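/- **Setting.** Let $K$ be a smooth function with $K(z)=1$ for $0\le z\le1$ and $K(z)=0$ for $z\ge4$. Let $0<\Lambda_R\le\Lambda_0$, $|A|\le\Lambda_R^3$, $|B|\le\Lambda_R^2$, and $\Delta_\Lambda(k)=K(k^2/\Lambda^2)/(k^2+B)$ on $\mathbb R^4$. Fix formal expansion parameters $\rho_4^R,\rho_5^R$ (renormalized relevant couplings, mass dimensions $1,0$) and $\rho_6^0,\rho_7^0,\rho_8^0$ (bare irrelevant couplings, mass dimension $-1$). For a multi-index $r\in\mathbb N^5$ put $|r|=r_1+\dots+r_5$ and $r_{NR}=r_3+r_4+r_5$. Let $L_n^{(r)}(k_1,\dots,k_n,\Lambda)$, $n\ge1$, $\Lambda\in[\Lambda_R,\Lambda_0]$, $\sum_i k_i=0$, be real vertex functions of $\phi^3+\phi^4$ theory in generalized perturbation theory. As functions of $k_1,\dots,k_{n-1}$ they are smooth, symmetric and $O(4)$-invariant, with all momentum derivatives jointly continuous in $(\Lambda,k)$. They vanish for $r=0$ and for $n>3|r|+2$. They solve the Polchinski equation at every order, $$\begin{aligned}\frac{d}{d\Lambda}L_n^{(r)}(k_1,\dots,k_n)=&-\frac12\sum_{S\subseteq\{1,\dots,n\}}\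 \sum_{s+s'=r}\frac{d\Delta_\Lambda}{d\Lambda}(K_S)\,L^{(s)}_{|S|+1}(k_S,-K_S)\,L^{(s')}_{n-|S|+1}(k_{S^c},K_S)\\&-\frac12\int\frac{d^4q}{(2\pi)^4}L^{(r)}_{n+2}(k_1,\dots,k_n,q,-q)\frac{d\Delta_\Lambda}{d\Lambda}(q)-\frac A2L^{(r)}_{n+1}(k_1,\dots,k_n,0)\frac{d\Delta_\Lambda}{d\Lambda}(0),\end{aligned}$$ with $K_S=\sum_{i\in S}k_i$. With $\partial_i^\mu$ the derivative in $k_i$ after eliminating $k_n$, the running couplings are, at zero momenta, $\rho_1=L_1$, $\rho_2=L_2$, $\rho_3\delta^{\mu\nu}=\partial_1^\mu\partial_1^\nu L_2$, $\rho_4=L_3$, $\rho_5=L_4$, $\rho_6\delta^{\mu\nu}=\partial^\mu_1\partial^\nu_1L_3$, $\rho_7\delta^{\mu\nu}=\partial^\mu_1\partial^\nu_2L_3$, $\rho_8=L_5$. One imposes, as identities between coefficients of formal series, $$\rho_1=\rho_2=\rho_3=0,\quad \rho_4=\rho_4^R,\quad \rho_5=\rho_5^R\quad\text{at }\Lambda_R,\qquad\qquad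 \rho_a=\rho_a^0\ \ (a=6,7,8)\quad\text{at }\Lambda_0.$$ To first order in the $\rho_a^0$ (and order zero in $\rho^R_4,\rho^R_5$), $L_5(\cdot,\Lambda_0)$ is momentum independent. For $n+p\ge6$ the bare functions satisfy $$\Lambda_0^{\,n-4+r_1-r_{NR}}\,\|\partial^pL_n^{(r)}(\Lambda_0)\|\le\Lambda_0^{-p}(\Lambda_0/\Lambda_R)^{r_1}\,\mathrm{Pln}(\Lambda_0/\Lambda_R),\qquad \|f\|=\sup_{|k_i|\le2\Lambda_0}|f|.$$ Here and below $\mathrm{Pln}(x)$ denotes a polynomial in $\ln x$ with nonnegative coefficients. It may depend on the order, on $n$, $p$ and on $a$, but not on the scales. **Notation.** Put $\lambda_a(\Lambda)=\Lambda\rho_a(\Lambda)$ and $\lambda_a^0(\Lambda)=\Lambda\rho_a^0$ for $a=6,7,8$, $\lambda_4^R(\Lambda)=\rho_4^R/\Lambda$ and $\lambda_5^R=\rho_5^R$. Let $\overline\lambda_a(\Lambda)$ be the part of $\lambda_a(\Lambda)$ of order zero in the bare irrelevant couplings. Put $\Delta\lambda_a(\Lambda)=\lambda_a(\Lambda)-\overline\lambda_a(\Lambda)$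 and $\Delta\lambda_a^R(\Lambda)=(\Lambda/\Lambda_R)\,\Delta\lambda_a(\Lambda_R)$. For $l\in\mathbb N^5$ put $|l|=l_1+\dots+l_5$ and $l_\Delta=l_3+l_4+l_5$. **Theorem (Inversion of the RG trajectory).** (i) There is a unique expansion, without constant term, of the bare couplings in formal power series $$\lambda_a^0(\Lambda)=\sum_l\lambda_a^{0\,(l)}(\Lambda)\,(\lambda_4^R)^{l_1}(\lambda_5^R)^{l_2}(\Delta\lambda_6^R)^{l_3}(\Delta\lambda_7^R)^{l_4}(\Delta\lambda_8^R)^{l_5},\qquad a=6,7,8,$$ that inverts the relation between the $\rho^0_a$ and the deviations at $\Lambda_R$. Let $\Delta\lambda_a^{(l)}(\Lambda)$ be the coefficients of $\Delta\lambda_a(\Lambda)$ expanded in the same way. If $$|\Delta\lambda_a^{(l)}(\Lambda)|\le\Big(\frac{\Lambda}{\Lambda_R}\Big)^{l_1}\Big(\frac{\Lambda_0}{\Lambda}\Big)^{l_\Delta}\frac{\Lambda}{\Lambda_0}\,\mathrm{Pln}\Big(\frac{\Lambda_0}{\Lambda_R}\Big)\qquad\text{for all }a,\ l,\ \Lambda_R\le\Lambda\le\Lambda_0,$$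 then $$|\lambda_a^{0\,(l)}(\Lambda)|\le\Big(\frac{\Lambda}{\Lambda_R}\Big)^{l_1}\Big(\frac{\Lambda_0}{\Lambda}\Big)^{l_\Delta}\frac{\Lambda}{\Lambda_0}\,\mathrm{Pln}\Big(\frac{\Lambda_0}{\Lambda_R}\Big)\qquad\text{for all }a,\ l,\ \Lambda_R\le\Lambda\le\Lambda_0.$$ The polynomials in the conclusion depend only on $K$ and on the polynomials in the hypotheses (besides $a$ and $l$), not on $\Lambda,\Lambda_0,\Lambda_R,A,B$ or the solution. (ii) Fix $\Lambda_R,A,B$, and for every $\Lambda_0\ge\Lambda_R$ a solution as above, with the same polynomials in the bounds on the bare functions. Then the coefficients of $\overline\lambda_a(\Lambda_R)=\overline\lambda_a(\Lambda_R,\Lambda_0)$ converge as $\Lambda_0\to\infty$, to those of a formal series $\lambda_a^{cont}(\Lambda_R)$ in $\lambda^R_4,\lambda_5^R$. Let $N\in\mathbb N$ and cut all series off after total order $N$. Let $g_4,g_5\in[-1,1]$ be the values of $\lambda_4^R(\Lambda_R),\lambda_5^R$. Let $\Lambda_D>\Lambda_R$, and let real numbers $\lambda_a^{NR}$, $a=6,7,8$,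 satisfy $$|\lambda_a^{NR}-\lambda_a^{cont}(\Lambda_R)|\le\frac{\Lambda_R}{\Lambda_D}\,\mathrm{Pln}\Big(\frac{\Lambda_D}{\Lambda_R}\Big).$$ For $\Lambda_R\le\Lambda_0\le\Lambda_D$ put $\delta_a=\lambda_a^{NR}-\overline\lambda_a(\Lambda_R,\Lambda_0)$, and let $\lambda_a^0(\Lambda)$ be given by the expansion in (i), cut off after order $N$, with $\Delta\lambda_a^R(\Lambda)=(\Lambda/\Lambda_R)\,\delta_a$ and $\lambda_4^R(\Lambda)=(\Lambda_R/\Lambda)\,g_4$. Then these bare couplings are small, $$|\lambda_a^0(\Lambda)|\le\frac{\Lambda}{\Lambda_0}\,\mathrm{Pln}\Big(\frac{\Lambda_0}{\Lambda_R}\Big),\qquad\Lambda_R\le\Lambda\le\Lambda_0,$$ and the improvement conditions are met up to terms of order $N+1$: with them, $\lambda_a(\Lambda_R,\Lambda_0)$ up to order $N$ satisfies $$|\lambda_a(\Lambda_R,\Lambda_0)-\lambda_a^{NR}|\le\frac{\Lambda_R}{\Lambda_0}\,\mathrm{Pln}\Big(\frac{\Lambda_0}{\Lambda_R}\Big)\,\varepsilon^{N+1}\qquad\text{whenever}\quad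 |g_4|,\ |g_5|,\ \frac{\Lambda_0}{\Lambda_R}|\delta_b|\le\varepsilon\ \ (b=6,7,8).$$ The polynomial in these two conclusions depends only on $K$, $N$ and the polynomials in the hypotheses. -/

import Mathlib

open Filter Topology
open scoped ContDiff

noncomputable section

namespace RGFlow

/-- Euclidean four-momenta. -/
abbrev Momentum : Type := EuclideanSpace ℝ (Fin 4)

/-- Orders of generalized perturbation theory. The five slots belong, in this order, to the
renormalized couplings `4`, `5` and to the irrelevant couplings `6`, `7`, `8` (either their bare
values or their deviations at the renormalization scale). -/
abbrev Order : Type := Fin 5 →₀ ℕ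

/-- The slots of the three irrelevant couplings `6`, `7`, `8`. -/
def irr : Fin 3 → Fin 5 := ![2, 3, 4]

/-- Total order in the irrelevant couplings. -/
def orderIrr (r : Order) : ℕ := r 2 + r 3 + r 4

/-- A perturbative effective potential: `L r m Λ` is the coefficient, at order `r` in the
(dimensionful) expansion parameters, of the vertex function with `m + 1` legs at scale `Λ`. It is a
function of the `m` independent momenta `k₁, …, kₘ`; the last momentum is
`- (k₁ + ⋯ + kₘ)` by momentum conservation. -/
abbrev VertexFunctions : Type := Order → (m : ℕ) → ℝ → (Fin m → Momentum) → ℝ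

/-- The momenta of all `m + 1` legs. -/
def allMomenta {m : ℕ} (k : Fin m → Momentum) : Fin (m + 1) → Momentum :=
  Fin.snoc (α := fun _ => Momentum) k (-∑ i, k i)

/-- A smooth momentum cutoff function. -/
structure IsCutoff (K : ℝ → ℝ) : Prop where
  smooth : ContDiff ℝ ∞ K
  eq_one : ∀ z, 0 ≤ z → z ≤ 1 → K z = 1
  eq_zero : ∀ z, 4 ≤ z → K z = 0

/-- The regularized propagator `K(k²/Λ²) / (k² + B)`. -/
def propagator (K : ℝ → ℝ) (B Λ : ℝ) (k : Momentum) : ℝ :=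
  K (‖k‖ ^ 2 / Λ ^ 2) / (‖k‖ ^ 2 + B)

/-- The derivative of the regularized propagator with respect to the scale. -/
def dPropagator (K : ℝ → ℝ) (B Λ : ℝ) (k : Momentum) : ℝ :=
  deriv (fun s => propagator K B s k) Λ

/-- Right-hand side of the Polchinski equation for the vertex function with `m + 1` legs at order
`r`: the tree term (a sum over all ways to distribute the external legs on two vertices joined by
one line, with the Cauchy product in the orders), the loop term, and the term with the coupling `A`
of the linear part of the free action. A vertex carrying the external legs in `S` and the internal
line has the independent momenta `kᵢ`, `i ∈ S`. -/
def flowRHS (K : ℝ → ℝ) (A B : ℝ) (L : VertexFunctions) (r : Order) (m : ℕ) (Λ : ℝ)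
    (k : Fin m → Momentum) : ℝ :=
  -(1 / 2) * ∑ S : Finset (Fin (m + 1)), ∑ s ∈ Finset.HasAntidiagonal.antidiagonal r,
      dPropagator K B Λ (∑ i ∈ S, allMomenta k i)
        * L s.1 S.card Λ (fun j => allMomenta k (S.orderEmbOfFin rfl j))
        * L s.2 Sᶜ.card Λ (fun j => allMomenta k (Sᶜ.orderEmbOfFin rfl j))
    - 1 / 2 * (((2 * Real.pi) ^ 4)⁻¹ *
        ∫ q : Momentum, L r (m + 2) Λ (Fin.snoc (α := fun _ => Momentum) (allMomenta k) q)
          * dPropagator K B Λ q)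
    - 1 / 2 * A * L r (m + 1) Λ (allMomenta k) * dPropagator K B Λ 0

/-- The derivative `∂ᵢ^μ ∂ⱼ^μ f` at zero momentum (no sum), with `μ` the first coordinate. For an
`O(4)`-invariant `f` the full matrix `∂ᵢ^μ ∂ⱼ^ν f` at zero is this number times `δ^{μν}`. -/
def secondDeriv {m : ℕ} (f : (Fin m → Momentum) → ℝ) (i j : Fin m) : ℝ :=
  iteratedFDeriv ℝ 2 f 0
    ![Pi.single i (EuclideanSpace.single 0 1), Pi.single j (EuclideanSpace.single 0 1)]

/-- The relevant running couplings `ρ₁, …, ρ₅` at order `r`. -/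
def rhoRel (L : VertexFunctions) (r : Order) (Λ : ℝ) : Fin 5 → ℝ :=
  ![L r 0 Λ 0, L r 1 Λ 0, secondDeriv (L r 1 Λ) 0 0, L r 2 Λ 0, L r 3 Λ 0]

/-- The irrelevant running couplings `ρ₆, ρ₇, ρ₈` (of mass dimension `-1`) at order `r`. -/
def rhoIrr (L : VertexFunctions) (r : Order) (Λ : ℝ) : Fin 3 → ℝ :=
  ![secondDeriv (L r 2 Λ) 0 0, secondDeriv (L r 2 Λ) 0 1, L r 4 Λ 0]

/-- `L` is, on the scales `[Λ_R, Λ₀]`, the solution in generalized perturbation theory of the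
Polchinski flow, with the relevant couplings renormalized at `Λ_R` and the couplings `ρ₆, ρ₇, ρ₈`
prescribed at the bare scale `Λ₀`. -/
structure IsPerturbativeFlow (K : ℝ → ℝ) (A B ΛR Λ0 : ℝ) (L : VertexFunctions) : Prop where
  /-- invariance under permutations of the independent momenta -/
  perm : ∀ r m, ∀ Λ ∈ Set.Icc ΛR Λ0, ∀ (σ : Equiv.Perm (Fin m)) (k : Fin m → Momentum),
    L r m Λ (fun i => k (σ i)) = L r m Λ k
  /-- invariance under the orthogonal group -/
  orthogonal : ∀ r m, ∀ Λ ∈ Set.Icc ΛR Λ0, ∀ (g : Momentum ≃ₗᵢ[ℝ] Momentum)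
    (k : Fin m → Momentum), L r m Λ (fun i => g (k i)) = L r m Λ k
  smooth : ∀ r m, ∀ Λ ∈ Set.Icc ΛR Λ0, ContDiff ℝ ∞ (L r m Λ)
  continuous : ∀ r m (p : ℕ), ContinuousOn
    (fun x : ℝ × (Fin m → Momentum) => iteratedFDeriv ℝ p (L r m x.1) x.2)
    (Set.Icc ΛR Λ0 ×ˢ Set.univ)
  /-- the Polchinski equation -/
  flow : ∀ r m, ∀ Λ ∈ Set.Icc ΛR Λ0, ∀ k : Fin m → Momentum,
    HasDerivWithinAt (fun s => L r m s k) (flowRHS K A B L r m Λ k) (Set.Icc ΛR Λ0) Λ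
  /-- there is no interaction at order zero -/
  zeroOrder : ∀ m, ∀ Λ ∈ Set.Icc ΛR Λ0, ∀ k : Fin m → Momentum, L 0 m Λ k = 0
  /-- at a given order there are at most `3 |r| + 2` legs -/
  finiteLegs : ∀ r m, ∀ Λ ∈ Set.Icc ΛR Λ0, 3 * r.degree + 2 < m + 1 →
    ∀ k : Fin m → Momentum, L r m Λ k = 0
  /-- renormalization conditions: `ρ₁ = ρ₂ = ρ₃ = 0`, and `ρ₄`, `ρ₅` are the first two expansion
  parameters -/
  renormalization : ∀ r, rhoRel L r ΛR =
    ![0, 0, 0, if r = Finsupp.single 0 1 then 1 else 0, if r = Finsupp.single 1 1 then 1 else 0]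
  /-- initial conditions: `ρ₆, ρ₇, ρ₈` at `Λ₀` are the last three expansion parameters -/
  initial : ∀ r a, rhoIrr L r Λ0 a = if r = Finsupp.single (irr a) 1 then 1 else 0
  /-- at first order in the bare irrelevant couplings the bare five-point function does not depend
  on the momenta -/
  initialLinear : ∀ (a : Fin 3) (k : Fin 4 → Momentum),
    L (Finsupp.single (irr a) 1) 4 Λ0 k = L (Finsupp.single (irr a) 1) 4 Λ0 0

/-- `Pln`: evaluation of a polynomial at a logarithm. -/
def pln (P : Polynomial ℝ) (x : ℝ) : ℝ := P.eval (Real.log x)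

/-- Polynomials with nonnegative coefficients. -/
def NonnegCoeffs (P : Polynomial ℝ) : Prop := ∀ i, 0 ≤ P.coeff i

/-- Smallness of the bare vertex functions `∂^p A_n^{(r)}`, `n + p ≥ 6`, where
`A_n^{(r)} = Λ^(n - 4 + r₁ - r_NR) L_n^{(r)}` is the dimensionless vertex function with
`n = m + 1` legs; the norm is the supremum over momenta of length at most `2 Λ₀`. -/
def SmallBare (P : Order → ℕ → ℕ → Polynomial ℝ) (ΛR Λ0 : ℝ) (L : VertexFunctions) : Prop :=
  ∀ r m p, 6 ≤ (m + 1) + p → ∀ k : Fin m → Momentum, (∀ i, ‖allMomenta k i‖ ≤ 2 * Λ0) →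
    Λ0 ^ (((m + 1 : ℕ) : ℤ) - 4 + (r 0 : ℤ) - (orderIrr r : ℤ))
        * ‖iteratedFDeriv ℝ p (L r m Λ0) k‖
      ≤ (Λ0 ^ p)⁻¹ * (Λ0 / ΛR) ^ r 0 * pln (P r m p) (Λ0 / ΛR)

/-- Passage to dimensionless expansion coefficients: if `f` is the expansion of a coupling `ρ` of
mass dimension `-1` in `ρ₄, ρ₅` (of dimension `1` and `0`) and three parameters of dimension `-1`,
this is the expansion of `Λ ρ` in the parameters made dimensionless with `Λ`. -/
def dimensionless (Λ : ℝ) (f : MvPowerSeries (Fin 5) ℝ) : MvPowerSeries (Fin 5) ℝ :=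
  fun r => Λ ^ (1 + (r 0 : ℤ) - (orderIrr r : ℤ)) * MvPowerSeries.coeff r f

/-- The running coupling `ρ_a(Λ)`, `a = 6, 7, 8`, as a formal power series in
`ρ₄ᴿ, ρ₅ᴿ, ρ₆⁰, ρ₇⁰, ρ₈⁰`. -/
def rhoSeries (L : VertexFunctions) (Λ : ℝ) (a : Fin 3) : MvPowerSeries (Fin 5) ℝ :=
  fun r => rhoIrr L r Λ a

/-- The deviation `Δρ_a(Λ)` of the running coupling from its value at vanishing bare irrelevant
couplings, as a formal power series in `ρ₄ᴿ, ρ₅ᴿ, ρ₆⁰, ρ₇⁰, ρ₈⁰`. -/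
def devSeries (L : VertexFunctions) (Λ : ℝ) (a : Fin 3) : MvPowerSeries (Fin 5) ℝ :=
  fun r => if orderIrr r = 0 then 0 else rhoIrr L r Λ a

/-- The substitution `(ρ₄ᴿ, ρ₅ᴿ, ρ₆⁰, ρ₇⁰, ρ₈⁰) = (X₀, X₁, H₆, H₇, H₈)`. -/
def insertBare (H : Fin 3 → MvPowerSeries (Fin 5) ℝ) : Fin 5 → MvPowerSeries (Fin 5) ℝ :=
  ![MvPowerSeries.X 0, MvPowerSeries.X 1, H 0, H 1, H 2]

/-- `H a` is the expansion of the bare coupling `ρ_a⁰` in `ρ₄ᴿ, ρ₅ᴿ` and in the deviations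
`Δρ₆(Λ_R), Δρ₇(Λ_R), Δρ₈(Λ_R)`. -/
structure IsInversion (L : VertexFunctions) (ΛR : ℝ) (H : Fin 3 → MvPowerSeries (Fin 5) ℝ) :
    Prop where
  constantCoeff : ∀ a, MvPowerSeries.constantCoeff (H a) = 0
  inverts : ∀ a, MvPowerSeries.subst (insertBare H) (devSeries L ΛR a)
    = MvPowerSeries.X (irr a)

/-- The dimensionless running coupling `λ_a(Λ)` as a series in
`λ₄ᴿ(Λ), λ₅ᴿ(Λ), λ₆⁰(Λ), λ₇⁰(Λ), λ₈⁰(Λ)`. -/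
def lamSeries (L : VertexFunctions) (Λ : ℝ) (a : Fin 3) : MvPowerSeries (Fin 5) ℝ :=
  dimensionless Λ (rhoSeries L Λ a)

/-- The dimensionless bare coupling `λ_a⁰(Λ) = Λ ρ_a⁰` as a series in
`λ₄ᴿ(Λ), λ₅ᴿ(Λ), Δλ₆ᴿ(Λ), Δλ₇ᴿ(Λ), Δλ₈ᴿ(Λ)`, where `Δλ_aᴿ(Λ) = (Λ/Λ_R) Δλ_a(Λ_R)`. -/
def lamBare (H : Fin 3 → MvPowerSeries (Fin 5) ℝ) (Λ : ℝ) (a : Fin 3) :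
    MvPowerSeries (Fin 5) ℝ :=
  dimensionless Λ (H a)

/-- The dimensionless deviation `Δλ_a(Λ)` as a series in
`λ₄ᴿ(Λ), λ₅ᴿ(Λ), Δλ₆ᴿ(Λ), Δλ₇ᴿ(Λ), Δλ₈ᴿ(Λ)`. -/
def lamDev (L : VertexFunctions) (H : Fin 3 → MvPowerSeries (Fin 5) ℝ) (Λ : ℝ) (a : Fin 3) :
    MvPowerSeries (Fin 5) ℝ :=
  dimensionless Λ (MvPowerSeries.subst (insertBare H) (devSeries L Λ a))

/-- The bound `(Λ/Λ_R)^l₁ (Λ₀/Λ)^l_Δ (Λ/Λ₀) Pln(Λ₀/Λ_R)` at every order and on all scales between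
`Λ_R` and `Λ₀`. -/
def CoeffBound (Q : Fin 3 → Order → Polynomial ℝ) (ΛR Λ0 : ℝ)
    (f : ℝ → Fin 3 → MvPowerSeries (Fin 5) ℝ) : Prop :=
  ∀ (a : Fin 3) (l : Order), ∀ Λ ∈ Set.Icc ΛR Λ0,
    |MvPowerSeries.coeff l (f Λ a)|
      ≤ (Λ / ΛR) ^ l 0 * (Λ0 / Λ) ^ orderIrr l * (Λ / Λ0) * pln (Q a l) (Λ0 / ΛR)

/-- Value, at the point `x`, of a formal power series cut off after total order `N`. -/
def evalUpTo (N : ℕ) (f : MvPowerSeries (Fin 5) ℝ) (x : Fin 5 → ℝ) : ℝ :=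
  ∑ d ∈ Finset.range (N + 1), ∑ l ∈ Finset.finsuppAntidiag Finset.univ d,
    MvPowerSeries.coeff l f * ∏ i, x i ^ l i

/-- The deviations, up to order `N`, of the prescribed values `ν` of `λ₆, λ₇, λ₈` at `Λ_R` from the
values these couplings take for vanishing bare irrelevant couplings; `g₄ = λ₄ᴿ(Λ_R)`,
`g₅ = λ₅ᴿ(Λ_R)`. -/
def prescribedDev (N : ℕ) (L : VertexFunctions) (ΛR g4 g5 : ℝ) (ν : Fin 3 → ℝ) (a : Fin 3) : ℝ :=
  ν a - evalUpTo N (lamSeries L ΛR a) ![g4, g5, 0, 0, 0]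

/-- The bare couplings `λ_a⁰(Λ)`, up to order `N`, belonging to the deviations `δ` at `Λ_R`. -/
def bareValue (N : ℕ) (H : Fin 3 → MvPowerSeries (Fin 5) ℝ) (ΛR g4 g5 : ℝ) (δ : Fin 3 → ℝ)
    (Λ : ℝ) (a : Fin 3) : ℝ :=
  evalUpTo N (lamBare H Λ a)
    ![ΛR / Λ * g4, g5, Λ / ΛR * δ 0, Λ / ΛR * δ 1, Λ / ΛR * δ 2]

end RGFlow

end

noncomputable section

namespace RGFlow

open MeasureTheory Set

/-! Part (i) is essentially algebra. At first order in a bare irrelevant coupling, ρ₆, ρ₇, ρ₈ do not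
run: an order of degree one cannot be split, so there is no tree term. The seven-point function
vanishes at this order, so the five-point function keeps its constant bare value. The loop term of
the three-point function is then momentum independent and drops out of second derivatives
(`IsPerturbativeFlow.rhoIrr_single`). Hence the deviations at Λ_R equal the bare couplings plus
terms of order at least two, and such a system of power series has a unique compositional inverse
(`existsUnique_formal_inverse`). For the estimate, the deviations at Λ₀ are the bare couplings
themselves. The hypothesis at Λ = Λ₀ therefore bounds the bare coefficients there, and dimensional
scaling carries the bound to every Λ with the same polynomial (`coeffBound_lamBare`).

Part (ii) rests on power counting. With n = m + 1 legs and p derivatives, the right-hand side of the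
flow has size Λ^(2-m-p) if the vertices have size Λ^(3-m-p). For m + p ≥ 4 one integrates down from
Λ₀. For m + p ≤ 3 one integrates up from Λ_R at zero momentum and reaches other momenta by Taylor's
formula. In both cases the endpoint value dominates up to one logarithm. The induction is on the
order, then downward in the legs, then downward in the derivatives (`exists_scaleBound`). It is
stated for an abstract `FlowSystem`, with prefactors c and at most one extra power of the scale,
because it is used for two systems.

The first system is the solution itself. An order containing irrelevant couplings gains a factor
Λ/Λ₀ over the naive size Λ_R^(-r₁) Λ₀^(r_NR), which bounds the deviations at Λ_R
(`exists_rhoIrr_bound`). The second consists of two solutions with bare scales Λ₀ ≤ Λ₀′ and their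
difference, at order zero in the irrelevant couplings. The difference has vanishing relevant data at
Λ_R and is merely bounded at Λ₀, so it gains Λ/Λ₀ (`exists_rhoIrr_rate`). Summing over dyadic scales
gives the continuum limit with a rate (`exists_limit_of_rate`).

The rest is finite-order analysis of power series in a weighted ℓ¹ norm, the parameters having the
natural sizes Λ_R, 1, Λ₀⁻¹, Λ₀⁻¹, Λ₀⁻¹. The norm is submultiplicative, so a logarithmic bound on the
deviations passes to their inverse through G = X - N(G), where X + N is the expansion being inverted
(`wnorm_inverse_le`). The distance of the prescribed values to the continuum limit and the rate of
convergence make the deviations at most Λ_R/Λ₀ up to logarithms, and evaluating the truncated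
inverse there shows that the bare couplings are small. The truncated series composed with its
truncated inverse is a polynomial that agrees with the identity through degree N, which gives the
error of order N + 1 (`abs_truncEval_comp_sub_le`, `exists_trajectory_bound`). -/

/-- A family of smooth functions whose derivatives depend continuously on the parameter. -/
structure SmoothFamily {X E F : Type} [TopologicalSpace X] [NormedAddCommGroup E]
    [NormedSpace ℝ E] [NormedAddCommGroup F] [NormedSpace ℝ F] (I : Set X) (u : X → E → F) :
    Prop where
  smooth : ∀ x ∈ I, ContDiff ℝ ∞ (u x)
  continuous : ∀ p : ℕ,
    ContinuousOn (fun y : X × E => iteratedFDeriv ℝ p (u y.1) y.2) (I ×ˢ univ)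

set_option linter.unusedSectionVars false

/-! ### Smooth families depending on a parameter, and differentiation under the integral -/

section Families

variable {X Y E F G H : Type} [TopologicalSpace X] [TopologicalSpace Y]
  [NormedAddCommGroup E] [NormedSpace ℝ E] [NormedAddCommGroup F] [NormedSpace ℝ F]
  [NormedAddCommGroup G] [NormedSpace ℝ G] [NormedAddCommGroup H] [NormedSpace ℝ H]

theorem natCast_le_infty (p : ℕ) : ((p : ℕ∞) : WithTop ℕ∞) ≤ ∞ := by
  exact_mod_cast le_top

theorem continuousOn_iteratedFDeriv_zero {I : Set X} {u : X → E → F} :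
    ContinuousOn (fun y : X × E => iteratedFDeriv ℝ 0 (u y.1) y.2) (I ×ˢ univ) ↔
      ContinuousOn (fun y : X × E => u y.1 y.2) (I ×ˢ univ) := by
  have : (fun y : X × E => iteratedFDeriv ℝ 0 (u y.1) y.2)
      = (continuousMultilinearCurryFin0 ℝ E F).symm ∘ (fun y : X × E => u y.1 y.2) := by
    ext y; simp [iteratedFDeriv_zero_eq_comp]
  rw [this]
  exact (continuousMultilinearCurryFin0 ℝ E F).symm.toHomeomorph.comp_continuousOn_iff _ _

theorem continuousOn_iteratedFDeriv_succ {I : Set X} {u : X → E → F} (p : ℕ) :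
    ContinuousOn (fun y : X × E => iteratedFDeriv ℝ (p + 1) (u y.1) y.2) (I ×ˢ univ) ↔
      ContinuousOn (fun y : X × E => iteratedFDeriv ℝ p (fderiv ℝ (u y.1)) y.2) (I ×ˢ univ) := by
  have : (fun y : X × E => iteratedFDeriv ℝ (p + 1) (u y.1) y.2)
      = (continuousMultilinearCurryRightEquiv' ℝ p E F).symm ∘
        (fun y : X × E => iteratedFDeriv ℝ p (fderiv ℝ (u y.1)) y.2) := by
    funext y
    rw [iteratedFDeriv_succ_eq_comp_right]; rfl
  rw [this]
  exact (continuousMultilinearCurryRightEquiv' ℝ p E F).symm.toHomeomorph.comp_continuousOn_iff _ _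

theorem SmoothFamily.continuousOn {I : Set X} {u : X → E → F} (hu : SmoothFamily I u) :
    ContinuousOn (fun y : X × E => u y.1 y.2) (I ×ˢ univ) :=
  continuousOn_iteratedFDeriv_zero.1 (hu.continuous 0)

theorem SmoothFamily.congr {I : Set X} {u v : X → E → F} (hu : SmoothFamily I u)
    (h : ∀ x ∈ I, v x = u x) : SmoothFamily I v where
  smooth x hx := by rw [h x hx]; exact hu.smooth x hx
  continuous p := (hu.continuous p).congr fun y hy => by rw [h y.1 hy.1]

theorem SmoothFamily.reparam {I : Set X} {J : Set Y} {u : X → E → F} (hu : SmoothFamily I u)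
    {φ : Y → X} (hφ : ContinuousOn φ J) (hJ : MapsTo φ J I) :
    SmoothFamily J (fun y => u (φ y)) where
  smooth y hy := hu.smooth _ (hJ hy)
  continuous p := by
    refine (hu.continuous p).comp (f := fun y : Y × E => (φ y.1, y.2)) ?_ ?_
    · exact (hφ.comp continuousOn_fst fun y hy => hy.1).prodMk continuousOn_snd
    · exact fun y hy => ⟨hJ hy.1, mem_univ _⟩

theorem SmoothFamily.mono {I J : Set X} {u : X → E → F} (hu : SmoothFamily I u) (h : J ⊆ I) :
    SmoothFamily J u :=
  hu.reparam continuousOn_id fun _ hx => h hx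

theorem smoothFamily_const (I : Set X) {f : E → F} (hf : ContDiff ℝ ∞ f) :
    SmoothFamily I (fun _ => f) where
  smooth _ _ := hf
  continuous p := ((hf.continuous_iteratedFDeriv (natCast_le_infty p)).comp
    continuous_snd).continuousOn

theorem smoothFamily_param {I : Set X} {c : X → F} (hc : ContinuousOn c I) :
    SmoothFamily I (fun x (_ : E) => c x) where
  smooth _ _ := contDiff_const
  continuous p := by
    cases p with
    | zero =>
      rw [continuousOn_iteratedFDeriv_zero (u := fun x (_ : E) => c x)]
      exact hc.comp continuousOn_fst fun y hy => hy.1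
    | succ p =>
      have : (fun y : X × E => iteratedFDeriv ℝ (p + 1) (fun _ : E => c y.1) y.2) = 0 := by
        funext y; simp [iteratedFDeriv_const_of_ne]
      rw [this]; exact continuousOn_const

theorem SmoothFamily.add {I : Set X} {u v : X → E → F} (hu : SmoothFamily I u)
    (hv : SmoothFamily I v) : SmoothFamily I (fun x k => u x k + v x k) where
  smooth x hx := (hu.smooth x hx).add (hv.smooth x hx)
  continuous p := ((hu.continuous p).add (hv.continuous p)).congr fun y hy =>
    iteratedFDeriv_add_apply (f := u y.1) (g := v y.1)
      ((hu.smooth _ hy.1).contDiffAt.of_le (natCast_le_infty p))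
      ((hv.smooth _ hy.1).contDiffAt.of_le (natCast_le_infty p))

theorem SmoothFamily.const_smul {I : Set X} {u : X → E → F} (hu : SmoothFamily I u) (c : ℝ) :
    SmoothFamily I (fun x k => c • u x k) where
  smooth x hx := contDiff_const.smul (hu.smooth x hx)
  continuous p := ((hu.continuous p).const_smul c).congr fun y hy =>
    iteratedFDeriv_const_smul_apply (f := u y.1)
      ((hu.smooth _ hy.1).contDiffAt.of_le (natCast_le_infty p))

theorem SmoothFamily.const_mul {I : Set X} {u : X → E → ℝ} (hu : SmoothFamily I u) (c : ℝ) :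
    SmoothFamily I (fun x k => c * u x k) := hu.const_smul c

theorem SmoothFamily.sub {I : Set X} {u v : X → E → F} (hu : SmoothFamily I u)
    (hv : SmoothFamily I v) : SmoothFamily I (fun x k => u x k - v x k) :=
  (hu.add (hv.const_smul (-1))).congr fun x _ => by funext k; simp [sub_eq_add_neg]

theorem SmoothFamily.sum {ι : Type} {I : Set X} {s : Finset ι} {u : ι → X → E → F}
    (hu : ∀ i ∈ s, SmoothFamily I (u i)) : SmoothFamily I (fun x k => ∑ i ∈ s, u i x k) := by
  classical
  induction s using Finset.induction_on with
  | empty => simpa using smoothFamily_const I (contDiff_const (c := (0 : F)))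
  | insert a s ha ih =>
    refine ((hu a (by simp)).add (ih fun i hi => hu i (by simp [hi]))).congr fun x _ => ?_
    funext k; simp [ha]

/-- Continuity of the derivatives of a product up to a fixed order. -/
theorem continuousOn_iteratedFDeriv_bilinear {E : Type} [NormedAddCommGroup E] [NormedSpace ℝ E]
    {I : Set X} (p : ℕ) :
    ∀ {F G H : Type} [NormedAddCommGroup F] [NormedSpace ℝ F] [NormedAddCommGroup G]
      [NormedSpace ℝ G] [NormedAddCommGroup H] [NormedSpace ℝ H] (B : F →L[ℝ] G →L[ℝ] H)
      {u : X → E → F} {v : X → E → G},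
      (∀ x ∈ I, ContDiff ℝ ∞ (u x)) → (∀ x ∈ I, ContDiff ℝ ∞ (v x)) →
      (∀ j ≤ p, ContinuousOn (fun y : X × E => iteratedFDeriv ℝ j (u y.1) y.2) (I ×ˢ univ)) →
      (∀ j ≤ p, ContinuousOn (fun y : X × E => iteratedFDeriv ℝ j (v y.1) y.2) (I ×ˢ univ)) →
      ContinuousOn (fun y : X × E => iteratedFDeriv ℝ p (fun k => B (u y.1 k) (v y.1 k)) y.2)
        (I ×ˢ univ) := by
  induction p with
  | zero =>
    intro F G H _ _ _ _ _ _ B u v hu hv cu cv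
    rw [continuousOn_iteratedFDeriv_zero (u := fun x k => B (u x k) (v x k))]
    exact (B.continuous.comp_continuousOn
      (continuousOn_iteratedFDeriv_zero.1 (cu 0 le_rfl))).clm_apply
      (continuousOn_iteratedFDeriv_zero.1 (cv 0 le_rfl))
  | succ p ih =>
    intro F G H _ _ _ _ _ _ B u v hu hv cu cv
    rw [continuousOn_iteratedFDeriv_succ (u := fun x k => B (u x k) (v x k))]
    have hu' : ∀ x ∈ I, ContDiff ℝ ∞ (fderiv ℝ (u x)) := fun x hx =>
      (contDiff_infty_iff_fderiv.1 (hu x hx)).2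
    have hv' : ∀ x ∈ I, ContDiff ℝ ∞ (fderiv ℝ (v x)) := fun x hx =>
      (contDiff_infty_iff_fderiv.1 (hv x hx)).2
    have cu' : ∀ j ≤ p, ContinuousOn
        (fun y : X × E => iteratedFDeriv ℝ j (fderiv ℝ (u y.1)) y.2) (I ×ˢ univ) :=
      fun j hj => (continuousOn_iteratedFDeriv_succ j).1 (cu (j + 1) (by omega))
    have cv' : ∀ j ≤ p, ContinuousOn
        (fun y : X × E => iteratedFDeriv ℝ j (fderiv ℝ (v y.1)) y.2) (I ×ˢ univ) :=
      fun j hj => (continuousOn_iteratedFDeriv_succ j).1 (cv (j + 1) (by omega))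
    -- The Leibniz rule replaces `B` by bilinear maps with values in spaces of linear maps, which is
    -- why the target spaces are quantified inside the induction on `p`.
    have h1 := ih (B.precompR E) hu hv' (fun j hj => cu j (by omega)) cv'
    have h2 := ih (B.precompL E) hu' hv cu' (fun j hj => cv j (by omega))
    refine (h1.add h2).congr fun y hy => ?_
    have e : fderiv ℝ (fun k => B (u y.1 k) (v y.1 k))
        = (fun k => B.precompR E (u y.1 k) (fderiv ℝ (v y.1) k))
          + (fun k => B.precompL E (fderiv ℝ (u y.1) k) (v y.1 k)) := by
      funext k
      exact B.fderiv_of_bilinear ((hu _ hy.1).differentiable (by simp) k)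
        ((hv _ hy.1).differentiable (by simp) k)
    change iteratedFDeriv ℝ p (fderiv ℝ (fun k => B (u y.1 k) (v y.1 k))) y.2 = _
    have s1 : ContDiff ℝ ∞ fun k => B.precompR E (u y.1 k) (fderiv ℝ (v y.1) k) :=
      (B.precompR E).isBoundedBilinearMap.contDiff.comp ((hu _ hy.1).prodMk (hv' _ hy.1))
    have s2 : ContDiff ℝ ∞ fun k => B.precompL E (fderiv ℝ (u y.1) k) (v y.1 k) :=
      (B.precompL E).isBoundedBilinearMap.contDiff.comp ((hu' _ hy.1).prodMk (hv _ hy.1))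
    rw [e]
    exact iteratedFDeriv_add_apply (s1.of_le (natCast_le_infty p)).contDiffAt
      (s2.of_le (natCast_le_infty p)).contDiffAt

theorem SmoothFamily.bilinear {I : Set X} (B : F →L[ℝ] G →L[ℝ] H) {u : X → E → F}
    {v : X → E → G} (hu : SmoothFamily I u) (hv : SmoothFamily I v) :
    SmoothFamily I (fun x k => B (u x k) (v x k)) where
  smooth x hx := B.isBoundedBilinearMap.contDiff.comp ((hu.smooth x hx).prodMk (hv.smooth x hx))
  continuous p := continuousOn_iteratedFDeriv_bilinear p B hu.smooth hv.smooth
    (fun j _ => hu.continuous j) (fun j _ => hv.continuous j)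

theorem SmoothFamily.mul {I : Set X} {u v : X → E → ℝ} (hu : SmoothFamily I u)
    (hv : SmoothFamily I v) : SmoothFamily I (fun x k => u x k * v x k) :=
  hu.bilinear (ContinuousLinearMap.mul ℝ ℝ) hv

theorem iteratedFDeriv_comp_affine {f : G → F} (hf : ContDiff ℝ ∞ f) (T : E →L[ℝ] G) (c : G)
    (p : ℕ) (k : E) :
    iteratedFDeriv ℝ p (fun k => f (T k + c)) k
      = (iteratedFDeriv ℝ p f (T k + c)).compContinuousLinearMap fun _ => T := by
  have h : ContDiff ℝ ∞ (fun y => f (y + c)) := hf.comp (contDiff_id.add contDiff_const)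
  have := T.iteratedFDeriv_comp_right h k (i := p) (natCast_le_infty p)
  rw [iteratedFDeriv_comp_add_right] at this
  exact this

theorem SmoothFamily.comp_affine {I : Set X} {u : X → G → F} (hu : SmoothFamily I u)
    (T : E →L[ℝ] G) {c : X → G} (hc : ContinuousOn c I) :
    SmoothFamily I (fun x k => u x (T k + c x)) where
  smooth x hx := (hu.smooth x hx).comp (T.contDiff.add contDiff_const)
  continuous p := by
    have h : ContinuousOn (fun y : X × E => (y.1, T y.2 + c y.1)) (I ×ˢ univ) :=
      continuousOn_fst.prodMk (((T.continuous.comp continuous_snd).continuousOn).add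
        (hc.comp continuousOn_fst fun y hy => hy.1))
    have h1 := (hu.continuous p).comp h fun y hy => ⟨hy.1, mem_univ _⟩
    refine ((ContinuousMultilinearMap.compContinuousLinearMapL
      (fun _ : Fin p => T)).continuous.comp_continuousOn h1).congr fun y hy => ?_
    exact iteratedFDeriv_comp_affine (hu.smooth _ hy.1) T _ p _

theorem SmoothFamily.comp_linear {I : Set X} {u : X → G → F} (hu : SmoothFamily I u)
    (T : E →L[ℝ] G) : SmoothFamily I (fun x k => u x (T k)) :=
  (hu.comp_affine T (c := fun _ => 0) continuousOn_const).congr fun x _ => by simp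

theorem norm_iteratedFDeriv_comp_affine_le {f : G → F} (hf : ContDiff ℝ ∞ f) (T : E →L[ℝ] G)
    (c : G) (p : ℕ) (k : E) :
    ‖iteratedFDeriv ℝ p (fun k => f (T k + c)) k‖
      ≤ ‖iteratedFDeriv ℝ p f (T k + c)‖ * ‖T‖ ^ p := by
  rw [iteratedFDeriv_comp_affine hf]
  refine (ContinuousMultilinearMap.norm_compContinuousLinearMap_le _ _).trans ?_
  simp

section Integral

variable {Q : Type} [TopologicalSpace Q] [MeasurableSpace Q] [OpensMeasurableSpace Q]
  [T2Space Q]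
  [ProperSpace E] [CompleteSpace F] {μ : Measure Q} [IsFiniteMeasureOnCompacts μ]

/-- Dominated differentiation, one order at a time: the derivative of order p + 1 is jointly
continuous, hence bounded on `C` times a closed unit ball, and a constant is integrable over the
compact set `C`. -/
theorem hasFTaylorSeriesUpTo_integral {C : Set Q} (hC : IsCompact C) {f : Q → E → F}
    (hf : SmoothFamily C f) :
    HasFTaylorSeriesUpTo ∞ (fun k => ∫ q in C, f q k ∂μ)
      (fun k p => ∫ q in C, iteratedFDeriv ℝ p (f q) k ∂μ) := by
  have hslice : ∀ (p : ℕ) (k : E), ContinuousOn (fun q => iteratedFDeriv ℝ p (f q) k) C :=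
    fun p k => (hf.continuous p).comp (continuousOn_id.prodMk continuousOn_const)
      fun q hq => ⟨hq, mem_univ _⟩
  have hint : ∀ (p : ℕ) (k : E),
      Integrable (fun q => iteratedFDeriv ℝ p (f q) k) (μ.restrict C) := fun p k =>
    (hslice p k).integrableOn_compact hC
  have hder : ∀ (p : ℕ) (k : E), HasFDerivAt (fun k => ∫ q in C, iteratedFDeriv ℝ p (f q) k ∂μ)
      (∫ q in C, iteratedFDeriv ℝ (p + 1) (f q) k ∂μ).curryLeft k := by
    intro p k
    obtain ⟨M, hM⟩ := (hC.prod (isCompact_closedBall k 1)).exists_bound_of_continuousOn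
      ((hf.continuous (p + 1)).mono (prod_mono_right (subset_univ _)))
    let e := (continuousMultilinearCurryLeftEquiv ℝ (fun _ : Fin (p + 1) => E) F)
    have key := hasFDerivAt_integral_of_dominated_of_fderiv_le (𝕜 := ℝ) (μ := μ.restrict C)
      (F := fun k q => iteratedFDeriv ℝ p (f q) k)
      (F' := fun k q => (iteratedFDeriv ℝ (p + 1) (f q) k).curryLeft)
      (bound := fun _ => M) (x₀ := k) (s := Metric.closedBall k 1)
      (Metric.closedBall_mem_nhds k one_pos)
      (Eventually.of_forall fun k' => (hint p k').1)
      (hint p k)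
      (e.continuous.comp_aestronglyMeasurable (hint (p + 1) k).1)
      ((ae_restrict_iff' hC.measurableSet).2 (Eventually.of_forall fun q hq x hx => by
        rw [ContinuousMultilinearMap.curryLeft_norm]; exact hM (q, x) ⟨hq, hx⟩))
      (integrableOn_const hC.measure_lt_top.ne)
      ((ae_restrict_iff' hC.measurableSet).2 (Eventually.of_forall fun q hq x _ => by
        have := ((hf.smooth q hq).ftaylorSeries).fderiv p
          (by exact_mod_cast ENat.natCast_lt_top p) x
        exact this))
    have : ∫ q in C, (iteratedFDeriv ℝ (p + 1) (f q) k).curryLeft ∂μ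
        = (∫ q in C, iteratedFDeriv ℝ (p + 1) (f q) k ∂μ).curryLeft := by
      let A : (E [×(p + 1)]→L[ℝ] F) →L[ℝ] (E →L[ℝ] (E [×p]→L[ℝ] F)) :=
        e.toContinuousLinearEquiv.toContinuousLinearMap
      exact ContinuousLinearMap.integral_comp_comm (𝕜 := ℝ) (Fₗ := E →L[ℝ] (E [×p]→L[ℝ] F)) A
        (hint (p + 1) k)
    rw [← this]; exact key
  refine ⟨fun k => ?_, fun p _ k => hder p k, fun p _ =>
    continuous_iff_continuousAt.2 fun k => (hder p k).continuousAt⟩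
  let e := continuousMultilinearCurryFin0 ℝ E F
  have := e.toContinuousLinearEquiv.toContinuousLinearMap.integral_comp_comm (hint 0 k)
  exact this.symm

theorem iteratedFDeriv_setIntegral {C : Set Q} (hC : IsCompact C) {f : Q → E → F}
    (hf : SmoothFamily C f) (p : ℕ) (k : E) :
    iteratedFDeriv ℝ p (fun k => ∫ q in C, f q k ∂μ) k
      = ∫ q in C, iteratedFDeriv ℝ p (f q) k ∂μ :=
  ((hasFTaylorSeriesUpTo_integral hC hf).eq_iteratedFDeriv (natCast_le_infty p) k).symm

theorem contDiff_setIntegral {C : Set Q} (hC : IsCompact C) {f : Q → E → F}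
    (hf : SmoothFamily C f) : ContDiff ℝ ∞ (fun k => ∫ q in C, f q k ∂μ) :=
  contDiff_infty.2 fun n =>
    ((hasFTaylorSeriesUpTo_integral hC hf).of_le (natCast_le_infty n)).contDiff

variable {I : Set X} {C : Set Q} {f : X → Q → E → F}

theorem integral_eq_setIntegral_of_support (h0 : ∀ x ∈ I, ∀ q ∉ C, f x q = 0) {x : X}
    (hx : x ∈ I) (k : E) : ∫ q, f x q k ∂μ = ∫ q in C, f x q k ∂μ :=
  (setIntegral_eq_integral_of_forall_compl_eq_zero fun q hq => by simp [h0 x hx q hq]).symm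

theorem SmoothFamily.slice (hf : SmoothFamily (I ×ˢ (univ : Set Q)) fun y k => f y.1 y.2 k)
    {x : X} (hx : x ∈ I) (D : Set Q) : SmoothFamily D (f x) :=
  hf.reparam (φ := fun q => (x, q)) (by fun_prop) fun _ _ => ⟨hx, mem_univ _⟩

/-- One compact set carries the integrands for all parameters. This allows derivatives to pass
inside and also gives joint continuity of the resulting integrals. -/
theorem SmoothFamily.integral (hC : IsCompact C)
    (hf : SmoothFamily (I ×ˢ (univ : Set Q)) fun y k => f y.1 y.2 k)
    (h0 : ∀ x ∈ I, ∀ q ∉ C, f x q = 0) :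
    SmoothFamily I (fun x k => ∫ q, f x q k ∂μ) := by
  have e : ∀ x ∈ I, (fun k => ∫ q, f x q k ∂μ) = fun k => ∫ q in C, f x q k ∂μ :=
    fun x hx => funext fun k => integral_eq_setIntegral_of_support h0 hx k
  refine ⟨fun x hx => by rw [e x hx]; exact contDiff_setIntegral hC (hf.slice hx C), fun p => ?_⟩
  have hz : ∀ x ∈ I, ∀ q ∉ C, ∀ k, iteratedFDeriv ℝ p (f x q) k = 0 := by
    intro x hx q hq k
    rw [h0 x hx q hq]; simp
  have h1 : ContinuousOn (fun y : X × E => ∫ q, iteratedFDeriv ℝ p (f y.1 q) y.2 ∂μ)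
      (I ×ˢ univ) := by
    refine continuousOn_integral_of_compact_support hC ?_ fun y q hy hq => hz _ hy.1 q hq _
    refine (hf.continuous p).comp
      (f := fun z : (X × E) × Q => ((z.1.1, z.2), z.1.2)) (by fun_prop) ?_
    exact fun z hz => ⟨⟨hz.1.1, mem_univ _⟩, mem_univ _⟩
  refine h1.congr fun y hy => ?_
  rw [e _ hy.1, iteratedFDeriv_setIntegral hC (hf.slice hy.1 C)]
  exact setIntegral_eq_integral_of_forall_compl_eq_zero fun q hq => hz _ hy.1 q hq _

theorem iteratedFDeriv_integral (hC : IsCompact C)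
    (hf : SmoothFamily (I ×ˢ (univ : Set Q)) fun y k => f y.1 y.2 k)
    (h0 : ∀ x ∈ I, ∀ q ∉ C, f x q = 0) {x : X} (hx : x ∈ I) (p : ℕ) (k : E) :
    iteratedFDeriv ℝ p (fun k => ∫ q, f x q k ∂μ) k
      = ∫ q in C, iteratedFDeriv ℝ p (f x q) k ∂μ := by
  have e : (fun k => ∫ q, f x q k ∂μ) = fun k => ∫ q in C, f x q k ∂μ :=
    funext fun k => integral_eq_setIntegral_of_support h0 hx k
  rw [e, iteratedFDeriv_setIntegral hC (hf.slice hx C)]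

end Integral

/-- Momentum derivatives commute with the scale derivative, in integrated form. -/
theorem iteratedFDeriv_sub_eq_integral [ProperSpace E] [CompleteSpace F] {a b : ℝ}
    {u g : ℝ → E → F} (hu : SmoothFamily (Icc a b) u) (hg : SmoothFamily (Icc a b) g)
    (hd : ∀ s ∈ Icc a b, ∀ k, HasDerivWithinAt (fun s => u s k) (g s k) (Icc a b) s)
    {s t : ℝ} (hs : a ≤ s) (hst : s ≤ t) (ht : t ≤ b) (p : ℕ) (k : E) :
    iteratedFDeriv ℝ p (u t) k - iteratedFDeriv ℝ p (u s) k
      = ∫ x in s..t, iteratedFDeriv ℝ p (g x) k := by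
  have hsub : Icc s t ⊆ Icc a b := Icc_subset_Icc hs ht
  have hg' : SmoothFamily (Icc s t) g := hg.mono hsub
  -- The fundamental theorem of calculus at each fixed momentum; the momentum derivatives are then
  -- taken under the scale integral.
  have e : (fun k => u t k - u s k) = fun k => ∫ x in Icc s t, g x k := by
    funext k
    rw [integral_Icc_eq_integral_Ioc, ← intervalIntegral.integral_of_le hst]
    refine (intervalIntegral.integral_eq_sub_of_hasDeriv_right
      (f := fun s => u s k) (f' := fun s => g s k) ?_ ?_ ?_).symm
    · rw [uIcc_of_le hst]
      exact fun x hx => ((hd x (hsub hx) k).mono hsub).continuousWithinAt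
    · intro x hx
      rw [min_eq_left hst, max_eq_right hst] at hx
      refine ((hd x (hsub (Ioo_subset_Icc_self hx)) k).hasDerivAt ?_).hasDerivWithinAt
      exact Icc_mem_nhds (hs.trans_lt hx.1) (hx.2.trans_le ht)
    · refine ContinuousOn.intervalIntegrable ?_
      rw [uIcc_of_le hst]
      exact hg'.continuousOn.comp (f := fun x => (x, k))
        (by fun_prop) fun x hx => ⟨hx, mem_univ _⟩
  have h1 : iteratedFDeriv ℝ p (fun k => u t k - u s k) k
      = iteratedFDeriv ℝ p (u t) k - iteratedFDeriv ℝ p (u s) k := by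
    have h2 := (hu.smooth t ⟨hs.trans hst, ht⟩).of_le (natCast_le_infty p)
    have h3 := (hu.smooth s ⟨hs, hst.trans ht⟩).of_le (natCast_le_infty p)
    exact iteratedFDeriv_sub_apply (f := u t) (g := u s) h2.contDiffAt h3.contDiffAt
  rw [← h1, e, iteratedFDeriv_setIntegral isCompact_Icc hg', integral_Icc_eq_integral_Ioc,
    ← intervalIntegral.integral_of_le hst]

end Families

/-! ### Flat profiles and the scale derivative of the propagator -/

/-- Smooth functions that vanish on `[0, 1]` and on `[4, ∞)`. -/
structure IsFlat (f : ℝ → ℝ) : Prop where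
  smooth : ContDiff ℝ ∞ f
  low : ∀ z ∈ Icc (0 : ℝ) 1, f z = 0
  high : ∀ z, 4 ≤ z → f z = 0

theorem deriv_eq_zero_of_eqOn_const {f : ℝ → ℝ} {s : Set ℝ} {c z : ℝ}
    (hf : DifferentiableAt ℝ f z) (hs : UniqueDiffWithinAt ℝ s z) (hz : z ∈ s)
    (h : ∀ x ∈ s, f x = c) : deriv f z = 0 := by
  rw [← hf.derivWithin hs, derivWithin_congr (f := fun _ => c) h (h z hz)]
  simp

theorem IsFlat.deriv {f : ℝ → ℝ} (hf : IsFlat f) : IsFlat (deriv f) where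
  smooth := (contDiff_infty_iff_deriv.1 hf.smooth).2
  low z hz := deriv_eq_zero_of_eqOn_const (hf.smooth.differentiable (by simp) z)
    (uniqueDiffOn_Icc_zero_one z hz) hz hf.low
  high z hz := deriv_eq_zero_of_eqOn_const (hf.smooth.differentiable (by simp) z)
    (uniqueDiffOn_Ici 4 z hz) hz hf.high

theorem IsCutoff.isFlat {K : ℝ → ℝ} (hK : IsCutoff K) : IsFlat (fun z => z * deriv K z) where
  smooth := contDiff_id.mul (contDiff_infty_iff_deriv.1 hK.smooth).2
  low z hz := by
    simp [deriv_eq_zero_of_eqOn_const (hK.smooth.differentiable (by simp) z)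
      (uniqueDiffOn_Icc_zero_one z hz) hz (fun x hx => hK.eq_one x hx.1 hx.2)]
  high z hz := by
    simp [deriv_eq_zero_of_eqOn_const (hK.smooth.differentiable (by simp) z)
      (uniqueDiffOn_Ici 4 z hz) hz hK.eq_zero]

/-- Induction by the mean value inequality: f(1) = 0, and f′ is again flat. This flatness at z = 1
compensates the zeros of k² + B, which can occur because B may be negative. -/
theorem IsFlat.bound (i : ℕ) : ∀ {f : ℝ → ℝ}, IsFlat f →
    ∃ C, 0 ≤ C ∧ ∀ z, 1 ≤ z → |f z| ≤ C * (z - 1) ^ i := by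
  induction i with
  | zero =>
    intro f hf
    obtain ⟨C, hC⟩ := (isCompact_Icc (a := (0 : ℝ)) (b := 4)).exists_bound_of_continuousOn
      hf.smooth.continuous.continuousOn
    have hC0 : 0 ≤ C := (norm_nonneg _).trans (hC 0 (by simp))
    refine ⟨C, hC0, fun z hz => ?_⟩
    rcases le_total 4 z with h | h
    · simpa [hf.high z h] using hC0
    · simpa using hC z ⟨by linarith, h⟩
  | succ i ih =>
    intro f hf
    obtain ⟨C, hC0, hC⟩ := ih hf.deriv
    refine ⟨C, hC0, fun z hz => ?_⟩
    have h := (convex_Icc (1 : ℝ) z).norm_image_sub_le_of_norm_deriv_le (f := f)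
      (C := C * (z - 1) ^ i) (x := 1) (y := z)
      (fun x _ => hf.smooth.differentiable (by simp) x) (fun x hx => ?_)
      (left_mem_Icc.2 hz) (right_mem_Icc.2 hz)
    · rw [hf.low 1 (by simp), sub_zero, Real.norm_eq_abs, Real.norm_eq_abs,
        abs_of_nonneg (by linarith : 0 ≤ z - 1)] at h
      rw [pow_succ, ← mul_assoc]; exact h
    · refine (hC x hx.1).trans ?_
      have := hx.1
      have := hx.2
      gcongr

/-- The building blocks `f(k²/s²) / (k² + B)^i` of the derivatives of the propagator. -/
def block (f : ℝ → ℝ) (i : ℕ) (B s : ℝ) (k : Momentum) : ℝ :=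
  f (‖k‖ ^ 2 / s ^ 2) / (‖k‖ ^ 2 + B) ^ i

theorem block_low {f : ℝ → ℝ} (hf : IsFlat f) (i : ℕ) (B : ℝ) {s : ℝ} (hs : 0 < s) {k : Momentum}
    (hk : ‖k‖ ^ 2 ≤ s ^ 2) : block f i B s k = 0 := by
  rw [block, hf.low _ ⟨by positivity, (div_le_one (by positivity)).2 hk⟩, zero_div]

theorem block_high {f : ℝ → ℝ} (hf : IsFlat f) (i : ℕ) (B : ℝ) {s : ℝ} (hs : 0 < s) {k : Momentum}
    (hk : 2 * s ≤ ‖k‖) : block f i B s k = 0 := by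
  rw [block, hf.high _ ((le_div_iff₀ (by positivity)).2 ?_), zero_div]
  calc 4 * s ^ 2 = (2 * s) ^ 2 := by ring
    _ ≤ ‖k‖ ^ 2 := by gcongr

/-- Since |B| ≤ s², one has k²/s² - 1 ≤ (k² + B)/s², so flatness at z = 1 beats any power of the
denominator. The surplus power j serves different ends: j = 0 for uniform bounds, j = 1 for
continuity and j = 2 for differentiability where k² + B = 0. -/
theorem block_bound {f : ℝ → ℝ} (hf : IsFlat f) (i j : ℕ) : ∃ C, 0 ≤ C ∧ ∀ (B s : ℝ)
    (k : Momentum), 0 < s → |B| ≤ s ^ 2 →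
      |block f i B s k| ≤ C * |‖k‖ ^ 2 + B| ^ j / s ^ (2 * (i + j)) := by
  obtain ⟨C, hC0, hC⟩ := hf.bound (i + j)
  refine ⟨C, hC0, fun B s k hs hB => ?_⟩
  rcases le_or_gt (‖k‖ ^ 2) (s ^ 2) with h | h
  · rw [block_low hf i B hs h, abs_zero]; positivity
  · have hs2 : 0 < s ^ 2 := by positivity
    have hq : 0 < ‖k‖ ^ 2 + B := by have := neg_le_of_abs_le hB; linarith
    have hz : 1 ≤ ‖k‖ ^ 2 / s ^ 2 := (one_le_div hs2).2 h.le
    have h1 : ‖k‖ ^ 2 / s ^ 2 - 1 ≤ (‖k‖ ^ 2 + B) / s ^ 2 := by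
      rw [le_div_iff₀ hs2, sub_mul, div_mul_cancel₀ _ hs2.ne']
      have := neg_le_of_abs_le hB; linarith
    have h2 : |f (‖k‖ ^ 2 / s ^ 2)| ≤ C * ((‖k‖ ^ 2 + B) / s ^ 2) ^ (i + j) :=
      (hC _ hz).trans (by
        have : 0 ≤ ‖k‖ ^ 2 / s ^ 2 - 1 := by linarith
        gcongr)
    rw [block, abs_div, abs_of_pos (pow_pos hq i), abs_of_pos hq, div_le_iff₀ (pow_pos hq i)]
    refine h2.trans (le_of_eq ?_)
    rw [div_pow, ← pow_mul]
    field_simp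
    ring

theorem hasFDerivAt_block {f : ℝ → ℝ} (hf : IsFlat f) (i : ℕ) {B s : ℝ} (hs : 0 < s)
    (hB : |B| ≤ s ^ 2) (k : Momentum) :
    HasFDerivAt (block f i B s)
      (block (deriv f) i B s k • ((2 / s ^ 2) • innerSL ℝ k)
        + block f (i + 1) B s k • ((-2 * (i : ℝ)) • innerSL ℝ k)) k := by
  have hn : HasFDerivAt (fun k : Momentum => ‖k‖ ^ 2) (2 • innerSL ℝ k) k :=
    (hasStrictFDerivAt_norm_sq k).hasFDerivAt
  by_cases hq : ‖k‖ ^ 2 + B = 0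
  -- At a zero of the denominator the block vanishes, and nearby it is dominated by a multiple of
  -- (k² + B)², whose derivative vanishes there. So its derivative is zero, in agreement with the
  -- formula.
  · have hk : ‖k‖ ^ 2 ≤ s ^ 2 := by have := neg_le_of_abs_le hB; linarith
    rw [block_low hf.deriv i B hs hk, block_low hf (i + 1) B hs hk, zero_smul, zero_smul, add_zero]
    obtain ⟨C, hC0, hC⟩ := block_bound hf i 2
    have hh : HasFDerivAt (fun k : Momentum => (‖k‖ ^ 2 + B) ^ 2) (0 : Momentum →L[ℝ] ℝ) k := by
      have := (hn.add_const B).pow 2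
      simpa [hq] using this
    rw [hasFDerivAt_iff_isLittleO] at hh ⊢
    refine Asymptotics.IsBigO.trans_isLittleO ?_ hh
    refine Asymptotics.IsBigO.of_bound (C / s ^ (2 * (i + 2))) (Eventually.of_forall fun x => ?_)
    have := hC B s x hs hB
    simp only [block_low hf i B hs hk, hq, zero_pow two_ne_zero, zero_apply,
      sub_zero, Real.norm_eq_abs]
    rw [abs_pow, div_mul_eq_mul_div]
    exact this
  · have hφ : HasDerivAt (fun w => f (w / s ^ 2) / (w + B) ^ i)
        ((deriv f (‖k‖ ^ 2 / s ^ 2) * (1 / s ^ 2) * (‖k‖ ^ 2 + B) ^ i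
          - f (‖k‖ ^ 2 / s ^ 2) * (i * (‖k‖ ^ 2 + B) ^ (i - 1) * 1))
          / ((‖k‖ ^ 2 + B) ^ i) ^ 2) (‖k‖ ^ 2) := by
      refine HasDerivAt.div ?_ ?_ (pow_ne_zero i hq)
      · exact ((hf.smooth.differentiable (by simp) _).hasDerivAt).comp (‖k‖ ^ 2)
          ((hasDerivAt_id _).div_const _)
      · exact ((hasDerivAt_id _).add_const B).pow i
    refine (hφ.comp_hasFDerivAt k hn).congr_fderiv ?_
    ext v
    simp only [block, smul_apply, add_apply, smul_eq_mul,
      nsmul_eq_mul, innerSL_apply_apply]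
    cases i with
    | zero => simp; ring
    | succ n =>
      simp only [Nat.add_sub_cancel]
      push_cast
      field_simp
      ring

theorem fderiv_block {f : ℝ → ℝ} (hf : IsFlat f) (i : ℕ) {B s : ℝ} (hs : 0 < s)
    (hB : |B| ≤ s ^ 2) :
    fderiv ℝ (block f i B s) = (fun k => block (deriv f) i B s k • ((2 / s ^ 2) • innerSL ℝ k))
      + fun k => block f (i + 1) B s k • ((-2 * (i : ℝ)) • innerSL ℝ k) :=
  funext fun k => (hasFDerivAt_block hf i hs hB k).fderiv

/-- The derivative of a block is a combination of blocks with smooth coefficients, so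
differentiability of all blocks bootstraps to every order. -/
theorem contDiff_block {B s : ℝ} (hs : 0 < s) (hB : |B| ≤ s ^ 2) {f : ℝ → ℝ} (hf : IsFlat f)
    (i : ℕ) : ContDiff ℝ ∞ (block f i B s) := by
  rw [contDiff_infty]
  intro n
  induction n generalizing f i with
  | zero =>
    exact contDiff_zero.2 (continuous_iff_continuousAt.2 fun k =>
      (hasFDerivAt_block hf i hs hB k).continuousAt)
  | succ n ih =>
    have : ((n + 1 : ℕ) : WithTop ℕ∞) = (n : WithTop ℕ∞) + 1 := by push_cast; rfl
    rw [this, contDiff_succ_iff_fderiv]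
    refine ⟨fun k => (hasFDerivAt_block hf i hs hB k).differentiableAt, by simp, ?_⟩
    rw [fderiv_block hf i hs hB]
    exact ((ih hf.deriv i).smul ((innerSL ℝ).contDiff.const_smul _)).add
      ((ih hf (i + 1)).smul ((innerSL ℝ).contDiff.const_smul _))

theorem continuousOn_block {ΛR B : ℝ} (hR : 0 < ΛR) (hB : |B| ≤ ΛR ^ 2) {f : ℝ → ℝ}
    (hf : IsFlat f) (i : ℕ) :
    ContinuousOn (fun y : ℝ × Momentum => block f i B y.1 y.2) (Ici ΛR ×ˢ univ) := by
  rintro ⟨s, k⟩ ⟨hs, -⟩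
  have hs0 : 0 < s := hR.trans_le hs
  by_cases hq : ‖k‖ ^ 2 + B = 0
  · have hk : ‖k‖ ^ 2 ≤ s ^ 2 := by
      have := neg_le_of_abs_le hB
      have : ΛR ^ 2 ≤ s ^ 2 := pow_le_pow_left₀ hR.le hs 2
      linarith
    obtain ⟨C, hC0, hC⟩ := block_bound hf i 1
    rw [ContinuousWithinAt, show block f i B (s, k).1 (s, k).2 = 0 from block_low hf i B hs0 hk]
    have hlim : Tendsto (fun y : ℝ × Momentum => C * |‖y.2‖ ^ 2 + B| ^ 1 / y.1 ^ (2 * (i + 1)))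
        (𝓝[Ici ΛR ×ˢ univ] (s, k)) (𝓝 0) := by
      have hc : ContinuousAt (fun y : ℝ × Momentum =>
          C * |‖y.2‖ ^ 2 + B| ^ 1 / y.1 ^ (2 * (i + 1))) (s, k) :=
        ContinuousAt.div (by fun_prop) (by fun_prop) (by positivity)
      have := hc.tendsto
      simp only [hq, abs_zero, pow_one, mul_zero, zero_div] at this
      simpa using this.mono_left nhdsWithin_le_nhds
    refine squeeze_zero_norm' ?_ hlim
    filter_upwards [self_mem_nhdsWithin] with y hy
    exact hC B y.1 y.2 (hR.trans_le hy.1) (hB.trans (pow_le_pow_left₀ hR.le hy.1 2))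
  · refine ContinuousAt.continuousWithinAt ?_
    have h1 : ContinuousAt (fun y : ℝ × Momentum => ‖y.2‖ ^ 2 / y.1 ^ 2) (s, k) :=
      ContinuousAt.div (by fun_prop) (by fun_prop) (by positivity)
    have h2 : ContinuousAt (fun y : ℝ × Momentum => f (‖y.2‖ ^ 2 / y.1 ^ 2)) (s, k) :=
      ContinuousAt.comp (g := f) hf.smooth.continuous.continuousAt h1
    exact h2.div (by fun_prop) (pow_ne_zero i hq)

theorem smoothFamily_block {ΛR B : ℝ} (hR : 0 < ΛR) (hB : |B| ≤ ΛR ^ 2) {f : ℝ → ℝ}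
    (hf : IsFlat f) (i : ℕ) : SmoothFamily (Ici ΛR) (block f i B) := by
  have hpos : ∀ s ∈ Ici ΛR, 0 < s := fun s hs => hR.trans_le hs
  have hBs : ∀ s ∈ Ici ΛR, |B| ≤ s ^ 2 := fun s hs => hB.trans (pow_le_pow_left₀ hR.le hs 2)
  have hsm : ∀ {f}, IsFlat f → ∀ i, ∀ s ∈ Ici ΛR, ContDiff ℝ ∞ (block f i B s) :=
    fun hf i s hs => contDiff_block (hpos s hs) (hBs s hs) hf i
  refine ⟨hsm hf i, fun p => ?_⟩
  induction p using Nat.strong_induction_on generalizing f i with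
  | _ p ih =>
    cases p with
    | zero =>
      rw [continuousOn_iteratedFDeriv_zero (u := block f i B)]
      exact continuousOn_block hR hB hf i
    | succ p =>
      rw [continuousOn_iteratedFDeriv_succ (u := block f i B)]
      have hlin : SmoothFamily (Ici ΛR) (fun (_ : ℝ) (k : Momentum) => innerSL ℝ k) :=
        smoothFamily_const _ (innerSL ℝ (E := Momentum)).contDiff
      have hl1 : SmoothFamily (Ici ΛR)
          (fun (s : ℝ) (k : Momentum) => (2 / s ^ 2) • innerSL ℝ k) :=
        SmoothFamily.bilinear (ContinuousLinearMap.lsmul ℝ ℝ)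
          (smoothFamily_param (c := fun s : ℝ => 2 / s ^ 2) (by
            refine ContinuousOn.div (by fun_prop) (by fun_prop) fun s hs => ?_
            have := hpos s hs; positivity)) hlin
      have hl2 : SmoothFamily (Ici ΛR)
          (fun (s : ℝ) (k : Momentum) => (-2 * (i : ℝ)) • innerSL ℝ k) := hlin.const_smul _
      -- Only derivatives of the blocks up to order `p` are known to be jointly continuous at this
      -- stage, so the product rule with a bounded number of derivatives is needed.
      have h1 := continuousOn_iteratedFDeriv_bilinear p (ContinuousLinearMap.lsmul ℝ ℝ)
        (hsm hf.deriv i) hl1.smooth (fun j hj => ih j (by omega) hf.deriv i)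
        (fun j _ => hl1.continuous j)
      have h2 := continuousOn_iteratedFDeriv_bilinear p (ContinuousLinearMap.lsmul ℝ ℝ)
        (hsm hf (i + 1)) hl2.smooth (fun j hj => ih j (by omega) hf (i + 1))
        (fun j _ => hl2.continuous j)
      refine (h1.add h2).congr fun y hy => ?_
      change iteratedFDeriv ℝ p (fderiv ℝ (block f i B y.1)) y.2 = _
      rw [fderiv_block hf i (hpos _ hy.1) (hBs _ hy.1)]
      exact iteratedFDeriv_add_apply
        (((hsm hf.deriv i _ hy.1).smul (hl1.smooth _ hy.1)).of_le
          (natCast_le_infty p)).contDiffAt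
        (((hsm hf (i + 1) _ hy.1).smul (hl2.smooth _ hy.1)).of_le
          (natCast_le_infty p)).contDiffAt

theorem iteratedFDeriv_eq_zero_of_support {E F : Type} [NormedAddCommGroup E] [NormedSpace ℝ E]
    [NormedAddCommGroup F] [NormedSpace ℝ F] {f : E → F} {r : ℝ} (h : ∀ k, r ≤ ‖k‖ → f k = 0)
    (p : ℕ) {k : E} (hk : r < ‖k‖) : iteratedFDeriv ℝ p f k = 0 := by
  have : f =ᶠ[𝓝 k] 0 := by
    filter_upwards [(isOpen_lt continuous_const continuous_norm).mem_nhds hk] with x hx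
    exact h x (le_of_lt hx)
  rw [(this.iteratedFDeriv ℝ p).eq_of_nhds]
  simp

theorem norm_iteratedFDeriv_smul_innerSL_le {s : ℝ} (hs : 0 < s) (c : ℝ) (p : ℕ) {k : Momentum}
    (hk : ‖k‖ ≤ 2 * s) :
    ‖iteratedFDeriv ℝ p (fun k : Momentum => c • innerSL ℝ k) k‖ ≤ |c| * (2 * s / s ^ p) := by
  have e : (fun k : Momentum => c • innerSL ℝ k) = c • fun k : Momentum => innerSL ℝ k := rfl
  rw [e, iteratedFDeriv_const_smul_apply ((innerSL ℝ (E := Momentum)).contDiff.contDiffAt),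
    norm_smul, Real.norm_eq_abs]
  gcongr
  match p with
  | 0 =>
    rw [norm_iteratedFDeriv_zero, innerSL_apply_norm, pow_zero, div_one]
    exact hk
  | 1 =>
    rw [norm_iteratedFDeriv_one, pow_one, mul_div_cancel_right₀ _ hs.ne']
    have : fderiv ℝ (fun k : Momentum => innerSL ℝ k) k = innerSL ℝ :=
      (innerSL ℝ (E := Momentum)).fderiv
    rw [this]
    refine (ContinuousLinearMap.opNorm_le_bound _ zero_le_one fun x => ?_).trans one_le_two
    simp
  | p + 2 =>
    have : fderiv ℝ (fun k : Momentum => innerSL ℝ k) = fun _ => innerSL ℝ :=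
      funext fun k => (innerSL ℝ (E := Momentum)).fderiv
    rw [← norm_iteratedFDeriv_fderiv, this, iteratedFDeriv_const_of_ne (by omega)]
    simp only [Pi.zero_apply, norm_zero]
    positivity

/-- A derivative either hits the profile, producing 2k/s², or raises the power of the denominator,
producing -2ik. On the support ‖k‖ ≤ 2s both cost a factor of order 1/s. -/
theorem block_deriv_bound (p : ℕ) {f : ℝ → ℝ} (hf : IsFlat f) (i : ℕ) :
    ∃ C, 0 ≤ C ∧ ∀ (B s : ℝ) (k : Momentum), 0 < s → |B| ≤ s ^ 2 →
      ‖iteratedFDeriv ℝ p (block f i B s) k‖ ≤ C / s ^ (2 * i + p) := by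
  induction p using Nat.strong_induction_on generalizing f i with
  | _ p ih =>
    cases p with
    | zero =>
      obtain ⟨C, hC0, hC⟩ := block_bound hf i 0
      exact ⟨C, hC0, fun B s k hs hB => by simpa using hC B s k hs hB⟩
    | succ p =>
      have h1 : ∃ C, 0 ≤ C ∧ ∀ j ≤ p, ∀ (B s : ℝ) (k : Momentum), 0 < s → |B| ≤ s ^ 2 →
          ‖iteratedFDeriv ℝ j (block (deriv f) i B s) k‖ ≤ C / s ^ (2 * i + j) ∧
          ‖iteratedFDeriv ℝ j (block f (i + 1) B s) k‖ ≤ C / s ^ (2 * (i + 1) + j) := by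
        choose! C1 hC1 h1 using fun j (hj : j < p + 1) => ih j hj hf.deriv i
        choose! C2 hC2 h2 using fun j (hj : j < p + 1) => ih j hj hf (i + 1)
        have hle : ∀ j ≤ p, C1 j ≤ ∑ l ∈ Finset.range (p + 1), (C1 l + C2 l) ∧
            C2 j ≤ ∑ l ∈ Finset.range (p + 1), (C1 l + C2 l) := by
          intro j hj
          have := Finset.single_le_sum (f := fun l => C1 l + C2 l) (s := Finset.range (p + 1))
            (fun l hl => add_nonneg (hC1 l (Finset.mem_range.1 hl)) (hC2 l (Finset.mem_range.1 hl)))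
            (Finset.mem_range.2 (Nat.lt_succ_of_le hj))
          have a1 := hC1 j (by omega)
          have a2 := hC2 j (by omega)
          exact ⟨by linarith, by linarith⟩
        refine ⟨∑ l ∈ Finset.range (p + 1), (C1 l + C2 l), Finset.sum_nonneg fun l hl =>
          add_nonneg (hC1 l (Finset.mem_range.1 hl)) (hC2 l (Finset.mem_range.1 hl)), ?_⟩
        intro j hj B s k hs hB
        refine ⟨(h1 j (by omega) B s k hs hB).trans ?_, (h2 j (by omega) B s k hs hB).trans ?_⟩
        · have := (hle j hj).1; gcongr
        · have := (hle j hj).2; gcongr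
      obtain ⟨C, hC0, hC⟩ := h1
      -- The factor 2^p is the sum of the binomial coefficients in the Leibniz rule; 4 and 4i come
      -- from |c| · 2s with c = 2/s² and c = -2i.
      refine ⟨2 ^ p * (4 * C) + 2 ^ p * (4 * i * C), by positivity, fun B s k hs hB => ?_⟩
      rcases lt_or_ge (2 * s) ‖k‖ with hk | hk
      · rw [iteratedFDeriv_eq_zero_of_support (fun x hx => block_high hf i B hs hx) _ hk, norm_zero]
        positivity
      rw [← norm_iteratedFDeriv_fderiv, fderiv_block hf i hs hB]
      have s1 := contDiff_block hs hB hf.deriv i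
      have s2 := contDiff_block hs hB hf (i + 1)
      have l1 : ∀ c : ℝ, ContDiff ℝ ∞ (fun k : Momentum => c • innerSL ℝ k) :=
        fun c => (innerSL ℝ (E := Momentum)).contDiff.const_smul c
      have hsum : ∀ c : ℝ, ∑ j ∈ Finset.range (p + 1), (p.choose j : ℝ) * c = 2 ^ p * c := by
        intro c
        rw [← Finset.sum_mul]
        congr 1
        exact_mod_cast Nat.sum_range_choose p
      rw [iteratedFDeriv_add_apply (f := fun k => block (deriv f) i B s k • _)
        (g := fun k => block f (i + 1) B s k • _)
        ((s1.smul (l1 _)).of_le (natCast_le_infty p)).contDiffAt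
        ((s2.smul (l1 _)).of_le (natCast_le_infty p)).contDiffAt]
      refine (norm_add_le _ _).trans ?_
      rw [add_div]
      refine add_le_add ?_ ?_
      · refine (norm_iteratedFDeriv_smul_le s1 (l1 _) k (natCast_le_infty p)).trans ?_
        rw [mul_div_assoc, ← hsum]
        refine Finset.sum_le_sum fun j hj => ?_
        have hj' : j ≤ p := Nat.lt_succ_iff.1 (Finset.mem_range.1 hj)
        rw [mul_assoc]
        refine mul_le_mul_of_nonneg_left ?_ (by positivity)
        refine (mul_le_mul (hC j hj' B s k hs hB).1
          (norm_iteratedFDeriv_smul_innerSL_le hs (2 / s ^ 2) (p - j) hk) (norm_nonneg _)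
          (by positivity)).trans (le_of_eq ?_)
        obtain ⟨d, rfl⟩ := Nat.exists_eq_add_of_le hj'
        rw [Nat.add_sub_cancel_left, abs_of_pos (by positivity)]
        field_simp
        ring
      · refine (norm_iteratedFDeriv_smul_le s2 (l1 _) k (natCast_le_infty p)).trans ?_
        rw [mul_div_assoc, ← hsum]
        refine Finset.sum_le_sum fun j hj => ?_
        have hj' : j ≤ p := Nat.lt_succ_iff.1 (Finset.mem_range.1 hj)
        rw [mul_assoc]
        refine mul_le_mul_of_nonneg_left ?_ (by positivity)
        refine (mul_le_mul (hC j hj' B s k hs hB).2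
          (norm_iteratedFDeriv_smul_innerSL_le hs (-2 * (i : ℝ)) (p - j) hk) (norm_nonneg _)
          (by positivity)).trans (le_of_eq ?_)
        obtain ⟨d, rfl⟩ := Nat.exists_eq_add_of_le hj'
        rw [Nat.add_sub_cancel_left, abs_mul, abs_neg, abs_two, Nat.abs_cast]
        field_simp
        ring

theorem dPropagator_eq {K : ℝ → ℝ} (hK : IsCutoff K) (B : ℝ) {s : ℝ} (hs : 0 < s)
    (k : Momentum) :
    dPropagator K B s k = -2 / s * block (fun z => z * deriv K z) 1 B s k := by
  have h1 : HasDerivAt (fun t : ℝ => ‖k‖ ^ 2 / t ^ 2) (-2 * ‖k‖ ^ 2 / s ^ 3) s := by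
    have := ((hasDerivAt_const s (‖k‖ ^ 2)).div (hasDerivAt_pow 2 s) (by positivity))
    refine this.congr_deriv ?_
    field_simp
    norm_num
    ring
  have h2 := (((hK.smooth.differentiable (by simp) _).hasDerivAt).comp s h1).div_const
    (‖k‖ ^ 2 + B)
  have h3 : dPropagator K B s k = _ := h2.deriv
  rw [h3, block, pow_one, ← mul_div_assoc]
  field_simp

/-- At k = 0 the argument of the cutoff is 0 for every s, so the propagator there is independent of
the scale. This removes the term with A from the flow. -/
theorem dPropagator_zero (K : ℝ → ℝ) (B s : ℝ) : dPropagator K B s 0 = 0 := by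
  simp [dPropagator, propagator]

theorem dPropagator_support {K : ℝ → ℝ} (hK : IsCutoff K) (B : ℝ) {s : ℝ} (hs : 0 < s)
    {k : Momentum} (hk : 2 * s ≤ ‖k‖) : dPropagator K B s k = 0 := by
  rw [dPropagator_eq hK B hs, block_high hK.isFlat 1 B hs hk, mul_zero]

theorem smoothFamily_dPropagator {K : ℝ → ℝ} (hK : IsCutoff K) {ΛR B : ℝ} (hR : 0 < ΛR)
    (hB : |B| ≤ ΛR ^ 2) : SmoothFamily (Ici ΛR) (dPropagator K B) := by
  have h := smoothFamily_block hR hB hK.isFlat 1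
  have hc : SmoothFamily (Ici ΛR) (fun (s : ℝ) (_ : Momentum) => -2 / s) :=
    smoothFamily_param (by
      refine ContinuousOn.div (by fun_prop) (by fun_prop) fun s hs => (hR.trans_le hs).ne')
  exact (hc.mul h).congr fun s hs => funext fun k => dPropagator_eq hK B (hR.trans_le hs) k

theorem dPropagator_deriv_bound {K : ℝ → ℝ} (hK : IsCutoff K) (p : ℕ) : ∃ C, 0 ≤ C ∧
    ∀ (B s : ℝ) (k : Momentum), 0 < s → |B| ≤ s ^ 2 →
      ‖iteratedFDeriv ℝ p (dPropagator K B s) k‖ ≤ C / s ^ (3 + p) := by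
  obtain ⟨C, hC0, hC⟩ := block_deriv_bound p hK.isFlat 1
  refine ⟨2 * C, by positivity, fun B s k hs hB => ?_⟩
  have e : dPropagator K B s = (-2 / s) • block (fun z => z * deriv K z) 1 B s :=
    funext fun k => dPropagator_eq hK B hs k
  rw [e, iteratedFDeriv_const_smul_apply
    ((contDiff_block hs hB hK.isFlat 1).of_le (natCast_le_infty p)).contDiffAt, norm_smul]
  have h1 : ‖-2 / s‖ = 2 / s := by
    rw [Real.norm_eq_abs, abs_div, abs_neg, abs_two, abs_of_pos hs]
  rw [h1]
  refine (mul_le_mul_of_nonneg_left (hC B s k hs hB) (by positivity)).trans (le_of_eq ?_)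
  field_simp
  ring

/-! ### Tree and loop terms, and the routing of momenta -/

/-- A tower of vertex functions, at one order, as functions of the scale and the momenta. -/
abbrev Tower : Type := (m : ℕ) → ℝ → (Fin m → Momentum) → ℝ

/-- The tree part of the flow, for two vertices taken from the towers `u` and `v`. -/
def treePart (K : ℝ → ℝ) (B : ℝ) (u v : Tower) (m : ℕ) (Λ : ℝ) (k : Fin m → Momentum) : ℝ :=
  ∑ S : Finset (Fin (m + 1)), dPropagator K B Λ (∑ i ∈ S, allMomenta k i)
    * u S.card Λ (fun j => allMomenta k (S.orderEmbOfFin rfl j))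
    * v Sᶜ.card Λ (fun j => allMomenta k (Sᶜ.orderEmbOfFin rfl j))

/-- The loop part of the flow. -/
def loopPart (K : ℝ → ℝ) (B : ℝ) (u : Tower) (m : ℕ) (Λ : ℝ) (k : Fin m → Momentum) : ℝ :=
  ((2 * Real.pi) ^ 4)⁻¹ *
    ∫ q : Momentum, u (m + 2) Λ (Fin.snoc (α := fun _ => Momentum) (allMomenta k) q)
      * dPropagator K B Λ q

/-- The momentum region in which all legs are at most twice the scale. -/
def InRegion {m : ℕ} (Λ : ℝ) (k : Fin m → Momentum) : Prop := ∀ i, ‖allMomenta k i‖ ≤ 2 * Λ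

@[simp] theorem allMomenta_castSucc {m : ℕ} (k : Fin m → Momentum) (i : Fin m) :
    allMomenta k i.castSucc = k i := by simp [allMomenta]

@[simp] theorem allMomenta_last {m : ℕ} (k : Fin m → Momentum) :
    allMomenta k (Fin.last m) = -∑ i, k i := by simp [allMomenta]

theorem sum_allMomenta {m : ℕ} (k : Fin m → Momentum) : ∑ i, allMomenta k i = 0 := by
  rw [Fin.sum_univ_castSucc]; simp

theorem inRegion_iff {m : ℕ} {Λ : ℝ} {k : Fin m → Momentum} :
    InRegion Λ k ↔ (∀ i, ‖k i‖ ≤ 2 * Λ) ∧ ‖∑ i, k i‖ ≤ 2 * Λ := by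
  simp [InRegion, Fin.forall_fin_succ']

/-- The momenta of all legs as a linear map. -/
def allMomentaL (m : ℕ) : (Fin m → Momentum) →L[ℝ] (Fin (m + 1) → Momentum) :=
  LinearMap.toContinuousLinearMap
    { toFun := allMomenta
      map_add' := fun k l => by
        funext i
        refine Fin.lastCases ?_ (fun j => ?_) i
        · simp [Finset.sum_add_distrib]; abel
        · simp
      map_smul' := fun c k => by
        funext i
        refine Fin.lastCases ?_ (fun j => ?_) i
        · simp [Finset.smul_sum]
        · simp }

@[simp] theorem allMomentaL_apply {m : ℕ} (k : Fin m → Momentum) :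
    allMomentaL m k = allMomenta k := rfl

/-- The total momentum of a set of legs. -/
def legSum {m : ℕ} (S : Finset (Fin (m + 1))) : (Fin m → Momentum) →L[ℝ] Momentum :=
  ∑ i ∈ S, (ContinuousLinearMap.proj i).comp (allMomentaL m)

theorem legSum_apply {m : ℕ} (S : Finset (Fin (m + 1))) (k : Fin m → Momentum) :
    legSum S k = ∑ i ∈ S, allMomenta k i := by
  simp [legSum]

/-- The momenta of a set of legs. -/
def legMomenta {m : ℕ} (S : Finset (Fin (m + 1))) :
    (Fin m → Momentum) →L[ℝ] (Fin S.card → Momentum) :=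
  ContinuousLinearMap.pi fun j =>
    (ContinuousLinearMap.proj (S.orderEmbOfFin rfl j)).comp (allMomentaL m)

theorem legMomenta_apply {m : ℕ} (S : Finset (Fin (m + 1))) (k : Fin m → Momentum) :
    legMomenta S k = fun j => allMomenta k (S.orderEmbOfFin rfl j) := rfl

theorem sum_legMomenta {m : ℕ} (S : Finset (Fin (m + 1))) (k : Fin m → Momentum) :
    ∑ j, legMomenta S k j = legSum S k := by
  rw [legSum_apply]
  conv_rhs => rw [← Finset.map_orderEmbOfFin_univ S rfl, Finset.sum_map]
  rfl

/-- The dependent leg of the vertex is the internal line, whose momentum is minus the sum of the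
external ones; its bound is exactly the extra hypothesis. -/
theorem inRegion_legMomenta {m : ℕ} {Λ : ℝ} {k : Fin m → Momentum} (hk : InRegion Λ k)
    {S : Finset (Fin (m + 1))} (hS : ‖legSum S k‖ ≤ 2 * Λ) : InRegion Λ (legMomenta S k) :=
  inRegion_iff.2 ⟨fun _ => hk _, by rwa [sum_legMomenta]⟩

theorem legSum_compl {m : ℕ} (S : Finset (Fin (m + 1))) (k : Fin m → Momentum) :
    legSum Sᶜ k = -legSum S k := by
  rw [legSum_apply, legSum_apply, eq_neg_iff_add_eq_zero, Finset.sum_compl_add_sum,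
    sum_allMomenta]

/-- The momenta of a vertex in a loop, as an affine function of the external momenta. -/
def loopL (m : ℕ) : (Fin m → Momentum) →L[ℝ] (Fin (m + 2) → Momentum) :=
  ContinuousLinearMap.pi (Fin.snoc (α := fun _ => (Fin m → Momentum) →L[ℝ] Momentum)
    (fun i => (ContinuousLinearMap.proj i).comp (allMomentaL m)) 0)

/-- The shift by the loop momentum. -/
def loopShift (m : ℕ) (q : Momentum) : Fin (m + 2) → Momentum :=
  Fin.snoc (α := fun _ => Momentum) (0 : Fin (m + 1) → Momentum) q

theorem snoc_eq_loopL {m : ℕ} (k : Fin m → Momentum) (q : Momentum) :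
    Fin.snoc (α := fun _ => Momentum) (allMomenta k) q = loopL m k + loopShift m q := by
  funext i
  refine Fin.lastCases ?_ (fun j => ?_) i <;> simp [loopL, loopShift]

theorem continuous_loopShift (m : ℕ) : Continuous (loopShift m) := by
  refine continuous_pi fun i => ?_
  refine Fin.lastCases ?_ (fun j => ?_) i
  · simpa [loopShift] using (continuous_id' (X := Momentum))
  · simpa [loopShift] using continuous_const

/-- The external momenta add up to zero, so the dependent leg of the loop vertex carries -q. -/
theorem inRegion_loop {m : ℕ} {Λ : ℝ} {k : Fin m → Momentum} (hk : InRegion Λ k)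
    {q : Momentum} (hq : ‖q‖ ≤ 2 * Λ) : InRegion Λ (loopL m k + loopShift m q) := by
  rw [← snoc_eq_loopL, inRegion_iff, Fin.forall_fin_succ', Fin.sum_univ_castSucc]
  simp only [Fin.snoc_castSucc, Fin.snoc_last, sum_allMomenta, zero_add]
  exact ⟨⟨hk, hq⟩, hq⟩

theorem treePart_eq (K : ℝ → ℝ) (B : ℝ) (u v : Tower) (m : ℕ) (Λ : ℝ) :
    treePart K B u v m Λ = fun k => ∑ S : Finset (Fin (m + 1)), dPropagator K B Λ (legSum S k)
      * u S.card Λ (legMomenta S k) * v Sᶜ.card Λ (legMomenta Sᶜ k) := by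
  funext k; simp only [treePart, legSum_apply, legMomenta_apply]

theorem loopPart_eq (K : ℝ → ℝ) (B : ℝ) (u : Tower) (m : ℕ) (Λ : ℝ) :
    loopPart K B u m Λ = fun k => ((2 * Real.pi) ^ 4)⁻¹ *
      ∫ q : Momentum, u (m + 2) Λ (loopL m k + loopShift m q) * dPropagator K B Λ q := by
  funext k; simp only [loopPart, snoc_eq_loopL]

section Smooth

variable {K : ℝ → ℝ} {B ΛR Λ0 : ℝ} {I : Set ℝ}

theorem SmoothFamily.treePart (hK : IsCutoff K) (hR : 0 < ΛR) (hB : |B| ≤ ΛR ^ 2)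
    (hI : I ⊆ Icc ΛR Λ0) {u v : Tower} (hu : ∀ m, SmoothFamily I (u m))
    (hv : ∀ m, SmoothFamily I (v m)) (m : ℕ) : SmoothFamily I (treePart K B u v m) := by
  have hP : SmoothFamily I (dPropagator K B) :=
    (smoothFamily_dPropagator hK hR hB).mono fun s hs => (hI hs).1
  refine (SmoothFamily.sum fun S _ => ((hP.comp_linear (legSum S)).mul
    ((hu S.card).comp_linear (legMomenta S))).mul
      ((hv Sᶜ.card).comp_linear (legMomenta Sᶜ))).congr fun x _ => treePart_eq K B u v m x

theorem smoothFamily_loopIntegrand (hK : IsCutoff K) (hR : 0 < ΛR) (hB : |B| ≤ ΛR ^ 2)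
    (hI : I ⊆ Icc ΛR Λ0) {u : Tower} {m : ℕ} (hu : SmoothFamily I (u (m + 2))) :
    SmoothFamily (I ×ˢ (univ : Set Momentum)) fun (y : ℝ × Momentum) k =>
      u (m + 2) y.1 (loopL m k + loopShift m y.2) * dPropagator K B y.1 y.2 := by
  have hP : ContinuousOn (fun y : ℝ × Momentum => dPropagator K B y.1 y.2) (I ×ˢ univ) :=
    ((smoothFamily_dPropagator hK hR hB).mono fun s hs => (hI hs).1).continuousOn
  have h1 : SmoothFamily (I ×ˢ (univ : Set Momentum)) fun y : ℝ × Momentum => u (m + 2) y.1 :=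
    hu.reparam continuousOn_fst fun y hy => hy.1
  exact (h1.comp_affine (loopL m) (c := fun y => loopShift m y.2)
    ((continuous_loopShift m).comp continuous_snd).continuousOn).mul (smoothFamily_param hP)

theorem loopIntegrand_support (hK : IsCutoff K) (hR : 0 < ΛR) (hI : I ⊆ Icc ΛR Λ0) (u : Tower)
    (m : ℕ) : ∀ x ∈ I, ∀ q ∉ Metric.closedBall (0 : Momentum) (2 * Λ0),
      (fun k => u (m + 2) x (loopL m k + loopShift m q) * dPropagator K B x q) = 0 := by
  intro x hx q hq
  funext k
  rw [dPropagator_support hK B (hR.trans_le (hI hx).1), mul_zero, Pi.zero_apply]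
  rw [mem_closedBall_zero_iff, not_le] at hq
  have := (hI hx).2
  linarith

theorem SmoothFamily.loopPart (hK : IsCutoff K) (hR : 0 < ΛR) (hB : |B| ≤ ΛR ^ 2)
    (hI : I ⊆ Icc ΛR Λ0) {u : Tower} {m : ℕ} (hu : SmoothFamily I (u (m + 2))) :
    SmoothFamily I (loopPart K B u m) :=
  ((SmoothFamily.integral (μ := volume) (isCompact_closedBall (0 : Momentum) (2 * Λ0))
    (smoothFamily_loopIntegrand hK hR hB hI hu)
    (loopIntegrand_support hK hR hI u m)).const_mul _).congr fun x _ => loopPart_eq K B u m x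

end Smooth

/-! ### Power counting for a single tree or loop -/

/-- Power counting bound, with prefactor `c`, on the `p`-th derivatives of the vertex function with
`m + 1` legs at scale `Λ`. -/
def ScaleBound (u : Tower) (Λ c : ℝ) (m p : ℕ) : Prop :=
  ∀ k : Fin m → Momentum, InRegion Λ k →
    ‖iteratedFDeriv ℝ p (u m Λ) k‖ ≤ c * Λ ^ ((3 : ℤ) - m) / Λ ^ p

theorem norm_iteratedFDeriv_mul_scaled_le {E : Type} [NormedAddCommGroup E] [NormedSpace ℝ E]
    {f g : E → ℝ} (hf : ContDiff ℝ ∞ f) (hg : ContDiff ℝ ∞ g) {x : E} {lam a b : ℝ}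
    (hlam : 0 < lam) (ha : 0 ≤ a) {p : ℕ}
    (h1 : ∀ j ≤ p, ‖iteratedFDeriv ℝ j f x‖ ≤ a / lam ^ j)
    (h2 : ∀ j ≤ p, ‖iteratedFDeriv ℝ j g x‖ ≤ b / lam ^ j) :
    ‖iteratedFDeriv ℝ p (fun k => f k * g k) x‖ ≤ 2 ^ p * (a * b) / lam ^ p := by
  refine (norm_iteratedFDeriv_mul_le hf hg x (natCast_le_infty p)).trans ?_
  have h : (2 : ℝ) ^ p = ∑ j ∈ Finset.range (p + 1), (p.choose j : ℝ) := by
    exact_mod_cast (Nat.sum_range_choose p).symm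
  rw [h, mul_div_assoc, Finset.sum_mul]
  refine Finset.sum_le_sum fun j hj => ?_
  have hj' : j ≤ p := Nat.lt_succ_iff.1 (Finset.mem_range.1 hj)
  rw [mul_assoc]
  refine mul_le_mul_of_nonneg_left ?_ (by positivity)
  refine (mul_le_mul (h1 j hj') (h2 (p - j) (by omega)) (norm_nonneg _)
    (by positivity)).trans (le_of_eq ?_)
  rw [div_mul_div_comm, ← pow_add, Nat.add_sub_cancel' hj']

theorem norm_iteratedFDeriv_comp_affine_scaled_le {E G : Type} [NormedAddCommGroup E]
    [NormedSpace ℝ E] [NormedAddCommGroup G] [NormedSpace ℝ G] {f : G → ℝ}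
    (hf : ContDiff ℝ ∞ f) (T : E →L[ℝ] G) (c : G) {x : E} {lam a : ℝ} (hlam : 0 < lam)
    (ha : 0 ≤ a) {p : ℕ} (h : ∀ j ≤ p, ‖iteratedFDeriv ℝ j f (T x + c)‖ ≤ a / lam ^ j) :
    ∀ j ≤ p, ‖iteratedFDeriv ℝ j (fun k => f (T k + c)) x‖
      ≤ (a * (1 + ‖T‖) ^ p) / lam ^ j := by
  intro j hj
  refine (norm_iteratedFDeriv_comp_affine_le hf T c j x).trans ?_
  have h1 : ‖T‖ ^ j ≤ (1 + ‖T‖) ^ p :=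
    (pow_le_pow_left₀ (norm_nonneg _) (by linarith) j).trans
      (pow_le_pow_right₀ (by linarith [norm_nonneg T]) hj)
  refine (mul_le_mul (h j hj) h1 (by positivity) (by positivity)).trans (le_of_eq ?_)
  ring

theorem exists_uniform_dPropagator_bound {K : ℝ → ℝ} (hK : IsCutoff K) (p : ℕ) : ∃ C, 0 ≤ C ∧
    ∀ j ≤ p, ∀ (B s : ℝ) (k : Momentum), 0 < s → |B| ≤ s ^ 2 →
      ‖iteratedFDeriv ℝ j (dPropagator K B s) k‖ ≤ C / s ^ 3 / s ^ j := by
  choose C hC0 hC using dPropagator_deriv_bound hK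
  refine ⟨∑ l ∈ Finset.range (p + 1), C l, Finset.sum_nonneg fun l _ => hC0 l, ?_⟩
  intro j hj B s k hs hB
  refine (hC j B s k hs hB).trans ?_
  rw [div_div, ← pow_add]
  have := Finset.single_le_sum (f := C) (s := Finset.range (p + 1)) (fun l _ => hC0 l)
    (Finset.mem_range.2 (Nat.lt_succ_of_le hj))
  gcongr

/-- Either the line momentum exceeds 2Λ and the propagator vanishes in a neighbourhood, or both
vertices are evaluated inside their regions. In the second case Λ^(-3) Λ^(3-|S|) Λ^(3-|Sᶜ|) =
Λ^(2-m), because |S| + |Sᶜ| = m + 1. -/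
theorem treePart_bound {K : ℝ → ℝ} (hK : IsCutoff K) (m p : ℕ) : ∃ C, 0 ≤ C ∧
    ∀ (B Λ a b : ℝ) (u v : Tower), 0 < Λ → |B| ≤ Λ ^ 2 → 0 ≤ a → 0 ≤ b →
      (∀ m, ContDiff ℝ ∞ (u m Λ)) → (∀ m, ContDiff ℝ ∞ (v m Λ)) →
      (∀ m' ≤ m + 1, ∀ j ≤ p, ScaleBound u Λ a m' j) →
      (∀ m' ≤ m + 1, ∀ j ≤ p, ScaleBound v Λ b m' j) →
      ∀ k, InRegion Λ k → ‖iteratedFDeriv ℝ p (treePart K B u v m Λ) k‖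
        ≤ C * (a * b) * Λ ^ ((2 : ℤ) - m) / Λ ^ p := by
  obtain ⟨C, hC0, hC⟩ := exists_uniform_dPropagator_bound hK p
  let w : Finset (Fin (m + 1)) → ℝ := fun S => 2 ^ p * (2 ^ p * ((C * (1 + ‖legSum S‖) ^ p) *
    (1 + ‖legMomenta S‖) ^ p) * (1 + ‖legMomenta Sᶜ‖) ^ p)
  have hw : ∀ S, 0 ≤ w S := fun S => by positivity
  refine ⟨∑ S, w S, Finset.sum_nonneg fun S _ => hw S, ?_⟩
  intro B Λ a b u v hΛ hB ha hb hu hv hbu hbv k hk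
  have hPs : ContDiff ℝ ∞ (dPropagator K B Λ) :=
    (smoothFamily_dPropagator hK hΛ hB).smooth Λ self_mem_Ici
  have sP : ∀ S : Finset (Fin (m + 1)), ContDiff ℝ ∞ fun k => dPropagator K B Λ (legSum S k) :=
    fun S => hPs.comp (legSum S).contDiff
  have su : ∀ S : Finset (Fin (m + 1)), ContDiff ℝ ∞ fun k => u S.card Λ (legMomenta S k) :=
    fun S => (hu _).comp (legMomenta S).contDiff
  have sv : ∀ S : Finset (Fin (m + 1)), ContDiff ℝ ∞ fun k => v S.card Λ (legMomenta S k) :=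
    fun S => (hv _).comp (legMomenta S).contDiff
  rw [treePart_eq, iteratedFDeriv_sum (f := fun S k => dPropagator K B Λ (legSum S k)
      * u S.card Λ (legMomenta S k) * v Sᶜ.card Λ (legMomenta Sᶜ k))
    (fun S _ => (((sP S).mul (su S)).mul (sv Sᶜ)).of_le (natCast_le_infty p)),
    Finset.sum_apply]
  refine (norm_sum_le _ _).trans ?_
  rw [mul_assoc, mul_div_assoc, Finset.sum_mul]
  refine Finset.sum_le_sum fun S _ => ?_
  rcases lt_or_ge (2 * Λ) ‖legSum S k‖ with hS | hS
  · have : (fun k => dPropagator K B Λ (legSum S k) * u S.card Λ (legMomenta S k)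
        * v Sᶜ.card Λ (legMomenta Sᶜ k)) =ᶠ[𝓝 k] 0 := by
      filter_upwards [(isOpen_lt continuous_const (legSum S).continuous.norm).mem_nhds hS] with x hx
      rw [dPropagator_support hK B hΛ (le_of_lt hx), zero_mul, zero_mul, Pi.zero_apply]
    rw [(this.iteratedFDeriv ℝ p).eq_of_nhds]
    have := hw S
    have h0 : iteratedFDeriv ℝ p (0 : (Fin m → Momentum) → ℝ) k = 0 := by simp
    rw [h0, norm_zero]
    positivity
  · have r1 := inRegion_legMomenta hk hS
    have r2 := inRegion_legMomenta hk (S := Sᶜ) (by rwa [legSum_compl, norm_neg])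
    have hcard : ∀ S : Finset (Fin (m + 1)), S.card ≤ m + 1 := fun S => by
      simpa using S.card_le_univ
    have b1 := norm_iteratedFDeriv_comp_affine_scaled_le hPs (legSum S) 0 (x := k) hΛ
      (a := C / Λ ^ 3) (by positivity) (p := p) fun j hj => hC j hj B Λ _ hΛ hB
    have b2 := norm_iteratedFDeriv_comp_affine_scaled_le (hu S.card) (legMomenta S) 0 (x := k) hΛ
      (a := a * Λ ^ ((3 : ℤ) - S.card)) (by positivity) (p := p) fun j hj =>
        hbu _ (hcard S) j hj _ (by simpa using r1)
    have b3 := norm_iteratedFDeriv_comp_affine_scaled_le (hv Sᶜ.card) (legMomenta Sᶜ) 0 (x := k) hΛ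
      (a := b * Λ ^ ((3 : ℤ) - Sᶜ.card)) (by positivity) (p := p) fun j hj =>
        hbv _ (hcard Sᶜ) j hj _ (by simpa using r2)
    simp only [add_zero] at b1 b2 b3
    have b12 : ∀ j ≤ p, _ := fun j hj => (norm_iteratedFDeriv_mul_scaled_le (sP S) (su S) hΛ
      (by positivity) (p := j) (fun i hi => b1 i (hi.trans hj))
      (fun i hi => b2 i (hi.trans hj))).trans (div_le_div_of_nonneg_right
        (mul_le_mul_of_nonneg_right (pow_le_pow_right₀ one_le_two hj) (by positivity))
        (by positivity))
    refine (norm_iteratedFDeriv_mul_scaled_le ((sP S).mul (su S)) (sv Sᶜ) hΛ (by positivity)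
      b12 b3).trans (le_of_eq ?_)
    have hsum : S.card + Sᶜ.card = m + 1 := by
      rw [Finset.card_add_card_compl]; simp
    have hpow : Λ ^ ((3 : ℤ) - S.card) * Λ ^ ((3 : ℤ) - Sᶜ.card)
        = Λ ^ ((2 : ℤ) - m) * Λ ^ 3 := by
      rw [← zpow_add₀ hΛ.ne', ← zpow_natCast Λ 3, ← zpow_add₀ hΛ.ne']
      congr 1
      have : (S.card : ℤ) + Sᶜ.card = m + 1 := by exact_mod_cast hsum
      push_cast
      linarith
    rw [mul_div_assoc', div_left_inj' (by positivity)]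
    calc _ = w S * (a * b) * ((Λ ^ ((3 : ℤ) - S.card) * Λ ^ ((3 : ℤ) - Sᶜ.card)) / Λ ^ 3) := by
          simp only [w]; field_simp
      _ = _ := by rw [hpow]; field_simp

/-- The vertex contributes Λ^(1-m), the propagator Λ^(-3), and the ball of radius 2Λ a volume
proportional to Λ⁴ (whence 16 = 2⁴). -/
theorem loopPart_bound {K : ℝ → ℝ} (hK : IsCutoff K) (m p : ℕ) : ∃ C, 0 ≤ C ∧
    ∀ (B Λ a : ℝ) (u : Tower), 0 < Λ → |B| ≤ Λ ^ 2 → 0 ≤ a →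
      (∀ m, ContDiff ℝ ∞ (u m Λ)) → (∀ j ≤ p, ScaleBound u Λ a (m + 2) j) →
      ∀ k, InRegion Λ k → ‖iteratedFDeriv ℝ p (loopPart K B u m Λ) k‖
        ≤ C * a * Λ ^ ((2 : ℤ) - m) / Λ ^ p := by
  obtain ⟨C, hC0, hC⟩ := exists_uniform_dPropagator_bound hK 0
  let V : ℝ := volume.real (Metric.ball (0 : Momentum) 1)
  have hV : 0 ≤ V := measureReal_nonneg
  refine ⟨((2 * Real.pi) ^ 4)⁻¹ * ((1 + ‖loopL m‖) ^ p * C * (16 * V)), by positivity, ?_⟩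
  intro B Λ a u hΛ hB ha hu hbu k hk
  -- Smoothness is assumed at one scale only, so the integral lemmas are applied over a one-point
  -- parameter set.
  have hfam : SmoothFamily {Λ} (u (m + 2)) := by
    refine (smoothFamily_const {Λ} (hu (m + 2))).congr fun x hx => ?_
    rw [mem_singleton_iff.1 hx]
  have hI : ({Λ} : Set ℝ) ⊆ Icc Λ Λ := by simp
  have hint := smoothFamily_loopIntegrand hK hΛ hB hI hfam
  have hsupp := loopIntegrand_support (B := B) hK hΛ hI u m
  have hball := isCompact_closedBall (0 : Momentum) (2 * Λ)
  have hsm := (SmoothFamily.integral (μ := volume) hball hint hsupp).smooth Λ rfl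
  have e : loopPart K B u m Λ = ((2 * Real.pi) ^ 4)⁻¹ • fun k =>
      ∫ q : Momentum, u (m + 2) Λ (loopL m k + loopShift m q) * dPropagator K B Λ q :=
    loopPart_eq K B u m Λ
  rw [e, iteratedFDeriv_const_smul_apply ((hsm.of_le (natCast_le_infty p)).contDiffAt), norm_smul,
    iteratedFDeriv_integral hball hint hsupp rfl, Real.norm_eq_abs,
    abs_of_nonneg (by positivity : 0 ≤ ((2 * Real.pi) ^ 4)⁻¹)]
  have hbound : ∀ q ∈ Metric.closedBall (0 : Momentum) (2 * Λ),
      ‖iteratedFDeriv ℝ p (fun k => u (m + 2) Λ (loopL m k + loopShift m q)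
        * dPropagator K B Λ q) k‖
        ≤ (a * Λ ^ ((3 : ℤ) - (m + 2 : ℕ)) * (1 + ‖loopL m‖) ^ p) / Λ ^ p * (C / Λ ^ 3) := by
    intro q hq
    have e2 : (fun k => u (m + 2) Λ (loopL m k + loopShift m q) * dPropagator K B Λ q)
        = dPropagator K B Λ q • fun k => u (m + 2) Λ (loopL m k + loopShift m q) := by
      funext k; simp [mul_comm]
    have s2 : ContDiff ℝ ∞ fun k => u (m + 2) Λ (loopL m k + loopShift m q) :=
      (hu _).comp ((loopL m).contDiff.add contDiff_const)
    rw [e2, iteratedFDeriv_const_smul_apply ((s2.of_le (natCast_le_infty p)).contDiffAt),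
      norm_smul, mul_comm]
    refine mul_le_mul ?_ ?_ (norm_nonneg _) (by positivity)
    · refine norm_iteratedFDeriv_comp_affine_scaled_le (hu _) (loopL m) (loopShift m q) hΛ
        (by positivity) (fun j hj => hbu j hj _ (inRegion_loop hk ?_)) p le_rfl
      simpa using hq
    · simpa using hC 0 le_rfl B Λ q hΛ hB
  have h := norm_setIntegral_le_of_norm_le_const (μ := volume) hball.measure_lt_top hbound
  have hvol : volume.real (Metric.closedBall (0 : Momentum) (2 * Λ)) = (2 * Λ) ^ 4 * V := by
    rw [Measure.addHaar_real_closedBall _ _ (by positivity)]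
    simp [V]
  refine (mul_le_mul_of_nonneg_left h (by positivity)).trans (le_of_eq ?_)
  have hpow : Λ ^ ((3 : ℤ) - (m + 2 : ℕ)) * Λ ^ 4 = Λ ^ ((2 : ℤ) - m) * Λ ^ 3 := by
    rw [← zpow_natCast Λ 4, ← zpow_natCast Λ 3, ← zpow_add₀ hΛ.ne', ← zpow_add₀ hΛ.ne']
    congr 1
    push_cast
    ring
  rw [hvol]
  calc _ = ((2 * Real.pi) ^ 4)⁻¹ * ((1 + ‖loopL m‖) ^ p * C * (16 * V)) * a
        * ((Λ ^ ((3 : ℤ) - (m + 2 : ℕ)) * Λ ^ 4) / Λ ^ 3) / Λ ^ p := by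
        field_simp; ring
    _ = _ := by rw [hpow]; field_simp

/-! ### Logarithmic majorants and Taylor estimates in the momentum region -/

/-- The standard majorants of polynomials in `ℓ ≥ 1`. -/
def majorant (M : ℕ) (x : ℝ) : ℝ := M * x ^ M

theorem majorant_nonneg (M : ℕ) {x : ℝ} (hx : 1 ≤ x) : 0 ≤ majorant M x := by
  unfold majorant; positivity

/-- A single natural number serves as coefficient and as degree. Polynomial bounds in ℓ ≥ 1 are
thereby indexed by one monotone parameter. -/
theorem exists_majorant (C : ℝ) (n : ℕ) : ∃ M : ℕ, ∀ x, 1 ≤ x → C * x ^ n ≤ majorant M x := by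
  obtain ⟨c, hc⟩ := exists_nat_ge C
  refine ⟨c + n, fun x hx => ?_⟩
  have h1 : x ^ n ≤ x ^ (c + n) := pow_le_pow_right₀ hx (by omega)
  have h2 : C ≤ ((c + n : ℕ) : ℝ) := hc.trans (by exact_mod_cast Nat.le_add_right c n)
  exact mul_le_mul h2 h1 (by positivity) (by positivity)

theorem majorant_mono {M N : ℕ} (h : M ≤ N) {x : ℝ} (hx : 1 ≤ x) :
    majorant M x ≤ majorant N x :=
  mul_le_mul (by exact_mod_cast h) (pow_le_pow_right₀ hx h) (by positivity) (by positivity)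

theorem sum_majorant_le {α : Type} (s : Finset α) (M : α → ℕ) {x : ℝ} (hx : 1 ≤ x) :
    ∑ i ∈ s, majorant (M i) x ≤ majorant (∑ i ∈ s, M i) x := by
  unfold majorant
  rw [Nat.cast_sum, Finset.sum_mul]
  refine Finset.sum_le_sum fun i hi => ?_
  have := Finset.single_le_sum (f := M) (s := s) (fun _ _ => Nat.zero_le _) hi
  gcongr

theorem add_majorant_le (M N : ℕ) {x : ℝ} (hx : 1 ≤ x) :
    majorant M x + majorant N x ≤ majorant (M + N) x := by
  unfold majorant
  rw [Nat.cast_add, add_mul]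
  gcongr <;> omega

theorem inRegion_mono {m : ℕ} {Λ Λ' : ℝ} (h : Λ ≤ Λ') {k : Fin m → Momentum}
    (hk : InRegion Λ k) : InRegion Λ' k := fun i => (hk i).trans (by linarith)

theorem inRegion_zero {m : ℕ} {Λ : ℝ} (h : 0 ≤ Λ) : InRegion Λ (0 : Fin m → Momentum) :=
  inRegion_iff.2 (by simp [h])

theorem convex_inRegion (m : ℕ) (Λ : ℝ) : Convex ℝ {k : Fin m → Momentum | InRegion Λ k} := by
  have : {k : Fin m → Momentum | InRegion Λ k}
      = ⋂ i, ((ContinuousLinearMap.proj (R := ℝ) (φ := fun _ : Fin (m + 1) => Momentum) i).comp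
          (allMomentaL m)) ⁻¹' Metric.closedBall 0 (2 * Λ) := by
    ext k; simp [InRegion]
  rw [this]
  exact convex_iInter fun i => (convex_closedBall _ _).linear_preimage _

/-- First order Taylor estimate in the momentum region. -/
theorem taylor_inRegion {m : ℕ} {f : (Fin m → Momentum) → ℝ} (hf : ContDiff ℝ ∞ f) {Λ X : ℝ}
    (hΛ : 0 ≤ Λ) (p : ℕ)
    (hX : ∀ k, InRegion Λ k → ‖iteratedFDeriv ℝ (p + 1) f k‖ ≤ X) {k : Fin m → Momentum}
    (hk : InRegion Λ k) :
    ‖iteratedFDeriv ℝ p f k‖ ≤ ‖iteratedFDeriv ℝ p f 0‖ + X * (2 * Λ) := by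
  have hX0 : 0 ≤ X := (norm_nonneg _).trans (hX k hk)
  have h := (convex_inRegion m Λ).norm_image_sub_le_of_norm_fderiv_le (𝕜 := ℝ)
    (f := iteratedFDeriv ℝ p f) (C := X) (x := 0) (y := k)
    (fun x _ => hf.differentiable_iteratedFDeriv (by exact_mod_cast ENat.natCast_lt_top p) x)
    (fun x hx => by rw [norm_fderiv_iteratedFDeriv]; exact hX x hx) (inRegion_zero hΛ) hk
  have hk2 : ‖k - 0‖ ≤ 2 * Λ := by
    rw [sub_zero]
    exact (pi_norm_le_iff_of_nonneg (by positivity)).2 (inRegion_iff.1 hk).1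
  have h2 := norm_le_norm_add_norm_sub' (iteratedFDeriv ℝ p f k) (iteratedFDeriv ℝ p f 0)
  have h3 : X * ‖k - 0‖ ≤ X * (2 * Λ) := by gcongr
  linarith

theorem norm_integral_le_log {F : Type} [NormedAddCommGroup F] [NormedSpace ℝ F] {J : ℝ → F}
    {s t D : ℝ} (hs : 0 < s) (hst : s ≤ t) (h : ∀ x ∈ Icc s t, ‖J x‖ ≤ D * x⁻¹) :
    ‖∫ x in s..t, J x‖ ≤ D * Real.log (t / s) := by
  have h1 : IntervalIntegrable (fun x : ℝ => D * x⁻¹) volume s t := by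
    refine ContinuousOn.intervalIntegrable ?_
    rw [uIcc_of_le hst]
    exact continuousOn_const.mul (continuousOn_id.inv₀ fun x hx => (hs.trans_le hx.1).ne')
  refine (intervalIntegral.norm_integral_le_of_norm_le hst
    (Eventually.of_forall fun x hx => h x ⟨hx.1.le, hx.2⟩) h1).trans (le_of_eq ?_)
  rw [intervalIntegral.integral_const_mul, integral_inv_of_pos hs (hs.trans_le hst)]

/-! ### Power counting for abstract flow systems -/

/-- A closed system of towers of vertex functions obeying Polchinski equations, with power counting
data: the tower `i` has prefactor `c i` and gains `e i` powers of the scale. -/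
structure FlowSystem {ι : Type} (K : ℝ → ℝ) (pairs : ι → Finset (ι × ι)) (legs e : ι → ℕ)
    (Mb : ι → ℕ → ℕ → ℕ) (ΛR Λ0 B ℓ : ℝ) (V : ι → Tower) (c : ι → ℝ) : Prop where
  pos : 0 < ΛR
  le : ΛR ≤ Λ0
  mass : |B| ≤ ΛR ^ 2
  log_le : 1 + Real.log (Λ0 / ΛR) ≤ ℓ
  family : ∀ i m, SmoothFamily (Icc ΛR Λ0) (V i m)
  flow : ∀ i m, ∀ Λ ∈ Icc ΛR Λ0, ∀ k, HasDerivWithinAt (fun s => V i m s k)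
    (-(1 / 2) * ∑ x ∈ pairs i, treePart K B (V x.1) (V x.2) m Λ k
      - 1 / 2 * loopPart K B (V i) m Λ k) (Icc ΛR Λ0) Λ
  finite : ∀ i m, legs i < m + 1 → ∀ Λ ∈ Icc ΛR Λ0, ∀ k, V i m Λ k = 0
  nonneg : ∀ i, 0 ≤ c i
  weight : ∀ i, ∀ x ∈ pairs i, ∀ Λ ∈ Icc ΛR Λ0,
    (c x.1 * Λ ^ e x.1) * (c x.2 * Λ ^ e x.2) ≤ c i * Λ ^ e i
  gain : ∀ i, e i ≤ 1
  low : ∀ i m p, m + p ≤ 3 → ‖iteratedFDeriv ℝ p (V i m ΛR) 0‖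
    ≤ c i * ΛR ^ e i * majorant (Mb i m p) ℓ * ΛR ^ ((3 : ℤ) - m) / ΛR ^ p
  high : ∀ i m p, 4 ≤ m + p → ScaleBound (V i) Λ0 (c i * Λ0 ^ e i * majorant (Mb i m p) ℓ) m p

/-- Collects all powers of the scale in one integer exponent. With b = 3 its sign decides from which
end the flow is integrated; with b = 2 it is the exponent of the integrand. -/
theorem scale_eq {Λ : ℝ} (hΛ : 0 < Λ) (c x : ℝ) (e m p : ℕ) (b : ℤ) :
    c * Λ ^ e * x * Λ ^ (b - m) / Λ ^ p = c * x * Λ ^ ((e : ℤ) + b - m - p) := by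
  rw [show (e : ℤ) + b - m - p = e + (b - m) - p by ring, zpow_sub₀ hΛ.ne' (e + (b - m)),
    zpow_add₀ hΛ.ne' (e : ℤ), zpow_natCast, zpow_natCast]
  ring

section Bound

variable {ι : Type} {K : ℝ → ℝ} {pairs : ι → Finset (ι × ι)} {legs e : ι → ℕ}
  {Mb : ι → ℕ → ℕ → ℕ}

/-- The right-hand side of the flow of the tower `i`. -/
def flowPart (K : ℝ → ℝ) (B : ℝ) (pairs : ι → Finset (ι × ι)) (V : ι → Tower) (i : ι) : Tower :=
  fun m Λ k => -(1 / 2) * ∑ x ∈ pairs i, treePart K B (V x.1) (V x.2) m Λ k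
    - 1 / 2 * loopPart K B (V i) m Λ k

section

variable {ΛR Λ0 B ℓ : ℝ} {V : ι → Tower} {c : ι → ℝ}
  (h : FlowSystem K pairs legs e Mb ΛR Λ0 B ℓ V c)
include h

theorem FlowSystem.one_le : 1 ≤ ℓ := by
  have : 0 ≤ Real.log (Λ0 / ΛR) := Real.log_nonneg ((one_le_div h.pos).2 h.le)
  linarith [h.log_le]

theorem FlowSystem.log_le' {s t : ℝ} (hs : ΛR ≤ s) (hst : s ≤ t) (ht : t ≤ Λ0) :
    Real.log (t / s) ≤ ℓ := by
  have hs0 := h.pos.trans_le hs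
  have : Real.log (t / s) ≤ Real.log (Λ0 / ΛR) := by
    refine Real.log_le_log (div_pos (hs0.trans_le hst) hs0) ?_
    have := h.pos
    have := hs0.trans_le (hst.trans ht)
    gcongr
  linarith [h.log_le]

theorem FlowSystem.smoothFamily_flowPart (hK : IsCutoff K) (i : ι) (m : ℕ) :
    SmoothFamily (Icc ΛR Λ0) (flowPart K B pairs V i m) :=
  ((SmoothFamily.sum fun x _ => SmoothFamily.treePart hK h.pos h.mass Subset.rfl
    (h.family x.1) (h.family x.2) m).const_mul _).sub
    ((SmoothFamily.loopPart hK h.pos h.mass Subset.rfl (h.family i (m + 2))).const_mul _)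

theorem FlowSystem.sub_eq (hK : IsCutoff K) (i : ι) (m p : ℕ) {s t : ℝ} (hs : ΛR ≤ s)
    (hst : s ≤ t) (ht : t ≤ Λ0) (k : Fin m → Momentum) :
    iteratedFDeriv ℝ p (V i m t) k - iteratedFDeriv ℝ p (V i m s) k
      = ∫ x in s..t, iteratedFDeriv ℝ p (flowPart K B pairs V i m x) k :=
  iteratedFDeriv_sub_eq_integral (h.family i m) (h.smoothFamily_flowPart hK i m)
    (h.flow i m) hs hst ht p k

end

/-- Trees involve only the towers in `pairs i`, and the loop only the same tower with two more legs.
The condition `weight` turns the product of two prefactors into the prefactor of `i`. The constant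
`M` is chosen before the scales and the solution. -/
theorem exists_flowPart_bound (hK : IsCutoff K) {i : ι} {m p : ℕ}
    (hp : ∀ x ∈ pairs i, ∀ j, j = x.1 ∨ j = x.2 → ∀ m' p', ∃ M : ℕ,
      ∀ {ΛR Λ0 B ℓ : ℝ} {V : ι → Tower} {c : ι → ℝ},
        FlowSystem K pairs legs e Mb ΛR Λ0 B ℓ V c → ∀ Λ ∈ Icc ΛR Λ0,
          ScaleBound (V j) Λ (c j * Λ ^ e j * majorant M ℓ) m' p')
    (hm : ∀ p', ∃ M : ℕ, ∀ {ΛR Λ0 B ℓ : ℝ} {V : ι → Tower} {c : ι → ℝ},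
        FlowSystem K pairs legs e Mb ΛR Λ0 B ℓ V c → ∀ Λ ∈ Icc ΛR Λ0,
          ScaleBound (V i) Λ (c i * Λ ^ e i * majorant M ℓ) (m + 2) p') :
    ∃ M : ℕ, ∀ {ΛR Λ0 B ℓ : ℝ} {V : ι → Tower} {c : ι → ℝ},
        FlowSystem K pairs legs e Mb ΛR Λ0 B ℓ V c → ∀ Λ ∈ Icc ΛR Λ0, ∀ k, InRegion Λ k →
          ‖iteratedFDeriv ℝ p (flowPart K B pairs V i m Λ) k‖
            ≤ c i * Λ ^ e i * majorant M ℓ * Λ ^ ((2 : ℤ) - m) / Λ ^ p := by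
  obtain ⟨C1, hC1, H1⟩ := treePart_bound hK m p
  obtain ⟨C2, hC2, H2⟩ := loopPart_bound hK m p
  have hx : ∀ x ∈ pairs i, ∃ M : ℕ, ∀ {ΛR Λ0 B ℓ : ℝ} {V : ι → Tower} {c : ι → ℝ},
      FlowSystem K pairs legs e Mb ΛR Λ0 B ℓ V c → ∀ Λ ∈ Icc ΛR Λ0, ∀ k, InRegion Λ k →
        ‖iteratedFDeriv ℝ p (treePart K B (V x.1) (V x.2) m Λ) k‖
          ≤ c i * Λ ^ e i * majorant M ℓ * Λ ^ ((2 : ℤ) - m) / Λ ^ p := by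
    intro x hx
    choose M1 hM1 using hp x hx x.1 (Or.inl rfl)
    choose M2 hM2 using hp x hx x.2 (Or.inr rfl)
    let N : ℕ := ∑ a ∈ Finset.range (m + 2), ∑ b ∈ Finset.range (p + 1), (M1 a b + M2 a b)
    have hN : ∀ a ≤ m + 1, ∀ b ≤ p, M1 a b + M2 a b ≤ N := by
      intro a ha b hb
      refine le_trans ?_ (Finset.single_le_sum (f := fun a => ∑ b ∈ Finset.range (p + 1),
        (M1 a b + M2 a b)) (fun _ _ => Nat.zero_le _) (Finset.mem_range.2 (by omega : a < m + 2)))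
      exact Finset.single_le_sum (f := fun b => M1 a b + M2 a b) (fun _ _ => Nat.zero_le _)
        (Finset.mem_range.2 (by omega : b < p + 1))
    obtain ⟨M, hM⟩ := exists_majorant (C1 * (N * N)) (N + N)
    refine ⟨M, fun {ΛR Λ0 B ℓ V c} h Λ hΛ k hk => ?_⟩
    have hΛ0 : 0 < Λ := h.pos.trans_le hΛ.1
    have hℓ := h.one_le
    have hN0 := majorant_nonneg N hℓ
    have w1 := mul_nonneg (h.nonneg x.1) (pow_nonneg hΛ0.le (e x.1))
    have w2 := mul_nonneg (h.nonneg x.2) (pow_nonneg hΛ0.le (e x.2))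
    have b := H1 B Λ (c x.1 * Λ ^ e x.1 * majorant N ℓ) (c x.2 * Λ ^ e x.2 * majorant N ℓ)
      (V x.1) (V x.2) hΛ0 (h.mass.trans (pow_le_pow_left₀ h.pos.le hΛ.1 2))
      (mul_nonneg w1 hN0) (mul_nonneg w2 hN0)
      (fun m => (h.family x.1 m).smooth Λ hΛ) (fun m => (h.family x.2 m).smooth Λ hΛ)
      (fun a ha b hb k hk => (hM1 a b h Λ hΛ k hk).trans (by
        have := majorant_mono ((Nat.le_add_right _ _).trans (hN a ha b hb)) hℓ
        gcongr))
      (fun a ha b hb k hk => (hM2 a b h Λ hΛ k hk).trans (by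
        have := majorant_mono ((Nat.le_add_left _ _).trans (hN a ha b hb)) hℓ
        gcongr)) k hk
    refine b.trans ?_
    gcongr ?_ * _ / _
    calc C1 * (c x.1 * Λ ^ e x.1 * majorant N ℓ * (c x.2 * Λ ^ e x.2 * majorant N ℓ))
        = ((c x.1 * Λ ^ e x.1) * (c x.2 * Λ ^ e x.2)) * (C1 * (N * N) * ℓ ^ (N + N)) := by
          simp only [majorant]; ring
      _ ≤ (c i * Λ ^ e i) * majorant M ℓ := by
          refine mul_le_mul (h.weight i x hx Λ hΛ) (hM ℓ hℓ) (by positivity) ?_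
          have := h.nonneg i
          positivity
  choose! Mx hMx using hx
  choose M3 hM3 using hm
  let N : ℕ := ∑ b ∈ Finset.range (p + 1), M3 b
  obtain ⟨M4, hM4⟩ := exists_majorant (C2 * N) N
  refine ⟨∑ x ∈ pairs i, Mx x + M4, fun {ΛR Λ0 B ℓ V c} h Λ hΛ k hk => ?_⟩
  have hΛ0 : 0 < Λ := h.pos.trans_le hΛ.1
  have hℓ := h.one_le
  have hB : |B| ≤ Λ ^ 2 := h.mass.trans (pow_le_pow_left₀ h.pos.le hΛ.1 2)
  have hN0 := majorant_nonneg N hℓ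
  have hw := mul_nonneg (h.nonneg i) (pow_nonneg hΛ0.le (e i))
  have bl := H2 B Λ (c i * Λ ^ e i * majorant N ℓ) (V i) hΛ0 hB (mul_nonneg hw hN0)
    (fun m => (h.family i m).smooth Λ hΛ)
    (fun b hb k hk => (hM3 b h Λ hΛ k hk).trans (by
        have := majorant_mono (Finset.single_le_sum (f := M3) (fun _ _ => Nat.zero_le _)
          (Finset.mem_range.2 (by omega : b < p + 1))) hℓ
        gcongr)) k hk
  let t : ι × ι → (Fin m → Momentum) → ℝ := fun x => treePart K B (V x.1) (V x.2) m Λ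
  have st : ∀ x ∈ pairs i, ContDiff ℝ p (t x) := fun x _ =>
    ((SmoothFamily.treePart hK h.pos h.mass Subset.rfl (h.family x.1) (h.family x.2) m).smooth
      Λ hΛ).of_le (natCast_le_infty p)
  have sl : ContDiff ℝ p (loopPart K B (V i) m Λ) :=
    ((SmoothFamily.loopPart hK h.pos h.mass Subset.rfl (h.family i (m + 2))).smooth
      Λ hΛ).of_le (natCast_le_infty p)
  have sts : ContDiff ℝ p (fun k => ∑ x ∈ pairs i, t x k) := ContDiff.sum st
  have e1 : flowPart K B pairs V i m Λ = (-(1 / 2) : ℝ) • (fun k => ∑ x ∈ pairs i, t x k)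
      + (-(1 / 2) : ℝ) • loopPart K B (V i) m Λ := by
    funext k
    simp only [flowPart, t, Pi.add_apply, Pi.smul_apply, smul_eq_mul]
    ring
  have n1 : ‖iteratedFDeriv ℝ p (fun k => ∑ x ∈ pairs i, t x k) k‖
      ≤ c i * Λ ^ e i * majorant (∑ x ∈ pairs i, Mx x) ℓ * Λ ^ ((2 : ℤ) - m) / Λ ^ p := by
    rw [iteratedFDeriv_sum st, Finset.sum_apply]
    refine (norm_sum_le _ _).trans ((Finset.sum_le_sum fun x hx => hMx x hx h Λ hΛ k hk).trans ?_)
    rw [← Finset.sum_div, ← Finset.sum_mul, ← Finset.mul_sum]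
    have := sum_majorant_le (pairs i) Mx hℓ
    gcongr
  have n2 : ‖iteratedFDeriv ℝ p (loopPart K B (V i) m Λ) k‖
      ≤ c i * Λ ^ e i * majorant M4 ℓ * Λ ^ ((2 : ℤ) - m) / Λ ^ p := by
    refine bl.trans ?_
    gcongr ?_ * _ / _
    calc C2 * (c i * Λ ^ e i * majorant N ℓ) = c i * Λ ^ e i * (C2 * N * ℓ ^ N) := by
          simp only [majorant]; ring
      _ ≤ _ := mul_le_mul_of_nonneg_left (hM4 ℓ hℓ) hw
  have hhalf : ‖(-(1 / 2) : ℝ)‖ = 1 / 2 := by norm_num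
  have sts' : ContDiffAt ℝ p ((-(1 / 2) : ℝ) • fun k => ∑ x ∈ pairs i, t x k) k :=
    (contDiff_const.smul sts).contDiffAt
  have sl' : ContDiffAt ℝ p ((-(1 / 2) : ℝ) • loopPart K B (V i) m Λ) k :=
    (contDiff_const.smul sl).contDiffAt
  rw [e1, iteratedFDeriv_add_apply sts' sl',
    iteratedFDeriv_const_smul_apply sts.contDiffAt, iteratedFDeriv_const_smul_apply sl.contDiffAt]
  refine (norm_add_le _ _).trans ?_
  rw [norm_smul, norm_smul, hhalf]
  have n3 := norm_nonneg (iteratedFDeriv ℝ p (fun k => ∑ x ∈ pairs i, t x k) k)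
  have n4 := norm_nonneg (iteratedFDeriv ℝ p (loopPart K B (V i) m Λ) k)
  have n5 : c i * Λ ^ e i * majorant (∑ x ∈ pairs i, Mx x) ℓ * Λ ^ ((2 : ℤ) - m) / Λ ^ p
      + c i * Λ ^ e i * majorant M4 ℓ * Λ ^ ((2 : ℤ) - m) / Λ ^ p
      ≤ c i * Λ ^ e i * majorant (∑ x ∈ pairs i, Mx x + M4) ℓ * Λ ^ ((2 : ℤ) - m) / Λ ^ p := by
    rw [← add_div, ← add_mul, ← mul_add]
    have := add_majorant_le (∑ x ∈ pairs i, Mx x) M4 hℓ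
    gcongr
  linarith

/-- Power counting: the bounds at the two ends of the flow propagate to all scales. -/
theorem exists_scaleBound (hK : IsCutoff K) (deg : ι → ℕ)
    (hdeg : ∀ i, ∀ x ∈ pairs i, deg x.1 < deg i ∧ deg x.2 < deg i) (i : ι) :
    ∀ m p, ∃ M : ℕ, ∀ {ΛR Λ0 B ℓ : ℝ} {V : ι → Tower} {c : ι → ℝ},
      FlowSystem K pairs legs e Mb ΛR Λ0 B ℓ V c → ∀ Λ ∈ Icc ΛR Λ0,
        ScaleBound (V i) Λ (c i * Λ ^ e i * majorant M ℓ) m p := by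
  -- Three nested inductions: on the degree, which controls trees; downward in the number of legs,
  -- which controls loops; and downward in the derivatives while m + p < 4.
  induction hd : deg i using Nat.strong_induction_on generalizing i with
  | _ d ihd =>
  have hp : ∀ x ∈ pairs i, ∀ j, j = x.1 ∨ j = x.2 → ∀ m' p', ∃ M : ℕ,
      ∀ {ΛR Λ0 B ℓ : ℝ} {V : ι → Tower} {c : ι → ℝ},
        FlowSystem K pairs legs e Mb ΛR Λ0 B ℓ V c → ∀ Λ ∈ Icc ΛR Λ0,
          ScaleBound (V j) Λ (c j * Λ ^ e j * majorant M ℓ) m' p' := by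
    rintro x hx j (rfl | rfl)
    · exact ihd _ (hd ▸ (hdeg i x hx).1) _ rfl
    · exact ihd _ (hd ▸ (hdeg i x hx).2) _ rfl
  intro m
  induction hr : legs i + 1 - m using Nat.strong_induction_on generalizing m with
  | _ r ihr =>
  by_cases hlegs : legs i < m + 1
  · refine fun p => ⟨0, fun {ΛR Λ0 B ℓ V c} h Λ hΛ k _ => ?_⟩
    have : V i m Λ = 0 := funext fun k => h.finite i m hlegs Λ hΛ k
    have hz : iteratedFDeriv ℝ p (0 : (Fin m → Momentum) → ℝ) k = 0 := by simp
    rw [this, hz]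
    simp [majorant]
  have hm := ihr (legs i + 1 - (m + 2)) (by omega) (m + 2) rfl
  choose MA hMA using fun p => exists_flowPart_bound (p := p) hK hp hm
  have hhigh : ∀ p, 4 ≤ m + p → ∃ M : ℕ, ∀ {ΛR Λ0 B ℓ : ℝ} {V : ι → Tower} {c : ι → ℝ},
      FlowSystem K pairs legs e Mb ΛR Λ0 B ℓ V c → ∀ Λ ∈ Icc ΛR Λ0,
        ScaleBound (V i) Λ (c i * Λ ^ e i * majorant M ℓ) m p := by
    intro p hmp
    obtain ⟨M1, hM1⟩ := exists_majorant (MA p) (MA p + 1)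
    refine ⟨Mb i m p + M1, fun {ΛR Λ0 B ℓ V c} h Λ hΛ k hk => ?_⟩
    have hΛ0 : 0 < Λ := h.pos.trans_le hΛ.1
    have hℓ := h.one_le
    have hc := h.nonneg i
    have hge := h.gain i
    have hsub := h.sub_eq hK i m p hΛ.1 hΛ.2 le_rfl k
    -- Here the gain being at most one is essential. With a nonpositive exponent the power of t is
    -- largest at the lower end Λ; what remains is ∫ dt/t, which costs one logarithm and explains
    -- the exponent `MA p + 1` in the choice of `M1`.
    have ha : (e i : ℤ) + 3 - m - p ≤ 0 := by omega
    have hpow : ∀ t, Λ ≤ t → t ^ ((e i : ℤ) + 3 - m - p) ≤ Λ ^ ((e i : ℤ) + 3 - m - p) := by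
      intro t ht
      have h1 := zpow_le_zpow_left₀ (neg_nonneg.2 ha) hΛ0.le ht
      rw [zpow_neg, zpow_neg] at h1
      exact (inv_le_inv₀ (zpow_pos hΛ0 _) (zpow_pos (hΛ0.trans_le ht) _)).1 h1
    have hint := norm_integral_le_log (D := c i * majorant (MA p) ℓ
        * Λ ^ ((e i : ℤ) + 3 - m - p)) hΛ0 hΛ.2
      (J := fun x => iteratedFDeriv ℝ p (flowPart K B pairs V i m x) k) (fun t ht => by
        have ht0 : 0 < t := hΛ0.trans_le ht.1
        refine (hMA p h t ⟨hΛ.1.trans ht.1, ht.2⟩ k (inRegion_mono ht.1 hk)).trans ?_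
        rw [scale_eq ht0, show (e i : ℤ) + 2 - m - p = ((e i : ℤ) + 3 - m - p) - 1 by ring,
          zpow_sub_one₀ ht0.ne', ← mul_assoc]
        have := hpow t ht.1
        have := majorant_nonneg (MA p) hℓ
        gcongr)
    rw [← hsub] at hint
    have hb := h.high i m p hmp k (inRegion_mono hΛ.2 hk)
    rw [scale_eq (hΛ0.trans_le hΛ.2)] at hb
    rw [scale_eq hΛ0]
    have hlog := h.log_le' hΛ.1 hΛ.2 le_rfl
    have hmaj := majorant_nonneg (MA p) hℓ
    have hmaj' := majorant_nonneg (Mb i m p) hℓ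
    have n1 : c i * majorant (MA p) ℓ * Λ ^ ((e i : ℤ) + 3 - m - p) * Real.log (Λ0 / Λ)
        ≤ c i * majorant M1 ℓ * Λ ^ ((e i : ℤ) + 3 - m - p) := by
      calc _ ≤ c i * majorant (MA p) ℓ * Λ ^ ((e i : ℤ) + 3 - m - p) * ℓ := by gcongr
        _ = c i * ((MA p) * ℓ ^ (MA p + 1)) * Λ ^ ((e i : ℤ) + 3 - m - p) := by
          simp only [majorant]; ring
        _ ≤ _ := by have := hM1 ℓ hℓ; gcongr
    have n2 : c i * majorant (Mb i m p) ℓ * Λ0 ^ ((e i : ℤ) + 3 - m - p)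
        ≤ c i * majorant (Mb i m p) ℓ * Λ ^ ((e i : ℤ) + 3 - m - p) := by
      have := hpow Λ0 hΛ.2
      gcongr
    have n3 : c i * majorant (Mb i m p) ℓ * Λ ^ ((e i : ℤ) + 3 - m - p)
        + c i * majorant M1 ℓ * Λ ^ ((e i : ℤ) + 3 - m - p)
        ≤ c i * majorant (Mb i m p + M1) ℓ * Λ ^ ((e i : ℤ) + 3 - m - p) := by
      rw [← add_mul, ← mul_add]
      have := add_majorant_le (Mb i m p) M1 hℓ
      gcongr
    have n4 := norm_le_norm_add_norm_sub (iteratedFDeriv ℝ p (V i m Λ0) k)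
      (iteratedFDeriv ℝ p (V i m Λ) k)
    linarith
  intro p
  induction hq : 4 - (m + p) generalizing p with
  | zero => exact hhigh p (by omega)
  | succ q ihq =>
    -- For m + p ≤ 3 the flow is integrated upward from Λ_R at zero momentum only; the bound on the
    -- next derivative then extends the estimate to the whole region.
    obtain ⟨M2, hM2⟩ := ihq (p + 1) (by omega)
    obtain ⟨M1, hM1⟩ := exists_majorant (MA p) (MA p + 1)
    refine ⟨Mb i m p + M1 + (M2 + M2), fun {ΛR Λ0 B ℓ V c} h Λ hΛ k hk => ?_⟩
    have hΛ0 : 0 < Λ := h.pos.trans_le hΛ.1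
    have hℓ := h.one_le
    have hc := h.nonneg i
    have ha : 0 ≤ (e i : ℤ) + 3 - m - p := by omega
    have hsub := h.sub_eq hK i m p le_rfl hΛ.1 hΛ.2 0
    have hpow : ∀ t, 0 < t → t ≤ Λ →
        t ^ ((e i : ℤ) + 3 - m - p) ≤ Λ ^ ((e i : ℤ) + 3 - m - p) := by
      intro t ht0 ht
      exact zpow_le_zpow_left₀ ha ht0.le ht
    have hint := norm_integral_le_log (D := c i * majorant (MA p) ℓ
        * Λ ^ ((e i : ℤ) + 3 - m - p)) h.pos hΛ.1
      (J := fun x => iteratedFDeriv ℝ p (flowPart K B pairs V i m x) 0) (fun t ht => by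
        have ht0 : 0 < t := h.pos.trans_le ht.1
        refine (hMA p h t ⟨ht.1, ht.2.trans hΛ.2⟩ 0 (inRegion_zero ht0.le)).trans ?_
        rw [scale_eq ht0, show (e i : ℤ) + 2 - m - p = ((e i : ℤ) + 3 - m - p) - 1 by ring,
          zpow_sub_one₀ ht0.ne', ← mul_assoc]
        have := hpow t ht0 ht.2
        have := majorant_nonneg (MA p) hℓ
        gcongr)
    rw [← hsub] at hint
    have hb := h.low i m p (by omega)
    rw [scale_eq h.pos] at hb
    have ht := taylor_inRegion ((h.family i m).smooth Λ hΛ) hΛ0.le p (hM2 h Λ hΛ) hk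
    have ht' : c i * Λ ^ e i * majorant M2 ℓ * Λ ^ ((3 : ℤ) - m) / Λ ^ (p + 1) * (2 * Λ)
        = c i * (majorant M2 ℓ + majorant M2 ℓ) * Λ ^ ((e i : ℤ) + 3 - m - p) := by
      rw [← scale_eq hΛ0]
      field_simp
      ring
    rw [ht'] at ht
    rw [scale_eq hΛ0]
    have hlog := h.log_le' le_rfl hΛ.1 hΛ.2
    have hmaj := majorant_nonneg (MA p) hℓ
    have hmaj' := majorant_nonneg (Mb i m p) hℓ
    have n1 : c i * majorant (MA p) ℓ * Λ ^ ((e i : ℤ) + 3 - m - p) * Real.log (Λ / ΛR)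
        ≤ c i * majorant M1 ℓ * Λ ^ ((e i : ℤ) + 3 - m - p) := by
      calc _ ≤ c i * majorant (MA p) ℓ * Λ ^ ((e i : ℤ) + 3 - m - p) * ℓ := by gcongr
        _ = c i * ((MA p) * ℓ ^ (MA p + 1)) * Λ ^ ((e i : ℤ) + 3 - m - p) := by
          simp only [majorant]; ring
        _ ≤ _ := by have := hM1 ℓ hℓ; gcongr
    have n2 : c i * majorant (Mb i m p) ℓ * ΛR ^ ((e i : ℤ) + 3 - m - p)
        ≤ c i * majorant (Mb i m p) ℓ * Λ ^ ((e i : ℤ) + 3 - m - p) := by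
      have := hpow ΛR h.pos hΛ.1
      gcongr
    have n3 : c i * majorant (Mb i m p) ℓ * Λ ^ ((e i : ℤ) + 3 - m - p)
        + c i * majorant M1 ℓ * Λ ^ ((e i : ℤ) + 3 - m - p)
        + c i * (majorant M2 ℓ + majorant M2 ℓ) * Λ ^ ((e i : ℤ) + 3 - m - p)
        ≤ c i * majorant (Mb i m p + M1 + (M2 + M2)) ℓ * Λ ^ ((e i : ℤ) + 3 - m - p) := by
      rw [← add_mul, ← mul_add, ← add_mul, ← mul_add]
      have h1 := add_majorant_le (Mb i m p) M1 hℓ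
      have h2 := add_majorant_le M2 M2 hℓ
      have h3 := add_majorant_le (Mb i m p + M1) (M2 + M2) hℓ
      have h4 : majorant (Mb i m p) ℓ + majorant M1 ℓ + (majorant M2 ℓ + majorant M2 ℓ)
          ≤ majorant (Mb i m p + M1 + (M2 + M2)) ℓ := by linarith
      gcongr
    have n4 := norm_le_norm_add_norm_sub' (iteratedFDeriv ℝ p (V i m Λ) 0)
      (iteratedFDeriv ℝ p (V i m ΛR) 0)
    linarith

end Bound

/-! ### Consequences of the symmetries at zero momentum -/

section Symmetry

theorem iteratedFDeriv_zero_invariant {E : Type} [NormedAddCommGroup E] [NormedSpace ℝ E]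
    {f : E → ℝ} (hf : ContDiff ℝ ∞ f) (T : E →L[ℝ] E) (hT : ∀ k, f (T k) = f k) (p : ℕ)
    (v : Fin p → E) :
    iteratedFDeriv ℝ p f 0 (fun j => T (v j)) = iteratedFDeriv ℝ p f 0 v := by
  have h := iteratedFDeriv_comp_affine hf T 0 p 0
  simp only [add_zero, map_zero, hT] at h
  conv_rhs => rw [h]
  rfl

theorem iteratedFDeriv_zero_of_odd {E : Type} [NormedAddCommGroup E] [NormedSpace ℝ E]
    {f : E → ℝ} (hf : ContDiff ℝ ∞ f) (hneg : ∀ k, f (-k) = f k) {p : ℕ} (hp : Odd p) :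
    iteratedFDeriv ℝ p f 0 = 0 := by
  ext v
  have h := iteratedFDeriv_zero_invariant hf (-ContinuousLinearMap.id ℝ E)
    (fun k => by simpa using hneg k) p v
  have h2 := (iteratedFDeriv ℝ p f 0).map_smul_univ (fun _ => (-1 : ℝ)) v
  simp only [neg_smul, one_smul, Finset.prod_const, Finset.card_univ, Fintype.card_fin,
    hp.neg_one_pow, smul_eq_mul] at h2
  simp only [neg_apply, ContinuousLinearMap.id_apply] at h
  rw [h] at h2
  simp only [zero_apply]
  linarith

theorem iteratedFDeriv_of_isEmpty {f : (Fin 0 → Momentum) → ℝ} {p : ℕ} (hp : p ≠ 0)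
    (k : Fin 0 → Momentum) : iteratedFDeriv ℝ p f k = 0 := by
  have : f = fun _ => f 0 := funext fun k => congrArg f (Subsingleton.elim _ _)
  rw [this, iteratedFDeriv_const_of_ne hp]
  rfl

variable {m : ℕ} {f : (Fin m → Momentum) → ℝ}

/-- The Hessian at zero momentum. -/
def hessian (f : (Fin m → Momentum) → ℝ) :
    (Fin m → Momentum) →L[ℝ] (Fin m → Momentum) →L[ℝ] ℝ := fderiv ℝ (fderiv ℝ f) 0

theorem hessian_eq (v w : Fin m → Momentum) :
    hessian f v w = iteratedFDeriv ℝ 2 f 0 ![v, w] := by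
  rw [iteratedFDeriv_two_apply]; rfl

theorem hessian_invariant (hf : ContDiff ℝ ∞ f)
    (T : (Fin m → Momentum) →L[ℝ] (Fin m → Momentum)) (hT : ∀ k, f (T k) = f k)
    (v w : Fin m → Momentum) : hessian f (T v) (T w) = hessian f v w := by
  rw [hessian_eq, hessian_eq, ← iteratedFDeriv_zero_invariant hf T hT 2 ![v, w]]
  congr 1
  funext j
  fin_cases j <;> rfl

/-- The action of an orthogonal transformation on all momenta. -/
def rotate (m : ℕ) (g : Momentum ≃ₗᵢ[ℝ] Momentum) :
    (Fin m → Momentum) →L[ℝ] (Fin m → Momentum) :=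
  ContinuousLinearMap.pi fun i =>
    (g.toContinuousLinearEquiv : Momentum →L[ℝ] Momentum).comp (ContinuousLinearMap.proj i)

@[simp] theorem rotate_apply (g : Momentum ≃ₗᵢ[ℝ] Momentum) (k : Fin m → Momentum) :
    rotate m g k = fun i => g (k i) := rfl

theorem rotate_single (g : Momentum ≃ₗᵢ[ℝ] Momentum) (i : Fin m) (v : Momentum) :
    rotate m g (Pi.single i v) = Pi.single i (g v) := by
  funext j
  rcases eq_or_ne j i with rfl | h <;> simp [*]

/-- The `μ`-th unit momentum on the leg `i`. -/
def unitLeg (i : Fin m) (μ : Fin 4) : Fin m → Momentum :=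
  Pi.single i (EuclideanSpace.single μ 1)

theorem secondDeriv_eq (i j : Fin m) : secondDeriv f i j = hessian f (unitLeg i 0) (unitLeg j 0) := by
  rw [hessian_eq]; rfl

/-- Reflecting the coordinate μ changes the sign of the first argument and fixes the second. -/
theorem hessian_unitLeg_of_ne (hf : ContDiff ℝ ∞ f)
    (hg : ∀ (g : Momentum ≃ₗᵢ[ℝ] Momentum) k, f (fun i => g (k i)) = f k) (i j : Fin m)
    {μ ν : Fin 4} (h : μ ≠ ν) : hessian f (unitLeg i μ) (unitLeg j ν) = 0 := by
  let g : Momentum ≃ₗᵢ[ℝ] Momentum := LinearIsometryEquiv.piLpCongrRight 2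
    (fun κ : Fin 4 => if κ = μ then LinearIsometryEquiv.neg ℝ else LinearIsometryEquiv.refl ℝ ℝ)
  have h1 : rotate m g (unitLeg i μ) = -unitLeg i μ := by
    rw [unitLeg, rotate_single, ← Pi.single_neg]
    congr 1
    have := LinearIsometryEquiv.piLpCongrRight_single (p := 2) (𝕜 := ℝ) (fun κ : Fin 4 =>
      if κ = μ then LinearIsometryEquiv.neg ℝ else LinearIsometryEquiv.refl ℝ ℝ) μ (1 : ℝ)
    refine this.trans ?_
    ext κ
    rcases eq_or_ne κ μ with rfl | hκ <;> simp [*]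
  have h2 : rotate m g (unitLeg j ν) = unitLeg j ν := by
    rw [unitLeg, rotate_single]
    congr 1
    have := LinearIsometryEquiv.piLpCongrRight_single (p := 2) (𝕜 := ℝ) (fun κ : Fin 4 =>
      if κ = μ then LinearIsometryEquiv.neg ℝ else LinearIsometryEquiv.refl ℝ ℝ) ν (1 : ℝ)
    refine this.trans ?_
    simp [h.symm]
  have h3 := hessian_invariant hf (rotate m g) (fun k => hg g k) (unitLeg i μ) (unitLeg j ν)
  rw [h1, h2, map_neg, neg_apply] at h3
  linarith

/-- Exchanging the coordinate axes 0 and μ is orthogonal. -/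
theorem hessian_unitLeg_self (hf : ContDiff ℝ ∞ f)
    (hg : ∀ (g : Momentum ≃ₗᵢ[ℝ] Momentum) k, f (fun i => g (k i)) = f k) (i j : Fin m)
    (μ : Fin 4) : hessian f (unitLeg i μ) (unitLeg j μ) = secondDeriv f i j := by
  let g : Momentum ≃ₗᵢ[ℝ] Momentum :=
    LinearIsometryEquiv.piLpCongrLeft 2 ℝ ℝ (Equiv.swap 0 μ)
  have h1 : ∀ i : Fin m, rotate m g (unitLeg i 0) = unitLeg i μ := by
    intro i
    rw [unitLeg, rotate_single, unitLeg]
    congr 1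
    have := EuclideanSpace.piLpCongrLeft_single (𝕜 := ℝ) (Equiv.swap (0 : Fin 4) μ) 0 1
    rw [Equiv.swap_apply_left] at this
    exact this
  rw [secondDeriv_eq, ← hessian_invariant hf (rotate m g) (fun k => hg g k) (unitLeg i 0), h1, h1]

theorem eq_sum_unitLeg (v : Fin m → Momentum) : v = ∑ i, ∑ μ, v i μ • unitLeg i μ := by
  funext j
  ext κ
  rw [Finset.sum_apply, Finset.sum_eq_single j]
  · simp [unitLeg, Pi.single_apply]
  · intro i _ hi
    simp [unitLeg, Pi.single_eq_of_ne hi.symm]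
  · simp

theorem hessian_expand (v w : Fin m → Momentum) : hessian f v w
    = ∑ i, ∑ μ, ∑ j, ∑ ν, v i μ * (w j ν * hessian f (unitLeg i μ) (unitLeg j ν)) := by
  conv_lhs => rw [eq_sum_unitLeg v]
  simp only [map_sum, map_smul, sum_apply, smul_apply, smul_eq_mul]
  refine Finset.sum_congr rfl fun i _ => Finset.sum_congr rfl fun μ _ => ?_
  conv_lhs => rw [eq_sum_unitLeg w]
  simp only [map_sum, map_smul, smul_eq_mul, Finset.mul_sum]

/-- Invariance leaves only the terms with μ = ν, and these agree for all μ; the factor 4 counts the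
coordinates. So finitely many couplings control the full second derivative. -/
theorem norm_iteratedFDeriv_two_le (hf : ContDiff ℝ ∞ f)
    (hg : ∀ (g : Momentum ≃ₗᵢ[ℝ] Momentum) k, f (fun i => g (k i)) = f k) :
    ‖iteratedFDeriv ℝ 2 f 0‖ ≤ 4 * ∑ i, ∑ j, |secondDeriv f i j| := by
  refine ContinuousMultilinearMap.opNorm_le_bound (by positivity) fun x => ?_
  have hx : iteratedFDeriv ℝ 2 f 0 x = hessian f (x 0) (x 1) := by
    rw [hessian_eq]; congr 1; funext j; fin_cases j <;> rfl
  have hc : ∀ (v : Fin m → Momentum) i μ, |v i μ| ≤ ‖v‖ := fun v i μ =>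
    (PiLp.norm_apply_le (v i) μ).trans (norm_le_pi_norm v i)
  rw [hx, hessian_expand, Real.norm_eq_abs, Fin.prod_univ_two]
  have hterm : ∀ i j : Fin m, ∀ μ ν : Fin 4,
      |x 0 i μ * (x 1 j ν * hessian f (unitLeg i μ) (unitLeg j ν))|
        ≤ if μ = ν then |secondDeriv f i j| * (‖x 0‖ * ‖x 1‖) else 0 := by
    intro i j μ ν
    split_ifs with h
    · subst h
      rw [hessian_unitLeg_self hf hg, abs_mul, abs_mul]
      calc |x 0 i μ| * (|x 1 j μ| * |secondDeriv f i j|)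
          ≤ ‖x 0‖ * (‖x 1‖ * |secondDeriv f i j|) := by
            gcongr
            · exact hc _ _ _
            · exact hc _ _ _
        _ = _ := by ring
    · rw [hessian_unitLeg_of_ne hf hg i j h]; simp
  calc _ ≤ ∑ i, ∑ μ : Fin 4, ∑ j, ∑ ν : Fin 4,
        |x 0 i μ * (x 1 j ν * hessian f (unitLeg i μ) (unitLeg j ν))| := by
        refine (Finset.abs_sum_le_sum_abs _ _).trans (Finset.sum_le_sum fun i _ => ?_)
        refine (Finset.abs_sum_le_sum_abs _ _).trans (Finset.sum_le_sum fun μ _ => ?_)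
        refine (Finset.abs_sum_le_sum_abs _ _).trans (Finset.sum_le_sum fun j _ => ?_)
        exact Finset.abs_sum_le_sum_abs _ _
    _ ≤ ∑ i, ∑ μ : Fin 4, ∑ j, ∑ ν : Fin 4,
        (if μ = ν then |secondDeriv f i j| * (‖x 0‖ * ‖x 1‖) else 0) :=
        Finset.sum_le_sum fun i _ => Finset.sum_le_sum fun μ _ =>
          Finset.sum_le_sum fun j _ => Finset.sum_le_sum fun ν _ => hterm i j μ ν
    _ = _ := by
        simp [← Finset.sum_mul, ← Finset.mul_sum, mul_assoc]

theorem secondDeriv_perm (hf : ContDiff ℝ ∞ f)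
    (hp : ∀ (σ : Equiv.Perm (Fin m)) (k : Fin m → Momentum), f (fun i => k (σ i)) = f k)
    (σ : Equiv.Perm (Fin m)) (i j : Fin m) :
    secondDeriv f (σ i) (σ j) = secondDeriv f i j := by
  let T : (Fin m → Momentum) →L[ℝ] (Fin m → Momentum) :=
    ContinuousLinearMap.pi fun i => ContinuousLinearMap.proj (σ i)
  have h1 : ∀ i, T (unitLeg (σ i) 0) = unitLeg i 0 := by
    intro i
    funext j
    change unitLeg (σ i) 0 (σ j) = _
    rcases eq_or_ne j i with rfl | h
    · simp [unitLeg]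
    · simp [unitLeg, h]
  rw [secondDeriv_eq, secondDeriv_eq, ← hessian_invariant hf T (fun k => hp σ k), h1, h1]

end Symmetry

/-! ### A perturbative solution as a flow system -/

/-- The decompositions of an order into two orders of the interaction. -/
def orderPairs (r : Order) : Finset (Order × Order) :=
  (Finset.HasAntidiagonal.antidiagonal r).filter fun s => s.1 ≠ 0 ∧ s.2 ≠ 0

theorem mem_orderPairs {r : Order} {s : Order × Order} :
    s ∈ orderPairs r ↔ s.1 + s.2 = r ∧ s.1 ≠ 0 ∧ s.2 ≠ 0 := by
  simp [orderPairs]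

theorem degree_lt_of_mem_orderPairs {r : Order} {s : Order × Order} (hs : s ∈ orderPairs r) :
    s.1.degree < r.degree ∧ s.2.degree < r.degree := by
  obtain ⟨rfl, h1, h2⟩ := mem_orderPairs.1 hs
  have h3 : s.1.degree ≠ 0 := fun h => h1 ((Finsupp.degree_eq_zero_iff _).1 h)
  have h4 : s.2.degree ≠ 0 := fun h => h2 ((Finsupp.degree_eq_zero_iff _).1 h)
  rw [map_add]
  omega

@[simp] theorem orderIrr_add (r s : Order) : orderIrr (r + s) = orderIrr r + orderIrr s := by
  simp only [orderIrr, Finsupp.add_apply]; ring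

@[simp] theorem orderIrr_zero : orderIrr 0 = 0 := rfl

theorem orderIrr_single_irr (a : Fin 3) : orderIrr (Finsupp.single (irr a) 1) = 1 := by
  fin_cases a <;> simp [orderIrr, irr]

theorem single_irr_apply_zero (a : Fin 3) : (Finsupp.single (irr a) 1 : Order) 0 = 0 := by
  fin_cases a <;> simp [irr]

/-- The number of powers of the scale gained by the presence of irrelevant couplings. -/
def irrGain (r : Order) : ℕ := if orderIrr r = 0 then 0 else 1

/-- The prefactor in the power counting bounds. -/
def scaleWeight (ΛR Λ0 : ℝ) (r : Order) : ℝ := (ΛR ^ r 0)⁻¹ * Λ0 ^ (orderIrr r - irrGain r)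

/-- The only strict loss occurs when both orders contain irrelevant couplings: the product then has
two powers of Λ where one is allowed, and the surplus one is bounded by Λ₀. -/
theorem scaleWeight_mul {ΛR Λ0 Λ : ℝ} (hR : 0 < ΛR) (hΛ : Λ ∈ Icc ΛR Λ0) (r s : Order) :
    (scaleWeight ΛR Λ0 r * Λ ^ irrGain r) * (scaleWeight ΛR Λ0 s * Λ ^ irrGain s)
      ≤ scaleWeight ΛR Λ0 (r + s) * Λ ^ irrGain (r + s) := by
  have h0 : 0 < Λ := hR.trans_le hΛ.1
  have h1 : 0 < Λ0 := h0.trans_le hΛ.2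
  have key : (Λ0 ^ (orderIrr r - irrGain r) * Λ ^ irrGain r)
      * (Λ0 ^ (orderIrr s - irrGain s) * Λ ^ irrGain s)
      ≤ Λ0 ^ (orderIrr (r + s) - irrGain (r + s)) * Λ ^ irrGain (r + s) := by
    simp only [irrGain, orderIrr_add]
    generalize orderIrr r = a
    generalize orderIrr s = b
    rcases a with - | a <;> rcases b with - | b
    · simp
    · simp
    · simp
    · simp only [Nat.add_eq_zero_iff, one_ne_zero, and_false, if_false]
      rw [show a + 1 + (b + 1) - 1 = a + b + 1 by omega, Nat.add_sub_cancel, Nat.add_sub_cancel]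
      calc Λ0 ^ a * Λ ^ 1 * (Λ0 ^ b * Λ ^ 1) = Λ0 ^ (a + b) * Λ * Λ := by ring
        _ ≤ Λ0 ^ (a + b) * Λ0 * Λ := by have := hΛ.2; gcongr
        _ = _ := by ring
  calc _ = ((ΛR ^ r 0)⁻¹ * (ΛR ^ s 0)⁻¹) * ((Λ0 ^ (orderIrr r - irrGain r) * Λ ^ irrGain r)
      * (Λ0 ^ (orderIrr s - irrGain s) * Λ ^ irrGain s)) := by simp only [scaleWeight]; ring
    _ ≤ ((ΛR ^ r 0)⁻¹ * (ΛR ^ s 0)⁻¹)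
        * (Λ0 ^ (orderIrr (r + s) - irrGain (r + s)) * Λ ^ irrGain (r + s)) := by gcongr
    _ = _ := by
      rw [scaleWeight, Finsupp.add_apply, pow_add, mul_inv]; ring

theorem scaleWeight_top {Λ0 : ℝ} (ΛR : ℝ) (r : Order) :
    scaleWeight ΛR Λ0 r * Λ0 ^ irrGain r = (ΛR ^ r 0)⁻¹ * Λ0 ^ orderIrr r := by
  rw [scaleWeight, mul_assoc, ← pow_add]
  congr 2
  simp only [irrGain]
  split_ifs <;> omega

/-- Order zero carries no interaction, so decompositions with a zero entry drop out. The remaining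
pairs have strictly smaller degree, as the induction requires. -/
theorem flowRHS_eq {K : ℝ → ℝ} {A B Λ : ℝ} {L : VertexFunctions} (h0 : ∀ m k, L 0 m Λ k = 0)
    (r : Order) (m : ℕ) (k : Fin m → Momentum) :
    flowRHS K A B L r m Λ k = flowPart K B orderPairs L r m Λ k := by
  simp only [flowRHS, flowPart, dPropagator_zero, mul_zero, sub_zero, loopPart]
  congr 2
  rw [Finset.sum_comm]
  rw [orderPairs, Finset.sum_filter]
  refine Finset.sum_congr rfl fun s _ => ?_
  split_ifs with h
  · rfl
  · rw [not_and_or, not_not, not_not] at h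
    rcases h with h | h <;> simp [h, h0]

section PerturbativeFlow

variable {K : ℝ → ℝ} {A B ΛR Λ0 : ℝ} {L : VertexFunctions}

theorem IsPerturbativeFlow.hasDeriv (h : IsPerturbativeFlow K A B ΛR Λ0 L) (r : Order) (m : ℕ)
    {Λ : ℝ} (hΛ : Λ ∈ Icc ΛR Λ0) (k : Fin m → Momentum) :
    HasDerivWithinAt (fun s => L r m s k) (flowPart K B orderPairs L r m Λ k) (Icc ΛR Λ0) Λ := by
  rw [← flowRHS_eq (A := A) fun m k => h.zeroOrder m Λ hΛ k]
  exact h.flow r m Λ hΛ k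

theorem IsPerturbativeFlow.family (h : IsPerturbativeFlow K A B ΛR Λ0 L) (r : Order) (m : ℕ) :
    SmoothFamily (Icc ΛR Λ0) (L r m) :=
  ⟨h.smooth r m, h.continuous r m⟩

theorem IsPerturbativeFlow.odd_zero (h : IsPerturbativeFlow K A B ΛR Λ0 L) {Λ : ℝ}
    (hΛ : Λ ∈ Icc ΛR Λ0) (r : Order) (m : ℕ) {p : ℕ} (hp : Odd p) :
    iteratedFDeriv ℝ p (L r m Λ) 0 = 0 :=
  iteratedFDeriv_zero_of_odd (h.smooth r m Λ hΛ)
    (fun k => h.orthogonal r m Λ hΛ (LinearIsometryEquiv.neg ℝ) k) hp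

theorem IsPerturbativeFlow.hessian_le (h : IsPerturbativeFlow K A B ΛR Λ0 L) {Λ : ℝ}
    (hΛ : Λ ∈ Icc ΛR Λ0) (r : Order) (m : ℕ) :
    ‖iteratedFDeriv ℝ 2 (L r m Λ) 0‖ ≤ 4 * ∑ i, ∑ j, |secondDeriv (L r m Λ) i j| :=
  norm_iteratedFDeriv_two_le (h.smooth r m Λ hΛ) (h.orthogonal r m Λ hΛ)

theorem IsPerturbativeFlow.rhoRel_eq (h : IsPerturbativeFlow K A B ΛR Λ0 L) (r : Order) :
    L r 0 ΛR 0 = 0 ∧ L r 1 ΛR 0 = 0 ∧ secondDeriv (L r 1 ΛR) 0 0 = 0 ∧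
      L r 2 ΛR 0 = (if r = Finsupp.single 0 1 then 1 else 0) ∧
      L r 3 ΛR 0 = (if r = Finsupp.single 1 1 then 1 else 0) := by
  have := h.renormalization r
  refine ⟨congrFun this 0, congrFun this 1, congrFun this 2, congrFun this 3, congrFun this 4⟩

/-- At the renormalization scale the relevant derivatives vanish. -/
theorem IsPerturbativeFlow.low_deriv (h : IsPerturbativeFlow K A B ΛR Λ0 L) (hle : ΛR ≤ Λ0)
    (r : Order) {m p : ℕ} (hp : p ≠ 0) (hmp : m + p ≤ 3) :
    iteratedFDeriv ℝ p (L r m ΛR) 0 = 0 := by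
  have hΛ : ΛR ∈ Icc ΛR Λ0 := left_mem_Icc.2 hle
  rcases Nat.even_or_odd p with he | ho
  · have h2 : p = 2 := by
      obtain ⟨q, rfl⟩ := he
      omega
    subst h2
    have hm : m = 0 ∨ m = 1 := by omega
    rcases hm with rfl | rfl
    · exact iteratedFDeriv_of_isEmpty two_ne_zero 0
    · have h3 := h.hessian_le hΛ r 1
      simp only [Fin.sum_univ_one, (h.rhoRel_eq r).2.2.1, abs_zero, mul_zero] at h3
      exact norm_le_zero_iff.1 h3
  · exact h.odd_zero hΛ r m ho

theorem IsPerturbativeFlow.low_value (h : IsPerturbativeFlow K A B ΛR Λ0 L)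
    (r : Order) {m : ℕ} (hm : m ≤ 3) :
    L r m ΛR 0 = if m = 2 ∧ r = Finsupp.single 0 1 then 1
      else if m = 3 ∧ r = Finsupp.single 1 1 then 1 else 0 := by
  obtain ⟨h0, h1, -, h2, h3⟩ := h.rhoRel_eq r
  interval_cases m
  · rw [h0]; simp
  · rw [h1]; simp
  · rw [h2]; simp
  · rw [h3]; simp

theorem IsPerturbativeFlow.rhoIrr_bound (h : IsPerturbativeFlow K A B ΛR Λ0 L) (hR : 0 < ΛR)
    (hle : ΛR ≤ Λ0) (r : Order) (a : Fin 3) :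
    |rhoIrr L r Λ0 a| ≤ (ΛR ^ r 0)⁻¹ * Λ0 ^ orderIrr r / Λ0 := by
  have h0 : 0 < Λ0 := hR.trans_le hle
  rw [h.initial r a]
  split_ifs with hr
  · rw [hr, orderIrr_single_irr, single_irr_apply_zero]
    simp [h0.ne']
  · rw [abs_zero]; positivity

/-- For n + p = 5 the smallness assumption on the bare functions says nothing, but the values at
zero momentum are fixed by the bare couplings: odd derivatives vanish by reflection, which leaves
the Hessian of the three-point function and the five-point function. The constant 16 is the
coordinate factor 4 times four Hessian entries. -/
theorem IsPerturbativeFlow.marginal_bound (h : IsPerturbativeFlow K A B ΛR Λ0 L) (hR : 0 < ΛR)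
    (hle : ΛR ≤ Λ0) (r : Order) {m p : ℕ} (hmp : m + p = 4) :
    ‖iteratedFDeriv ℝ p (L r m Λ0) 0‖ ≤ 16 * ((ΛR ^ r 0)⁻¹ * Λ0 ^ orderIrr r / Λ0) := by
  have h0 : 0 < Λ0 := hR.trans_le hle
  have hΛ : Λ0 ∈ Icc ΛR Λ0 := right_mem_Icc.2 hle
  have hX : 0 ≤ (ΛR ^ r 0)⁻¹ * Λ0 ^ orderIrr r / Λ0 := by positivity
  have hm : m ≤ 4 := by omega
  interval_cases m
  · rw [iteratedFDeriv_of_isEmpty (by omega)]; simpa using hX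
  · rw [h.odd_zero hΛ r 1 (show Odd p from ⟨1, by omega⟩)]; simpa using hX
  · obtain rfl : p = 2 := by omega
    refine (h.hessian_le hΛ r 2).trans ?_
    have hperm := fun σ i j => secondDeriv_perm (h.smooth r 2 Λ0 hΛ) (h.perm r 2 Λ0 hΛ) σ i j
    have e1 : secondDeriv (L r 2 Λ0) 1 1 = secondDeriv (L r 2 Λ0) 0 0 := by
      simpa using hperm (Equiv.swap 0 1) 0 0
    have e2 : secondDeriv (L r 2 Λ0) 1 0 = secondDeriv (L r 2 Λ0) 0 1 := by
      simpa using hperm (Equiv.swap 0 1) 0 1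
    have b1 : |secondDeriv (L r 2 Λ0) 0 0| ≤ _ := h.rhoIrr_bound hR hle r 0
    have b2 : |secondDeriv (L r 2 Λ0) 0 1| ≤ _ := h.rhoIrr_bound hR hle r 1
    simp only [Fin.sum_univ_two, e1, e2]
    linarith
  · rw [h.odd_zero hΛ r 3 (show Odd p from ⟨0, by omega⟩)]; simpa using hX
  · obtain rfl : p = 0 := by omega
    have b : |L r 4 Λ0 0| ≤ _ := h.rhoIrr_bound hR hle r 2
    rw [norm_iteratedFDeriv_zero, Real.norm_eq_abs]
    linarith

end PerturbativeFlow

theorem exists_majorant_polynomial (P : Polynomial ℝ) : ∃ M : ℕ, ∀ t ℓ, 0 ≤ t → 1 + t ≤ ℓ →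
    P.eval t ≤ majorant M ℓ := by
  obtain ⟨M, hM⟩ := exists_majorant (∑ i ∈ Finset.range (P.natDegree + 1), |P.coeff i|) P.natDegree
  refine ⟨M, fun t ℓ ht hℓ => le_trans ?_ (hM ℓ (by linarith))⟩
  rw [Polynomial.eval_eq_sum_range, Finset.sum_mul]
  refine Finset.sum_le_sum fun i hi => ?_
  have h1 : t ^ i ≤ ℓ ^ P.natDegree :=
    (pow_le_pow_left₀ ht (by linarith) i).trans
      (pow_le_pow_right₀ (by linarith) (by simpa [Nat.lt_succ_iff] using hi))
  calc P.coeff i * t ^ i ≤ |P.coeff i| * t ^ i := by gcongr; exact le_abs_self _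
    _ ≤ _ := by gcongr

section Bare

variable {P : Order → ℕ → ℕ → Polynomial ℝ} {ΛR Λ0 : ℝ} {L : VertexFunctions}

theorem SmallBare.bound (h : SmallBare P ΛR Λ0 L) (hR : 0 < ΛR) (hle : ΛR ≤ Λ0) (r : Order)
    {m p : ℕ} (hmp : 5 ≤ m + p) {M : ℕ} {ℓ : ℝ}
    (hM : (P r m p).eval (Real.log (Λ0 / ΛR)) ≤ majorant M ℓ) {k : Fin m → Momentum}
    (hk : InRegion Λ0 k) : ‖iteratedFDeriv ℝ p (L r m Λ0) k‖
      ≤ (ΛR ^ r 0)⁻¹ * Λ0 ^ orderIrr r * majorant M ℓ * Λ0 ^ ((3 : ℤ) - m) / Λ0 ^ p := by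
  have h0 : 0 < Λ0 := hR.trans_le hle
  have hb := h r m p (by omega) k hk
  have e : Λ0 ^ (((m + 1 : ℕ) : ℤ) - 4 + (r 0 : ℤ) - (orderIrr r : ℤ))
      = Λ0 ^ r 0 / (Λ0 ^ orderIrr r * Λ0 ^ ((3 : ℤ) - m)) := by
    rw [eq_div_iff (by positivity), ← zpow_natCast Λ0 (r 0), ← zpow_natCast Λ0 (orderIrr r),
      ← zpow_add₀ h0.ne', ← zpow_add₀ h0.ne']
    congr 1
    push_cast
    ring
  rw [e, div_mul_eq_mul_div, div_le_iff₀ (by positivity)] at hb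
  have h1 : Λ0 ^ r 0 * ‖iteratedFDeriv ℝ p (L r m Λ0) k‖
      ≤ Λ0 ^ r 0 * ((ΛR ^ r 0)⁻¹ * Λ0 ^ orderIrr r * majorant M ℓ * Λ0 ^ ((3 : ℤ) - m)
        / Λ0 ^ p) := by
    refine hb.trans ?_
    rw [pln]
    calc (Λ0 ^ p)⁻¹ * (Λ0 / ΛR) ^ r 0 * (P r m p).eval (Real.log (Λ0 / ΛR))
          * (Λ0 ^ orderIrr r * Λ0 ^ ((3 : ℤ) - m))
        ≤ (Λ0 ^ p)⁻¹ * (Λ0 / ΛR) ^ r 0 * majorant M ℓ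
          * (Λ0 ^ orderIrr r * Λ0 ^ ((3 : ℤ) - m)) := by gcongr
      _ = _ := by rw [div_pow]; field_simp
  exact le_of_mul_le_mul_left h1 (by positivity)

end Bare

/-- The tower of a perturbative solution satisfies power counting bounds. -/
theorem exists_flowSystem (P : Order → ℕ → ℕ → Polynomial ℝ) : ∃ Mb : Order → ℕ → ℕ → ℕ,
    ∀ {K : ℝ → ℝ} {A B ΛR Λ0 ℓ : ℝ} {L : VertexFunctions}, 0 < ΛR → ΛR ≤ Λ0 → |B| ≤ ΛR ^ 2 →
      1 + Real.log (Λ0 / ΛR) ≤ ℓ → IsPerturbativeFlow K A B ΛR Λ0 L → SmallBare P ΛR Λ0 L →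
      FlowSystem K orderPairs (fun r => 3 * r.degree + 2) irrGain Mb ΛR Λ0 B ℓ L
        (scaleWeight ΛR Λ0) := by
  choose M hM using fun r m p => exists_majorant_polynomial (P r m p)
  -- The values at Λ_R are 0 or 1, so 1 suffices for m + p ≤ 3. For m + p = 4 the bound adds 16,
  -- from zero momentum, and twice the majorant of the next derivative, from Taylor's formula.
  -- Beyond that the assumed polynomials apply.
  refine ⟨fun r m p => if m + p ≤ 3 then 1 else if m + p = 4 then
    16 + (M r m (p + 1) + M r m (p + 1)) else M r m p, ?_⟩
  intro K A B ΛR Λ0 ℓ L hR hle hB hlog h hs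
  have h0 : 0 < Λ0 := hR.trans_le hle
  have hlog0 : 0 ≤ Real.log (Λ0 / ΛR) := Real.log_nonneg ((one_le_div hR).2 hle)
  have hℓ : 1 ≤ ℓ := by linarith
  have hMl : ∀ r m p, (P r m p).eval (Real.log (Λ0 / ΛR)) ≤ majorant (M r m p) ℓ :=
    fun r m p => hM r m p _ ℓ hlog0 hlog
  refine ⟨hR, hle, hB, hlog, h.family, fun r m Λ hΛ k => h.hasDeriv r m hΛ k,
    fun r m hm Λ hΛ k => h.finiteLegs r m Λ hΛ hm k, fun r => ?_, ?_, fun r => ?_, ?_, ?_⟩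
  · simp only [scaleWeight]; positivity
  · intro r s hs Λ hΛ
    have := scaleWeight_mul hR hΛ s.1 s.2
    rwa [(mem_orderPairs.1 hs).1] at this
  · simp only [irrGain]; split_ifs <;> simp
  · intro r m p hmp
    have hw : 0 ≤ scaleWeight ΛR Λ0 r := by simp only [scaleWeight]; positivity
    have hrhs : 0 ≤ scaleWeight ΛR Λ0 r * ΛR ^ irrGain r * majorant 1 ℓ * ΛR ^ ((3 : ℤ) - m)
        / ΛR ^ p := by
      have := majorant_nonneg 1 hℓ
      positivity
    rw [if_pos hmp]
    rcases eq_or_ne p 0 with rfl | hp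
    · rw [norm_iteratedFDeriv_zero, h.low_value r (by omega)]
      split_ifs with h1 h2
      · obtain ⟨rfl, rfl⟩ := h1
        simp only [scaleWeight, irrGain, orderIrr, majorant, norm_one, Finsupp.single_eq_same,
          pow_one, Nat.cast_one, Nat.cast_ofNat, pow_zero, one_mul, div_one]
        simp only [ne_eq, Fin.reduceEq, not_false_eq_true, Finsupp.single_eq_of_ne, add_zero,
          if_true, tsub_self, pow_zero, mul_one]
        norm_num
        rw [mul_right_comm, inv_mul_cancel₀ hR.ne', one_mul]
        exact hℓ
      · obtain ⟨rfl, rfl⟩ := h2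
        simp [scaleWeight, irrGain, orderIrr, majorant, hℓ]
      · simpa using hrhs
    · rw [h.low_deriv hle r hp hmp, norm_zero]
      exact hrhs
  · intro r m p hmp k hk
    rw [scaleWeight_top]
    by_cases h4 : m + p = 4
    · rw [if_neg (by omega), if_pos h4]
      have h5 := taylor_inRegion (h.smooth r m Λ0 (right_mem_Icc.2 hle)) h0.le p
        (fun k hk => hs.bound hR hle r (p := p + 1) (by omega) (hMl r m (p + 1)) hk) hk
      have h6 := h.marginal_bound hR hle r h4
      have hpow : Λ0 ^ ((3 : ℤ) - m) / Λ0 ^ p = 1 / Λ0 := by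
        rw [← zpow_natCast Λ0 p, ← zpow_sub₀ h0.ne', one_div, ← zpow_neg_one]
        congr 1
        omega
      have h7 : (ΛR ^ r 0)⁻¹ * Λ0 ^ orderIrr r * majorant (M r m (p + 1)) ℓ * Λ0 ^ ((3 : ℤ) - m)
          / Λ0 ^ (p + 1) * (2 * Λ0) = ((ΛR ^ r 0)⁻¹ * Λ0 ^ orderIrr r / Λ0)
            * (majorant (M r m (p + 1)) ℓ + majorant (M r m (p + 1)) ℓ) := by
        calc _ = (ΛR ^ r 0)⁻¹ * Λ0 ^ orderIrr r * (2 * majorant (M r m (p + 1)) ℓ)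
              * (Λ0 ^ ((3 : ℤ) - m) / Λ0 ^ p) := by field_simp; ring
          _ = _ := by rw [hpow]; ring
      have h16 : (16 : ℝ) ≤ majorant 16 ℓ := by
        have : (1 : ℝ) ≤ ℓ ^ 16 := one_le_pow₀ hℓ
        simp only [majorant]; push_cast; linarith
      have h8 := add_majorant_le (M r m (p + 1)) (M r m (p + 1)) hℓ
      have h9 := add_majorant_le 16 (M r m (p + 1) + M r m (p + 1)) hℓ
      calc _ ≤ _ := h5
        _ ≤ ((ΛR ^ r 0)⁻¹ * Λ0 ^ orderIrr r / Λ0)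
            * (16 + (majorant (M r m (p + 1)) ℓ + majorant (M r m (p + 1)) ℓ)) := by
            rw [h7]; linarith
        _ ≤ ((ΛR ^ r 0)⁻¹ * Λ0 ^ orderIrr r / Λ0)
            * majorant (16 + (M r m (p + 1) + M r m (p + 1))) ℓ := by
            gcongr; linarith
        _ = (ΛR ^ r 0)⁻¹ * Λ0 ^ orderIrr r * majorant (16 + (M r m (p + 1) + M r m (p + 1))) ℓ
            * (1 / Λ0) := by ring
        _ = _ := by rw [← hpow]; ring
    · rw [if_neg (by omega), if_neg h4]
      exact hs.bound hR hle r (by omega) (hMl r m p) hk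

/-! ### Irrelevant couplings at the renormalization scale -/

theorem norm_unitLeg_le {m : ℕ} (i : Fin m) (μ : Fin 4) : ‖unitLeg i μ‖ ≤ 1 := by
  rw [unitLeg, Pi.norm_single, PiLp.norm_single, norm_one]

theorem abs_secondDeriv_le {m : ℕ} (f : (Fin m → Momentum) → ℝ) (i j : Fin m) :
    |secondDeriv f i j| ≤ ‖iteratedFDeriv ℝ 2 f 0‖ := by
  refine ((iteratedFDeriv ℝ 2 f 0).le_opNorm _).trans ?_
  rw [Fin.prod_univ_two]
  have h1 := norm_unitLeg_le i 0
  have h2 := norm_unitLeg_le j 0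
  calc ‖iteratedFDeriv ℝ 2 f 0‖ * (‖unitLeg i 0‖ * ‖unitLeg j 0‖)
      ≤ ‖iteratedFDeriv ℝ 2 f 0‖ * (1 * 1) := by gcongr
    _ = _ := by ring

/-- The irrelevant couplings of a tower. -/
def towerRho (u : Tower) (Λ : ℝ) : Fin 3 → ℝ :=
  ![secondDeriv (u 2 Λ) 0 0, secondDeriv (u 2 Λ) 0 1, u 4 Λ 0]

theorem abs_towerRho_le {u : Tower} {Λ c : ℝ} (hΛ : 0 < Λ) (h2 : ScaleBound u Λ c 2 2)
    (h4 : ScaleBound u Λ c 4 0) (a : Fin 3) : |towerRho u Λ a| ≤ c / Λ := by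
  have b2 := h2 0 (inRegion_zero hΛ.le)
  have b4 := h4 0 (inRegion_zero hΛ.le)
  have e2 : c * Λ ^ ((3 : ℤ) - (2 : ℕ)) / Λ ^ 2 = c / Λ := by
    norm_num
    field_simp
  have e4 : c * Λ ^ ((3 : ℤ) - (4 : ℕ)) / Λ ^ 0 = c / Λ := by
    norm_num
    field_simp
  rw [e2] at b2
  rw [e4, norm_iteratedFDeriv_zero] at b4
  fin_cases a
  · exact (abs_secondDeriv_le _ 0 0).trans b2
  · exact (abs_secondDeriv_le _ 0 1).trans b2
  · exact b4

/-- Bound on the irrelevant couplings at the renormalization scale. -/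
theorem exists_rhoIrr_bound {K : ℝ → ℝ} (hK : IsCutoff K) (P : Order → ℕ → ℕ → Polynomial ℝ)
    (r : Order) : ∃ M : ℕ, ∀ {A B ΛR Λ0 ℓ : ℝ} {L : VertexFunctions}, 0 < ΛR → ΛR ≤ Λ0 →
      |B| ≤ ΛR ^ 2 → 1 + Real.log (Λ0 / ΛR) ≤ ℓ → IsPerturbativeFlow K A B ΛR Λ0 L →
      SmallBare P ΛR Λ0 L → ∀ a, |rhoIrr L r ΛR a|
        ≤ scaleWeight ΛR Λ0 r * ΛR ^ irrGain r * majorant M ℓ / ΛR := by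
  obtain ⟨Mb, hMb⟩ := exists_flowSystem P
  obtain ⟨M2, hM2⟩ := exists_scaleBound (Mb := Mb) hK Finsupp.degree
    (fun r s hs => degree_lt_of_mem_orderPairs hs) r 2 2
  obtain ⟨M4, hM4⟩ := exists_scaleBound (Mb := Mb) hK Finsupp.degree
    (fun r s hs => degree_lt_of_mem_orderPairs hs) r 4 0
  refine ⟨M2 + M4, fun {A B ΛR Λ0 ℓ L} hR hle hB hℓ h hs a => ?_⟩
  have sys := hMb hR hle hB hℓ h hs
  have hΛ : ΛR ∈ Icc ΛR Λ0 := left_mem_Icc.2 hle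
  have hc := sys.nonneg r
  have hl := sys.one_le
  refine abs_towerRho_le (u := L r) hR (fun k hk => ?_) (fun k hk => ?_) a
  · refine (hM2 sys ΛR hΛ k hk).trans ?_
    have := majorant_mono (Nat.le_add_right M2 M4) hl
    gcongr
  · refine (hM4 sys ΛR hΛ k hk).trans ?_
    have := majorant_mono (Nat.le_add_left M4 M2) hl
    gcongr

/-! ### Differences of solutions with different bare scales -/

/-- The towers of two solutions and of their difference, at vanishing order in the irrelevant
couplings. -/
def diffTower (L L' : VertexFunctions) (i : Fin 3 × Order) : Tower := fun m Λ k =>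
  if orderIrr i.2 = 0 then
    if i.1 = 0 then L i.2 m Λ k else if i.1 = 1 then L' i.2 m Λ k
      else L' i.2 m Λ k - L i.2 m Λ k
  else 0

/-- The two towers in the tree part of the flow of `diffTower`. -/
def pairEmb (a b : Fin 3) : Order × Order ↪ (Fin 3 × Order) × (Fin 3 × Order) where
  toFun s := ((a, s.1), (b, s.2))
  inj' := fun s t h => by simpa [Prod.ext_iff] using h

@[simp]
theorem pairEmb_apply (a b : Fin 3) (s : Order × Order) :
    pairEmb a b s = ((a, s.1), (b, s.2)) := rfl

/-- Decompositions for the flow of `diffTower`. -/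
def diffPairs (i : Fin 3 × Order) : Finset ((Fin 3 × Order) × (Fin 3 × Order)) :=
  if orderIrr i.2 = 0 then
    if i.1 = 0 then (orderPairs i.2).map (pairEmb 0 0)
    else if i.1 = 1 then (orderPairs i.2).map (pairEmb 1 1)
    else (orderPairs i.2).map (pairEmb 2 1) ∪ (orderPairs i.2).map (pairEmb 0 2)
  else ∅

/-- The gain of `diffTower`. -/
def diffGain (i : Fin 3 × Order) : ℕ := if i.1 = 2 then 1 else 0

/-- The prefactor for `diffTower`. -/
def diffWeight (ΛR Λ0 : ℝ) (i : Fin 3 × Order) : ℝ :=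
  (ΛR ^ i.2 0)⁻¹ * if i.1 = 2 then Λ0⁻¹ else 1

theorem mem_diffPairs {i : Fin 3 × Order} {x : (Fin 3 × Order) × (Fin 3 × Order)}
    (hx : x ∈ diffPairs i) : ((x.1.2, x.2.2) ∈ orderPairs i.2 ∧ orderIrr i.2 = 0) ∧
      ((i.1 = 0 ∧ x.1.1 = 0 ∧ x.2.1 = 0) ∨ (i.1 = 1 ∧ x.1.1 = 1 ∧ x.2.1 = 1) ∨
        (i.1 = 2 ∧ x.1.1 = 2 ∧ x.2.1 = 1) ∨ (i.1 = 2 ∧ x.1.1 = 0 ∧ x.2.1 = 2)) := by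
  obtain ⟨a, r⟩ := i
  by_cases h : orderIrr r = 0
  · fin_cases a
    · simp only [diffPairs, h, if_true, Fin.zero_eta, Finset.mem_map] at hx
      obtain ⟨s, hs, rfl⟩ := hx
      exact ⟨⟨hs, h⟩, Or.inl ⟨rfl, rfl, rfl⟩⟩
    · simp only [diffPairs, h, if_true, Fin.mk_one, one_ne_zero, if_false, Finset.mem_map] at hx
      obtain ⟨s, hs, rfl⟩ := hx
      exact ⟨⟨hs, h⟩, Or.inr (Or.inl ⟨rfl, rfl, rfl⟩)⟩
    · simp only [diffPairs, h, if_true, Fin.reduceFinMk, Fin.reduceEq, if_false,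
        Finset.mem_union, Finset.mem_map] at hx
      rcases hx with ⟨s, hs, rfl⟩ | ⟨s, hs, rfl⟩
      · exact ⟨⟨hs, h⟩, Or.inr (Or.inr (Or.inl ⟨rfl, rfl, rfl⟩))⟩
      · exact ⟨⟨hs, h⟩, Or.inr (Or.inr (Or.inr ⟨rfl, rfl, rfl⟩))⟩
  · simp [diffPairs, h] at hx

/-- Telescoping one factor at a time. The difference tower thus appears linearly, paired with the
second solution on its right and with the first on its left, as recorded in `diffPairs`. -/
theorem treePart_sub {K : ℝ → ℝ} {B Λ : ℝ} (u u' v v' : Tower) (m : ℕ)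
    (k : Fin m → Momentum) : treePart K B u' v' m Λ k - treePart K B u v m Λ k
      = treePart K B (fun m Λ k => u' m Λ k - u m Λ k) v' m Λ k
        + treePart K B u (fun m Λ k => v' m Λ k - v m Λ k) m Λ k := by
  simp only [treePart]
  rw [← Finset.sum_sub_distrib, ← Finset.sum_add_distrib]
  refine Finset.sum_congr rfl fun S _ => ?_
  ring

theorem loopPart_sub {K : ℝ → ℝ} (hK : IsCutoff K) {B Λ : ℝ} (hΛ : 0 < Λ) (hB : |B| ≤ Λ ^ 2)
    {u v : Tower} (hu : ∀ m, ContDiff ℝ ∞ (u m Λ)) (hv : ∀ m, ContDiff ℝ ∞ (v m Λ)) (m : ℕ)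
    (k : Fin m → Momentum) : loopPart K B v m Λ k - loopPart K B u m Λ k
      = loopPart K B (fun m Λ k => v m Λ k - u m Λ k) m Λ k := by
  have hint : ∀ {w : Tower}, (∀ m, ContDiff ℝ ∞ (w m Λ)) → Integrable fun q : Momentum =>
      w (m + 2) Λ (loopL m k + loopShift m q) * dPropagator K B Λ q := by
    intro w hw
    have hP : ContDiff ℝ ∞ (dPropagator K B Λ) :=
      (smoothFamily_dPropagator hK hΛ hB).smooth Λ self_mem_Ici
    refine Continuous.integrable_of_hasCompactSupport ?_ ?_
    · exact ((hw _).continuous.comp (continuous_const.add (continuous_loopShift m))).mul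
        hP.continuous
    · refine HasCompactSupport.intro (isCompact_closedBall (0 : Momentum) (2 * Λ)) fun q hq => ?_
      rw [mem_closedBall_zero_iff, not_le] at hq
      rw [dPropagator_support hK B hΛ hq.le, mul_zero]
  simp only [loopPart_eq]
  rw [← mul_sub, ← integral_sub (hint hv) (hint hu)]
  simp only [sub_mul]

section DiffTower

variable {K : ℝ → ℝ} {A B A' ΛR Λ0 Λ0' : ℝ} {L L' : VertexFunctions}

theorem diffTower_of_ne (L L' : VertexFunctions) (a : Fin 3) {r : Order} (h : orderIrr r ≠ 0) :
    diffTower L L' (a, r) = fun _ _ _ => 0 := by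
  funext m Λ k; simp [diffTower, h]

theorem diffTower_zero (L L' : VertexFunctions) {r : Order} (h : orderIrr r = 0) :
    diffTower L L' (0, r) = L r := by
  funext m Λ k; simp [diffTower, h]

theorem diffTower_one (L L' : VertexFunctions) {r : Order} (h : orderIrr r = 0) :
    diffTower L L' (1, r) = L' r := by
  funext m Λ k; simp [diffTower, h]

theorem diffTower_two (L L' : VertexFunctions) {r : Order} (h : orderIrr r = 0) :
    diffTower L L' (2, r) = fun m Λ k => L' r m Λ k - L r m Λ k := by
  funext m Λ k; simp [diffTower, h]

theorem orderIrr_eq_zero_of_mem {r : Order} (h : orderIrr r = 0) {s : Order × Order}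
    (hs : s ∈ orderPairs r) : orderIrr s.1 = 0 ∧ orderIrr s.2 = 0 := by
  rw [← (mem_orderPairs.1 hs).1, orderIrr_add] at h
  omega

theorem flowPart_diffTower_zero {Λ : ℝ} {r : Order} (h : orderIrr r = 0) (m : ℕ)
    (k : Fin m → Momentum) :
    flowPart K B diffPairs (diffTower L L') (0, r) m Λ k = flowPart K B orderPairs L r m Λ k := by
  simp only [flowPart, diffPairs, h, if_true, diffTower_zero L L' h, Finset.sum_map]
  congr 2
  refine Finset.sum_congr rfl fun s hs => ?_
  obtain ⟨h1, h2⟩ := orderIrr_eq_zero_of_mem h hs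
  simp only [pairEmb_apply, diffTower_zero L L' h1, diffTower_zero L L' h2]

theorem flowPart_diffTower_one {Λ : ℝ} {r : Order} (h : orderIrr r = 0) (m : ℕ)
    (k : Fin m → Momentum) :
    flowPart K B diffPairs (diffTower L L') (1, r) m Λ k = flowPart K B orderPairs L' r m Λ k := by
  simp only [flowPart, diffPairs, h, if_true, one_ne_zero, if_false, diffTower_one L L' h,
    Finset.sum_map]
  congr 2
  refine Finset.sum_congr rfl fun s hs => ?_
  obtain ⟨h1, h2⟩ := orderIrr_eq_zero_of_mem h hs
  simp only [pairEmb_apply, diffTower_one L L' h1, diffTower_one L L' h2]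

theorem flowPart_diffTower_two (hK : IsCutoff K) {Λ : ℝ} (hΛ : 0 < Λ) (hB : |B| ≤ Λ ^ 2)
    (hu : ∀ r m, ContDiff ℝ ∞ (L r m Λ)) (hv : ∀ r m, ContDiff ℝ ∞ (L' r m Λ))
    {r : Order} (h : orderIrr r = 0) (m : ℕ) (k : Fin m → Momentum) :
    flowPart K B diffPairs (diffTower L L') (2, r) m Λ k
      = flowPart K B orderPairs L' r m Λ k - flowPart K B orderPairs L r m Λ k := by
  have hdis : Disjoint ((orderPairs r).map (pairEmb 2 1)) ((orderPairs r).map (pairEmb 0 2)) := by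
    rw [Finset.disjoint_left]
    intro x h1 h2
    obtain ⟨s, -, rfl⟩ := Finset.mem_map.1 h1
    obtain ⟨t, -, ht⟩ := Finset.mem_map.1 h2
    simp only [pairEmb_apply, Prod.mk.injEq] at ht
    exact absurd ht.1.1 (by decide)
  simp only [flowPart, diffPairs, h, if_true, Fin.reduceEq, if_false, diffTower_two L L' h]
  rw [Finset.sum_union hdis, Finset.sum_map, Finset.sum_map,
    ← loopPart_sub hK hΛ hB (hu r) (hv r) m k]
  have : ∑ s ∈ orderPairs r, treePart K B (diffTower L L' (pairEmb 2 1 s).1)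
        (diffTower L L' (pairEmb 2 1 s).2) m Λ k
      + ∑ s ∈ orderPairs r, treePart K B (diffTower L L' (pairEmb 0 2 s).1)
        (diffTower L L' (pairEmb 0 2 s).2) m Λ k
      = ∑ s ∈ orderPairs r, treePart K B (L' s.1) (L' s.2) m Λ k
        - ∑ s ∈ orderPairs r, treePart K B (L s.1) (L s.2) m Λ k := by
    rw [← Finset.sum_add_distrib, ← Finset.sum_sub_distrib]
    refine Finset.sum_congr rfl fun s hs => ?_
    obtain ⟨h1, h2⟩ := orderIrr_eq_zero_of_mem h hs
    rw [treePart_sub]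
    simp only [pairEmb_apply, diffTower_zero L L' h1,
      diffTower_one L L' h2, diffTower_two L L' h1, diffTower_two L L' h2]
  rw [this]
  ring

end DiffTower

/-- Two solutions with different bare scales, and their difference, form a system with power
counting bounds. -/
theorem exists_diffSystem {K : ℝ → ℝ} (hK : IsCutoff K) (P : Order → ℕ → ℕ → Polynomial ℝ) :
    ∃ Mb : Fin 3 × Order → ℕ → ℕ → ℕ, ∀ {A A' B ΛR Λ0 Λ0' ℓ : ℝ} {L L' : VertexFunctions},
      0 < ΛR → ΛR ≤ Λ0 → Λ0 ≤ Λ0' → |B| ≤ ΛR ^ 2 → 1 + Real.log (Λ0' / ΛR) ≤ ℓ →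
      IsPerturbativeFlow K A B ΛR Λ0 L → SmallBare P ΛR Λ0 L →
      IsPerturbativeFlow K A' B ΛR Λ0' L' → SmallBare P ΛR Λ0' L' →
      FlowSystem K diffPairs (fun i => 3 * i.2.degree + 2) diffGain Mb ΛR Λ0 B ℓ
        (diffTower L L') (diffWeight ΛR Λ0) := by
  obtain ⟨Mb, hMb⟩ := exists_flowSystem P
  choose M hM using exists_scaleBound (Mb := Mb) hK Finsupp.degree
    (fun r s hs => degree_lt_of_mem_orderPairs hs)
  -- The common interval ends at Λ₀, an intermediate scale for the second solution. Its data there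
  -- come from the already propagated bound `M`, those of the first solution from `Mb`; the sum
  -- covers the difference.
  refine ⟨fun i m p => Mb i.2 m p + M i.2 m p, ?_⟩
  intro A A' B ΛR Λ0 Λ0' ℓ L L' hR hle hle' hB hlog h hs h' hs'
  have h0 : 0 < Λ0 := hR.trans_le hle
  have hlog0 : 1 + Real.log (Λ0 / ΛR) ≤ ℓ := by
    have := Real.log_le_log (div_pos h0 hR) (div_le_div_of_nonneg_right hle' hR.le)
    linarith
  have sys := hMb hR hle hB hlog0 h hs
  have sys' := hMb hR (hle.trans hle') hB hlog h' hs'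
  have hℓ := sys.one_le
  have hsub : Icc ΛR Λ0 ⊆ Icc ΛR Λ0' := Icc_subset_Icc le_rfl hle'
  have hweight : ∀ (Λ0 Λ : ℝ) {r : Order}, orderIrr r = 0 →
      scaleWeight ΛR Λ0 r * Λ ^ irrGain r = (ΛR ^ r 0)⁻¹ := by
    intro Λ0 Λ r hr
    simp [scaleWeight, irrGain, hr]
  have hmajl : ∀ r m p, majorant (Mb r m p) ℓ ≤ majorant (Mb r m p + M r m p) ℓ := fun r m p =>
    majorant_mono (Nat.le_add_right _ _) hℓ
  have hmajr : ∀ r m p, majorant (M r m p) ℓ ≤ majorant (Mb r m p + M r m p) ℓ := fun r m p =>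
    majorant_mono (Nat.le_add_left _ _) hℓ
  have hpos : ∀ (r : Order) (m p : ℕ) (M : ℕ), 0 ≤ (ΛR ^ r 0)⁻¹ * majorant M ℓ := fun r m p M =>
    mul_nonneg (by positivity) (majorant_nonneg _ hℓ)
  have hc : ∀ i, 0 ≤ diffWeight ΛR Λ0 i := by
    intro i
    simp only [diffWeight]
    split_ifs <;> positivity
  refine ⟨hR, hle, hB, hlog0, ?_, ?_, ?_, hc, ?_, ?_, ?_, ?_⟩
  · rintro ⟨a, r⟩ m
    by_cases hr : orderIrr r = 0
    · fin_cases a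
      · exact (diffTower_zero L L' hr) ▸ h.family r m
      · exact (diffTower_one L L' hr) ▸ (h'.family r m).mono hsub
      · have := ((h'.family r m).mono hsub).sub (h.family r m)
        exact (congrFun (diffTower_two L L' hr) m) ▸ this
    · rw [diffTower_of_ne L L' a hr]
      exact smoothFamily_const _ contDiff_const
  · rintro ⟨a, r⟩ m Λ hΛ k
    have hΛ0 : 0 < Λ := hR.trans_le hΛ.1
    change HasDerivWithinAt _ (flowPart K B diffPairs (diffTower L L') (a, r) m Λ k) _ _
    by_cases hr : orderIrr r = 0
    · fin_cases a
      · simp only [Fin.zero_eta]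
        rw [flowPart_diffTower_zero hr, diffTower_zero L L' hr]
        exact h.hasDeriv r m hΛ k
      · simp only [Fin.mk_one]
        rw [flowPart_diffTower_one hr, diffTower_one L L' hr]
        exact (h'.hasDeriv r m (hsub hΛ) k).mono hsub
      · simp only [Fin.reduceFinMk]
        rw [flowPart_diffTower_two hK hΛ0 (hB.trans (pow_le_pow_left₀ hR.le hΛ.1 2))
          (fun r m => h.smooth r m Λ hΛ) (fun r m => h'.smooth r m Λ (hsub hΛ)) hr,
          diffTower_two L L' hr]
        exact ((h'.hasDeriv r m (hsub hΛ) k).mono hsub).sub (h.hasDeriv r m hΛ k)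
    · have hz : flowPart K B diffPairs (diffTower L L') (a, r) m Λ k = 0 := by
        simp [flowPart, diffPairs, hr, diffTower_of_ne L L' a hr, loopPart]
      rw [hz, diffTower_of_ne L L' a hr]
      exact hasDerivWithinAt_const _ _ _
  · rintro ⟨a, r⟩ m hm Λ hΛ k
    have e1 := h.finiteLegs r m Λ hΛ hm k
    have e2 := h'.finiteLegs r m Λ (hsub hΛ) hm k
    simp [diffTower, e1, e2]
  · rintro ⟨a, r⟩ x hx Λ hΛ
    obtain ⟨⟨hs, -⟩, hx⟩ := mem_diffPairs hx
    have hadd : r 0 = x.1.2 0 + x.2.2 0 := by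
      have := (mem_orderPairs.1 hs).1
      simp only at this
      rw [← this, Finsupp.add_apply]
    obtain ⟨⟨x1, s1⟩, ⟨x2, s2⟩⟩ := x
    simp only at hx hadd
    simp only [diffWeight, diffGain, hadd, pow_add, mul_inv]
    rcases hx with ⟨rfl, rfl, rfl⟩ | ⟨rfl, rfl, rfl⟩ | ⟨rfl, rfl, rfl⟩ | ⟨rfl, rfl, rfl⟩ <;>
    · simp
      try ring_nf
      try exact le_rfl
  · rintro ⟨a, r⟩
    simp only [diffGain]
    split_ifs <;> simp
  · rintro ⟨a, r⟩ m p hmp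
    have hrhs : 0 ≤ diffWeight ΛR Λ0 (a, r) * ΛR ^ diffGain (a, r)
        * majorant (Mb r m p + M r m p) ℓ * ΛR ^ ((3 : ℤ) - m) / ΛR ^ p := by
      have := hc (a, r)
      have := majorant_nonneg (Mb r m p + M r m p) hℓ
      positivity
    by_cases hr : orderIrr r = 0
    · fin_cases a
      · have h1 := sys.low r m p hmp
        rw [hweight _ _ hr] at h1
        simp only [Fin.zero_eta, diffTower_zero L L' hr, diffWeight, diffGain]
        simp only [Fin.reduceEq, if_false, pow_zero, mul_one]
        refine h1.trans ?_
        have := hmajl r m p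
        gcongr
      · have h1 := sys'.low r m p hmp
        rw [hweight _ _ hr] at h1
        simp only [Fin.mk_one, diffTower_one L L' hr, diffWeight, diffGain]
        simp only [Fin.reduceEq, if_false, pow_zero, mul_one]
        refine h1.trans ?_
        have := hmajl r m p
        gcongr
      -- Both solutions satisfy the same renormalization conditions, so the difference has no
      -- relevant data at Λ_R.
      · have hz : iteratedFDeriv ℝ p (diffTower L L' (2, r) m ΛR) 0 = 0 := by
          rw [diffTower_two L L' hr]
          have s1 := (h.smooth r m ΛR (left_mem_Icc.2 hle)).of_le (natCast_le_infty p)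
          have s2 := (h'.smooth r m ΛR (left_mem_Icc.2 (hle.trans hle'))).of_le
            (natCast_le_infty p)
          refine (iteratedFDeriv_sub_apply (f := L' r m ΛR) (g := L r m ΛR) s2.contDiffAt
            s1.contDiffAt).trans ?_
          rcases eq_or_ne p 0 with rfl | hp
          · rw [sub_eq_zero]
            ext v
            simp only [iteratedFDeriv_zero_apply]
            rw [h.low_value r (by omega), h'.low_value r (by omega)]
          · rw [h.low_deriv hle r hp hmp, h'.low_deriv (hle.trans hle') r hp hmp, sub_zero]
        simp only [Fin.reduceFinMk] at hrhs ⊢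
        rw [hz, norm_zero]
        exact hrhs
    · have hz : iteratedFDeriv ℝ p (diffTower L L' (a, r) m ΛR) 0 = 0 := by
        rw [diffTower_of_ne L L' a hr]
        exact congrFun (iteratedFDeriv_fun_zero (𝕜 := ℝ) (n := p)) 0
      rw [hz, norm_zero]
      exact hrhs
  · rintro ⟨a, r⟩ m p hmp k hk
    have hrhs : 0 ≤ diffWeight ΛR Λ0 (a, r) * Λ0 ^ diffGain (a, r)
        * majorant (Mb r m p + M r m p) ℓ * Λ0 ^ ((3 : ℤ) - m) / Λ0 ^ p := by
      have := hc (a, r)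
      have := majorant_nonneg (Mb r m p + M r m p) hℓ
      positivity
    by_cases hr : orderIrr r = 0
    · have b0 := sys.high r m p hmp k hk
      have b1 := hM r m p sys' Λ0 ⟨hle, hle'⟩ k hk
      rw [hweight _ _ hr] at b0 b1
      fin_cases a
      · simp only [Fin.zero_eta, diffTower_zero L L' hr, diffWeight, diffGain]
        simp only [Fin.reduceEq, if_false, pow_zero, mul_one]
        refine b0.trans ?_
        have := hmajl r m p
        gcongr
      · simp only [Fin.mk_one, diffTower_one L L' hr, diffWeight, diffGain]
        simp only [Fin.reduceEq, if_false, pow_zero, mul_one]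
        refine b1.trans ?_
        have := hmajr r m p
        gcongr
      · simp only [Fin.reduceFinMk, diffTower_two L L' hr, diffWeight, diffGain, if_true, pow_one]
        have s1 := (h.smooth r m Λ0 (right_mem_Icc.2 hle)).of_le (natCast_le_infty p)
        have s2 := (h'.smooth r m Λ0 ⟨hle, hle'⟩).of_le (natCast_le_infty p)
        have e : iteratedFDeriv ℝ p (fun k => L' r m Λ0 k - L r m Λ0 k) k
            = iteratedFDeriv ℝ p (L' r m Λ0) k - iteratedFDeriv ℝ p (L r m Λ0) k :=
          iteratedFDeriv_sub_apply (f := L' r m Λ0) (g := L r m Λ0) s2.contDiffAt s1.contDiffAt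
        rw [e]
        -- At Λ₀ the prefactor Λ₀⁻¹ and the gained power Λ₀ cancel: no smallness of the difference
        -- is needed there, and the factor Λ/Λ₀ appears only at lower scales.
        refine (norm_sub_le _ _).trans ((add_le_add b1 b0).trans ?_)
        rw [mul_assoc _ Λ0⁻¹ Λ0, inv_mul_cancel₀ h0.ne', mul_one, ← add_div, ← add_mul, ← mul_add]
        have := add_majorant_le (Mb r m p) (M r m p) hℓ
        gcongr
        linarith
    · have hz : iteratedFDeriv ℝ p (diffTower L L' (a, r) m Λ0) k = 0 := by
        rw [diffTower_of_ne L L' a hr]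
        exact congrFun (iteratedFDeriv_fun_zero (𝕜 := ℝ) (n := p)) k
      rw [hz, norm_zero]
      exact hrhs

/-- Rate of change of the irrelevant couplings at the renormalization scale with the bare scale. -/
theorem exists_rhoIrr_rate {K : ℝ → ℝ} (hK : IsCutoff K) (P : Order → ℕ → ℕ → Polynomial ℝ)
    {r : Order} (hr : orderIrr r = 0) : ∃ M : ℕ,
      ∀ {A A' B ΛR Λ0 Λ0' ℓ : ℝ} {L L' : VertexFunctions},
      0 < ΛR → ΛR ≤ Λ0 → Λ0 ≤ Λ0' → |B| ≤ ΛR ^ 2 → 1 + Real.log (Λ0' / ΛR) ≤ ℓ →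
      IsPerturbativeFlow K A B ΛR Λ0 L → SmallBare P ΛR Λ0 L →
      IsPerturbativeFlow K A' B ΛR Λ0' L' → SmallBare P ΛR Λ0' L' → ∀ a,
      |rhoIrr L' r ΛR a - rhoIrr L r ΛR a| ≤ (ΛR ^ r 0)⁻¹ * majorant M ℓ / Λ0 := by
  obtain ⟨Mb, hMb⟩ := exists_diffSystem hK P
  have hdeg : ∀ i, ∀ x ∈ diffPairs i, x.1.2.degree < i.2.degree ∧ x.2.2.degree < i.2.degree :=
    fun i x hx => degree_lt_of_mem_orderPairs (mem_diffPairs hx).1.1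
  obtain ⟨M2, hM2⟩ := exists_scaleBound (Mb := Mb) (legs := fun i => 3 * i.2.degree + 2)
    (e := diffGain) hK (fun i => i.2.degree) hdeg (2, r) 2 2
  obtain ⟨M4, hM4⟩ := exists_scaleBound (Mb := Mb) (legs := fun i => 3 * i.2.degree + 2)
    (e := diffGain) hK (fun i => i.2.degree) hdeg (2, r) 4 0
  refine ⟨M2 + M4, fun {A A' B ΛR Λ0 Λ0' ℓ L L'} hR hle hle' hB hℓ h hs h' hs' a => ?_⟩
  have sys := hMb hR hle hle' hB hℓ h hs h' hs'
  have hΛ : ΛR ∈ Icc ΛR Λ0 := left_mem_Icc.2 hle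
  have hΛ' : ΛR ∈ Icc ΛR Λ0' := left_mem_Icc.2 (hle.trans hle')
  have hc := sys.nonneg (2, r)
  have hl := sys.one_le
  have key := abs_towerRho_le (u := diffTower L L' (2, r)) (Λ := ΛR)
    (c := diffWeight ΛR Λ0 (2, r) * ΛR ^ diffGain (2, r) * majorant (M2 + M4) ℓ) hR
    (fun k hk => (hM2 sys ΛR hΛ k hk).trans (by
      have := majorant_mono (Nat.le_add_right M2 M4) hl
      gcongr))
    (fun k hk => (hM4 sys ΛR hΛ k hk).trans (by
      have := majorant_mono (Nat.le_add_left M4 M2) hl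
      gcongr)) a
  have hsd : ∀ i j : Fin 2, secondDeriv (fun k => L' r 2 ΛR k - L r 2 ΛR k) i j
      = secondDeriv (L' r 2 ΛR) i j - secondDeriv (L r 2 ΛR) i j := by
    intro i j
    have s1 := (h.smooth r 2 ΛR hΛ).of_le (natCast_le_infty 2)
    have s2 := (h'.smooth r 2 ΛR hΛ').of_le (natCast_le_infty 2)
    simp only [secondDeriv]
    rw [show (fun k => L' r 2 ΛR k - L r 2 ΛR k) = L' r 2 ΛR - L r 2 ΛR from rfl,
      iteratedFDeriv_sub_apply s2.contDiffAt s1.contDiffAt]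
    rfl
  have e : towerRho (diffTower L L' (2, r)) ΛR a = rhoIrr L' r ΛR a - rhoIrr L r ΛR a := by
    rw [diffTower_two L L' hr]
    fin_cases a
    · exact hsd 0 0
    · exact hsd 0 1
    · rfl
  rw [e] at key
  refine key.trans (le_of_eq ?_)
  have h0 : 0 < Λ0 := hR.trans_le hle
  simp only [diffWeight, diffGain, if_true, pow_one]
  field_simp

/-! ### Convergence as the bare scale tends to infinity -/

theorem one_add_log_pow_le (d : ℕ) {x : ℝ} (hx : 1 ≤ x) :
    (1 + Real.log x) ^ d ≤ d.factorial * Real.exp 1 * x := by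
  have h0 : 0 ≤ 1 + Real.log x := by linarith [Real.log_nonneg hx]
  have h := Real.pow_div_factorial_le_exp (1 + Real.log x) h0 d
  rw [Real.exp_add, Real.exp_log (by linarith), div_le_iff₀ (by positivity)] at h
  linarith

theorem tendsto_one_add_log_pow_div (d : ℕ) :
    Tendsto (fun x : ℝ => (1 + Real.log x) ^ d / x) atTop (𝓝 0) := by
  have h1 : Tendsto (fun x : ℝ => ((d + 1).factorial * Real.exp 1) / (1 + Real.log x)) atTop
      (𝓝 0) :=
    (tendsto_atTop_add_const_left _ 1 Real.tendsto_log_atTop).const_div_atTop _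
  refine squeeze_zero' ?_ ?_ h1
  · filter_upwards [eventually_ge_atTop 1] with x hx
    have := Real.log_nonneg hx
    positivity
  · filter_upwards [eventually_ge_atTop 1] with x hx
    have h0 := Real.log_nonneg hx
    have := one_add_log_pow_le (d + 1) hx
    rw [div_le_div_iff₀ (by linarith) (by linarith), ← pow_succ]
    exact this

theorem one_add_log_two_pow_le {x : ℝ} (hx : 1 ≤ x) (j : ℕ) :
    1 + Real.log (2 ^ (j + 1) * x) ≤ ((j + 2 : ℕ) : ℝ) * (1 + Real.log x) := by
  have h0 := Real.log_nonneg hx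
  rw [Real.log_mul (by positivity) (by linarith), Real.log_pow]
  have h2 : Real.log 2 ≤ 1 := by linarith [Real.log_two_lt_d9]
  push_cast
  have : (j + 1 : ℝ) * Real.log 2 ≤ (j + 1) * 1 := by gcongr
  nlinarith [mul_nonneg (show (0 : ℝ) ≤ j + 1 by positivity) h0]

/-- A function whose increments decay up to logarithms converges at that rate. -/
theorem exists_limit_of_rate (M : ℕ) : ∃ N : ℕ, ∀ f : ℝ → ℝ,
    (∀ x y, 1 ≤ x → x ≤ y → |f y - f x| ≤ majorant M (1 + Real.log y) / x) →
    ∃ c, Tendsto f atTop (𝓝 c) ∧ ∀ x, 1 ≤ x → |f x - c| ≤ majorant N (1 + Real.log x) / x := by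
  -- The coefficient bounds the increment beyond 2^i x, up to 2^(i+1) x: there the logarithm grows
  -- at most by the factor i + 2 while the denominator is 2^i x. Summability removes the dependence
  -- of the rate on the larger scale.
  let a : ℕ → ℝ := fun i => M * ((i + 2 : ℕ) : ℝ) ^ M * 2⁻¹ ^ i
  have ha : ∀ i, 0 ≤ a i := fun i => by positivity
  have hsum : Summable a := by
    have h := summable_pow_mul_geometric_of_norm_lt_one (R := ℝ) M (r := 2⁻¹) (by norm_num)
    refine (((summable_nat_add_iff 2).2 h).mul_left ((M : ℝ) * 4)).congr fun i => ?_
    simp only [a, pow_add]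
    ring
  obtain ⟨N, hN⟩ := exists_majorant (∑' i, a i) M
  refine ⟨N, fun f hf => ?_⟩
  have step : ∀ x, 1 ≤ x → ∀ j y, x ≤ y → y ≤ 2 ^ j * x →
      |f y - f x| ≤ (∑ i ∈ Finset.range j, a i) * ((1 + Real.log x) ^ M / x) := by
    intro x hx j
    have hx0 : 0 < x := by linarith
    have hl := Real.log_nonneg hx
    have hw : 0 ≤ (1 + Real.log x) ^ M / x := by positivity
    induction j with
    | zero =>
      intro y h1 h2
      rw [pow_zero, one_mul] at h2
      rw [le_antisymm h2 h1]; simp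
    | succ j ih =>
      intro y h1 h2
      rw [Finset.sum_range_succ, add_mul]
      rcases le_total y (2 ^ j * x) with h3 | h3
      · linarith [ih y h1 h3, mul_nonneg (ha j) hw]
      · have h4 : x ≤ 2 ^ j * x := le_mul_of_one_le_left hx0.le (one_le_pow₀ (by norm_num))
        have h5 := ih _ h4 le_rfl
        have h6 := hf _ y (hx.trans h4) h3
        have hly : 0 ≤ Real.log y := Real.log_nonneg (hx.trans h1)
        have h7 : 1 + Real.log y ≤ ((j + 2 : ℕ) : ℝ) * (1 + Real.log x) := by
          refine le_trans ?_ (one_add_log_two_pow_le hx j)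
          have := Real.log_le_log (by linarith) h2
          linarith
        have h8 : majorant M (1 + Real.log y) / (2 ^ j * x) ≤ a j * ((1 + Real.log x) ^ M / x) := by
          calc majorant M (1 + Real.log y) / (2 ^ j * x)
              ≤ M * (((j + 2 : ℕ) : ℝ) * (1 + Real.log x)) ^ M / (2 ^ j * x) := by
                unfold majorant; gcongr
            _ = _ := by simp only [a, mul_pow, inv_pow]; field_simp
        have h9 := abs_sub_le (f y) (f (2 ^ j * x)) (f x)
        linarith
  have key : ∀ x y, 1 ≤ x → x ≤ y → |f y - f x| ≤ majorant N (1 + Real.log x) / x := by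
    intro x y hx hxy
    have hl := Real.log_nonneg hx
    obtain ⟨j, hj⟩ := pow_unbounded_of_one_lt (y / x) (one_lt_two)
    rw [div_lt_iff₀ (by linarith)] at hj
    refine (step x hx j y hxy hj.le).trans ?_
    have h1 : ∑ i ∈ Finset.range j, a i ≤ ∑' i, a i := hsum.sum_le_tsum _ fun i _ => ha i
    rw [← mul_div_assoc]
    refine div_le_div_of_nonneg_right (le_trans ?_ (hN _ (by linarith))) (by linarith)
    gcongr
  have hdecay : Tendsto (fun x : ℝ => majorant N (1 + Real.log x) / x) atTop (𝓝 0) := by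
    have := (tendsto_one_add_log_pow_div N).const_mul (N : ℝ)
    rw [mul_zero] at this
    exact this.congr fun x => by rw [majorant, mul_div_assoc]
  have hcauchy : CauchySeq f := by
    rw [Metric.cauchySeq_iff']
    intro ε hε
    obtain ⟨x, hx, hx1⟩ := ((hdecay.eventually (gt_mem_nhds hε)).and (eventually_ge_atTop 1)).exists
    exact ⟨x, fun y hy => by
      rw [Real.dist_eq]
      exact (key x y hx1 hy).trans_lt hx⟩
  obtain ⟨c, hc⟩ := cauchySeq_tendsto_of_complete hcauchy
  refine ⟨c, hc, fun x hx => ?_⟩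
  rw [abs_sub_comm]
  refine le_of_tendsto (hc.sub_const (f x)).abs ?_
  filter_upwards [eventually_ge_atTop x] with y hy using key x y hx hy

theorem coeff_dimensionless (Λ : ℝ) (f : MvPowerSeries (Fin 5) ℝ) (r : Order) :
    MvPowerSeries.coeff r (dimensionless Λ f)
      = Λ ^ (1 + (r 0 : ℤ) - (orderIrr r : ℤ)) * MvPowerSeries.coeff r f := rfl

theorem coeff_rhoSeries (L : VertexFunctions) (Λ : ℝ) (a : Fin 3) (r : Order) :
    MvPowerSeries.coeff r (rhoSeries L Λ a) = rhoIrr L r Λ a := rfl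

theorem coeff_devSeries (L : VertexFunctions) (Λ : ℝ) (a : Fin 3) (r : Order) :
    MvPowerSeries.coeff r (devSeries L Λ a) = if orderIrr r = 0 then 0 else rhoIrr L r Λ a := rfl

/-- Without bare irrelevant couplings, the irrelevant couplings at the renormalization scale
converge as the bare scale goes to infinity. -/
theorem exists_lamSeries_limit {K : ℝ → ℝ} (hK : IsCutoff K) (P : Order → ℕ → ℕ → Polynomial ℝ)
    {r : Order} (hr : orderIrr r = 0) : ∃ M : ℕ,
      ∀ {ΛR A B : ℝ} {L : ℝ → VertexFunctions}, 0 < ΛR → |B| ≤ ΛR ^ 2 →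
      (∀ Λ0, ΛR ≤ Λ0 → IsPerturbativeFlow K A B ΛR Λ0 (L Λ0) ∧ SmallBare P ΛR Λ0 (L Λ0)) →
      ∀ a, ∃ c, Tendsto (fun Λ0 => MvPowerSeries.coeff r (lamSeries (L Λ0) ΛR a)) atTop (𝓝 c) ∧
        ∀ Λ0, ΛR ≤ Λ0 → |MvPowerSeries.coeff r (lamSeries (L Λ0) ΛR a) - c|
          ≤ ΛR / Λ0 * majorant M (1 + Real.log (Λ0 / ΛR)) := by
  obtain ⟨M, hM⟩ := exists_rhoIrr_rate hK P hr
  obtain ⟨N, hN⟩ := exists_limit_of_rate M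
  refine ⟨N, fun {ΛR A B L} hR hB hL a => ?_⟩
  have hcoeff : ∀ Λ0, MvPowerSeries.coeff r (lamSeries (L Λ0) ΛR a)
      = ΛR ^ (1 + r 0) * rhoIrr (L Λ0) r ΛR a := by
    intro Λ0
    rw [lamSeries, coeff_dimensionless, coeff_rhoSeries, hr, Nat.cast_zero, sub_zero]
    norm_cast
  -- The bare scale is measured in units of Λ_R, so that the constants in the limit do not depend on
  -- Λ_R.
  have hrate : ∀ x y, 1 ≤ x → x ≤ y → |ΛR ^ (1 + r 0) * rhoIrr (L (y * ΛR)) r ΛR a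
      - ΛR ^ (1 + r 0) * rhoIrr (L (x * ΛR)) r ΛR a| ≤ majorant M (1 + Real.log y) / x := by
    intro x y hx hxy
    have h1 : ΛR ≤ x * ΛR := le_mul_of_one_le_left hR.le hx
    have h2 : x * ΛR ≤ y * ΛR := by gcongr
    have key := hM hR h1 h2 hB (ℓ := 1 + Real.log y) (by rw [mul_div_cancel_right₀ _ hR.ne'])
      (hL _ h1).1 (hL _ h1).2 (hL _ (h1.trans h2)).1 (hL _ (h1.trans h2)).2 a
    rw [← mul_sub, abs_mul, abs_of_pos (by positivity)]
    calc _ ≤ ΛR ^ (1 + r 0) * ((ΛR ^ r 0)⁻¹ * majorant M (1 + Real.log y) / (x * ΛR)) := by gcongr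
      _ = _ := by rw [pow_add]; field_simp
  obtain ⟨c, hc, hb⟩ := hN _ hrate
  refine ⟨c, ?_, fun Λ0 hΛ0 => ?_⟩
  · refine (hc.comp (tendsto_id.atTop_div_const hR)).congr fun Λ0 => ?_
    rw [Function.comp_apply, hcoeff, id, div_mul_cancel₀ _ hR.ne']
  · have := hb (Λ0 / ΛR) ((one_le_div hR).2 hΛ0)
    rw [div_mul_cancel₀ _ hR.ne', ← hcoeff] at this
    refine this.trans (le_of_eq ?_)
    rw [div_div_eq_mul_div]
    ring

/-! ### Absence of running at first order in the bare couplings -/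

theorem orderPairs_single (i : Fin 5) : orderPairs (Finsupp.single i 1) = ∅ := by
  refine Finset.eq_empty_of_forall_notMem fun s hs => ?_
  have h := degree_lt_of_mem_orderPairs hs
  rw [Finsupp.degree_single] at h
  exact (mem_orderPairs.1 hs).2.1 ((Finsupp.degree_eq_zero_iff _).1 (by omega))

section Linear

variable {K : ℝ → ℝ} {A B ΛR Λ0 : ℝ} {L : VertexFunctions}

theorem IsPerturbativeFlow.hasDeriv_single (h : IsPerturbativeFlow K A B ΛR Λ0 L) (i : Fin 5)
    (m : ℕ) {Λ : ℝ} (hΛ : Λ ∈ Icc ΛR Λ0) (k : Fin m → Momentum) :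
    HasDerivWithinAt (fun s => L (Finsupp.single i 1) m s k)
      (-(1 / 2) * loopPart K B (L (Finsupp.single i 1)) m Λ k) (Icc ΛR Λ0) Λ := by
  have := h.hasDeriv (Finsupp.single i 1) m hΛ k
  rw [flowPart, orderPairs_single, Finset.sum_empty, mul_zero, zero_sub, ← neg_mul] at this
  exact this

theorem eq_of_hasDerivWithinAt_zero {f : ℝ → ℝ} {a b : ℝ} (hab : a ≤ b)
    (hf : ∀ x ∈ Icc a b, HasDerivWithinAt f 0 (Icc a b) x) : ∀ x ∈ Icc a b, f x = f b := by
  have key := constant_of_derivWithin_zero (fun x hx => (hf x hx).differentiableWithinAt)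
    fun x hx => (hf x (Ico_subset_Icc_self hx)).derivWithin
      (uniqueDiffOn_Icc (hx.1.trans_lt hx.2) x (Ico_subset_Icc_self hx))
  intro x hx
  rw [key x hx, key b (right_mem_Icc.2 hab)]

/-- At first order in a bare irrelevant coupling, the five-point function is constant. -/
theorem IsPerturbativeFlow.five_point (h : IsPerturbativeFlow K A B ΛR Λ0 L) (hle : ΛR ≤ Λ0)
    (b : Fin 3) {Λ : ℝ} (hΛ : Λ ∈ Icc ΛR Λ0) (k : Fin 4 → Momentum) :
    L (Finsupp.single (irr b) 1) 4 Λ k = L (Finsupp.single (irr b) 1) 4 Λ0 0 := by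
  rw [← h.initialLinear b k]
  refine eq_of_hasDerivWithinAt_zero (f := fun s => L (Finsupp.single (irr b) 1) 4 s k) hle
    (fun x hx => ?_) Λ hΛ
  have hz : loopPart K B (L (Finsupp.single (irr b) 1)) 4 x k = 0 := by
    simp only [loopPart]
    rw [integral_eq_zero_of_ae, mul_zero]
    filter_upwards with q
    -- A loop would need the seven-point function, but an order of degree one has at most five legs.
    rw [h.finiteLegs _ 6 x hx (by rw [Finsupp.degree_single]; omega)]
    simp
  have := h.hasDeriv_single (irr b) 4 hx k
  rwa [hz, mul_zero] at this

/-- The loop term integrates a constant five-point function against the propagator, so it does not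
depend on the external momenta and the flow only shifts the function by a constant. -/
theorem IsPerturbativeFlow.three_point (h : IsPerturbativeFlow K A B ΛR Λ0 L) (hle : ΛR ≤ Λ0)
    (b : Fin 3) (k : Fin 2 → Momentum) :
    L (Finsupp.single (irr b) 1) 2 ΛR k = L (Finsupp.single (irr b) 1) 2 Λ0 k
      + (L (Finsupp.single (irr b) 1) 2 ΛR 0 - L (Finsupp.single (irr b) 1) 2 Λ0 0) := by
  have hd : ∀ x ∈ Icc ΛR Λ0, HasDerivWithinAt
      (fun s => L (Finsupp.single (irr b) 1) 2 s k - L (Finsupp.single (irr b) 1) 2 s 0) 0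
      (Icc ΛR Λ0) x := by
    intro x hx
    have hz : loopPart K B (L (Finsupp.single (irr b) 1)) 2 x k
        = loopPart K B (L (Finsupp.single (irr b) 1)) 2 x 0 := by
      simp only [loopPart]
      congr 2
      funext q
      rw [h.five_point hle b hx, h.five_point hle b hx]
    have := (h.hasDeriv_single (irr b) 2 hx k).sub (h.hasDeriv_single (irr b) 2 hx 0)
    rwa [hz, sub_self] at this
  have key := eq_of_hasDerivWithinAt_zero hle hd ΛR (left_mem_Icc.2 hle)
  linarith

/-- The irrelevant couplings do not run at first order in their bare values. -/
theorem IsPerturbativeFlow.rhoIrr_single (h : IsPerturbativeFlow K A B ΛR Λ0 L) (hle : ΛR ≤ Λ0)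
    (a b : Fin 3) : rhoIrr L (Finsupp.single (irr b) 1) ΛR a = if a = b then 1 else 0 := by
  have hirr : Function.Injective irr := by decide
  have h0 : rhoIrr L (Finsupp.single (irr b) 1) Λ0 a = if a = b then 1 else 0 := by
    rw [h.initial]
    simp only [Finsupp.single_left_inj one_ne_zero, hirr.eq_iff, eq_comm]
  rw [← h0]
  have hsd : ∀ i j, secondDeriv (L (Finsupp.single (irr b) 1) 2 ΛR) i j
      = secondDeriv (L (Finsupp.single (irr b) 1) 2 Λ0) i j := by
    intro i j
    have hs := (h.smooth (Finsupp.single (irr b) 1) 2 Λ0 (right_mem_Icc.2 hle)).of_le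
      (natCast_le_infty 2)
    have e : L (Finsupp.single (irr b) 1) 2 ΛR = L (Finsupp.single (irr b) 1) 2 Λ0
        + fun _ => L (Finsupp.single (irr b) 1) 2 ΛR 0 - L (Finsupp.single (irr b) 1) 2 Λ0 0 :=
      funext fun k => h.three_point hle b k
    rw [secondDeriv, e, iteratedFDeriv_add_apply hs.contDiffAt contDiffAt_const,
      iteratedFDeriv_const_of_ne two_ne_zero]
    simp [secondDeriv]
  fin_cases a
  · exact hsd 0 0
  · exact hsd 0 1
  · exact h.five_point hle b (left_mem_Icc.2 hle) 0

end Linear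

/-! ### The deviations as a perturbation of the identity -/

/-- The expansions of all expansion parameters at the renormalization scale. -/
def devFamily (L : VertexFunctions) (ΛR : ℝ) : Fin 5 → MvPowerSeries (Fin 5) ℝ :=
  insertBare (devSeries L ΛR)

theorem Order.eq_single_of_degree {r : Order} (hr : r.degree = 1) :
    ∃ i, r = Finsupp.single i 1 := by
  obtain ⟨i, rfl⟩ := (Finsupp.sum_eq_one_iff r).1 hr
  exact ⟨i, rfl⟩

theorem insertBare_irr (H : Fin 3 → MvPowerSeries (Fin 5) ℝ) (a : Fin 3) :
    insertBare H (irr a) = H a := by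
  fin_cases a <;> rfl

/-- The constant term vanishes, linear terms in the relevant parameters are excluded from the
deviation, and those in the irrelevant ones form the identity matrix because these couplings do not
run. -/
theorem devSeries_order {K : ℝ → ℝ} {A B ΛR Λ0 : ℝ} {L : VertexFunctions}
    (h : IsPerturbativeFlow K A B ΛR Λ0 L) (hle : ΛR ≤ Λ0) (s : Fin 5) :
    2 ≤ (devFamily L ΛR s - MvPowerSeries.X s).order := by
  have key : ∀ a, 2 ≤ (devSeries L ΛR a - MvPowerSeries.X (irr a)).order := by
    intro a
    refine MvPowerSeries.nat_le_order (n := 2) fun r hr => ?_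
    rw [map_sub, coeff_devSeries, MvPowerSeries.coeff_X]
    obtain hr | hr : r.degree = 0 ∨ r.degree = 1 := by omega
    · rw [Finsupp.degree_eq_zero_iff] at hr
      subst hr
      simp [(Finsupp.single_ne_zero.2 one_ne_zero : (Finsupp.single (irr a) 1 : Order) ≠ 0).symm]
    · obtain ⟨i, rfl⟩ := Order.eq_single_of_degree hr
      by_cases hi : ∃ b, i = irr b
      · obtain ⟨b, rfl⟩ := hi
        have hirr : Function.Injective irr := by decide
        rw [orderIrr_single_irr, if_neg one_ne_zero, h.rhoIrr_single hle]
        simp only [Finsupp.single_left_inj one_ne_zero, hirr.eq_iff, eq_comm, sub_self]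
      · have h0 : orderIrr (Finsupp.single i 1) = 0 := by
          fin_cases i
          · simp [orderIrr]
          · simp [orderIrr]
          · exact absurd ⟨0, rfl⟩ hi
          · exact absurd ⟨1, rfl⟩ hi
          · exact absurd ⟨2, rfl⟩ hi
        simp only [if_pos h0, Finsupp.single_left_inj one_ne_zero, sub_eq_zero]
        rw [if_neg fun e => hi ⟨a, e⟩]
  fin_cases s
  · simp [devFamily, insertBare]
  · simp [devFamily, insertBare]
  · exact key 0
  · exact key 1
  · exact key 2

/-! ### Compositional inverses of formal power series -/

section FormalInverse

open MvPowerSeries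

variable {σ : Type} {R : Type} [CommRing R] {G G' : σ → MvPowerSeries σ R}

theorem degree_le_order_prod (hG : ∀ s, constantCoeff (G s) = 0) (d : σ →₀ ℕ) :
    (d.degree : ℕ∞) ≤ (d.prod fun s e => G s ^ e).order := by
  refine le_trans ?_ (le_order_prod _ _)
  rw [Finsupp.degree_apply, Nat.cast_sum]
  exact Finset.sum_le_sum fun s _ => le_order_pow_of_constantCoeff_eq_zero _ (hG s)

/-- Telescoping ab - a′b′ = (a - a′)b + a′(b - b′). The `+ 1` on the right stands in for a
subtraction on the left, which would truncate. -/
theorem order_mul_sub_mul {a a' b b' : MvPowerSeries σ R} {n j k : ℕ∞}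
    (ha : n + j ≤ (a - a').order + 1) (hb : n + k ≤ (b - b').order + 1) (hk : k ≤ b.order)
    (hj : j ≤ a'.order) : n + (j + k) ≤ (a * b - a' * b').order + 1 := by
  have e : a * b - a' * b' = (a - a') * b + a' * (b - b') := by ring
  have h1 : n + (j + k) ≤ ((a - a') * b).order + 1 := calc
    n + (j + k) = (n + j) + k := by ring
    _ ≤ ((a - a').order + 1) + b.order := add_le_add ha hk
    _ = ((a - a').order + b.order) + 1 := by ring
    _ ≤ _ := by gcongr; exact le_order_mul
  have h2 : n + (j + k) ≤ (a' * (b - b')).order + 1 := calc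
    n + (j + k) = j + (n + k) := by ring
    _ ≤ a'.order + ((b - b').order + 1) := add_le_add hj hb
    _ = (a'.order + (b - b').order) + 1 := by ring
    _ ≤ _ := by gcongr; exact le_order_mul
  rw [e]
  refine le_trans ?_ (add_le_add_left min_order_le_add 1)
  rw [← min_add_add_right]
  exact le_min h1 h2

/-- In each telescoping term one factor is replaced by a difference of order at least n, and each of
the other deg d - 1 factors has order at least one. -/
theorem order_prod_sub_prod (hG : ∀ s, constantCoeff (G s) = 0)
    (hG' : ∀ s, constantCoeff (G' s) = 0) {n : ℕ∞}
    (h : ∀ s, n ≤ (G s - G' s).order) (d : σ →₀ ℕ) :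
    n + d.degree ≤ ((d.prod fun s e => G s ^ e) - d.prod fun s e => G' s ^ e).order + 1 := by
  induction d using Finsupp.induction_linear with
  | zero => simp
  | add d d' h1 h2 =>
    rw [Finsupp.prod_add_index' (by simp) (fun s a b => pow_add _ _ _),
      Finsupp.prod_add_index' (by simp) (fun s a b => pow_add _ _ _), map_add, Nat.cast_add]
    exact order_mul_sub_mul h1 h2 (degree_le_order_prod hG d') (degree_le_order_prod hG' d)
  | single s k =>
    rw [Finsupp.prod_single_index (h := fun s e => G s ^ e) (pow_zero _),
      Finsupp.prod_single_index (h := fun s e => G' s ^ e) (pow_zero _),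
      Finsupp.degree_single]
    induction k with
    | zero => simp
    | succ k ih =>
      rw [pow_succ, pow_succ, Nat.cast_add]
      refine order_mul_sub_mul ih ?_ ?_ (le_order_pow_of_constantCoeff_eq_zero _ (hG' s))
      · rw [Nat.cast_one]
        gcongr
        exact h s
      · rw [Nat.cast_one]
        exact one_le_order_iff_constCoeff_eq_zero.2 (hG s)

variable [Finite σ]

/-- Substitutions agreeing in low degrees give the same low coefficients. -/
theorem coeff_subst_congr (hG : ∀ s, constantCoeff (G s) = 0)
    (hG' : ∀ s, constantCoeff (G' s) = 0) {n k : ℕ}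
    (h : ∀ s e, e.degree < n → coeff e (G s) = coeff e (G' s)) {f : MvPowerSeries σ R}
    (hf : k ≤ f.order) {e : σ →₀ ℕ} (he : e.degree + 1 < n + k) :
    coeff e (subst G f) = coeff e (subst G' f) := by
  rw [coeff_subst (hasSubst_of_constantCoeff_zero hG),
    coeff_subst (hasSubst_of_constantCoeff_zero hG')]
  refine finsum_congr fun d => ?_
  rcases lt_or_ge d.degree k with hd | hd
  · rw [coeff_of_lt_order (lt_of_lt_of_le (by exact_mod_cast hd) hf), zero_smul, zero_smul]
  · congr 1
    rw [← sub_eq_zero, ← map_sub]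
    refine coeff_of_lt_order ?_
    have key := order_prod_sub_prod hG hG' (n := n)
      (fun s => nat_le_order fun e he => by rw [map_sub, h s e he, sub_self]) d
    have h1 : ((e.degree + 1 + 1 : ℕ) : ℕ∞) ≤ (n : ℕ∞) + d.degree := by
      exact_mod_cast (by omega : e.degree + 1 + 1 ≤ n + d.degree)
    have h2 := h1.trans key
    rw [Nat.cast_add, Nat.cast_one, ENat.add_le_add_iff_right (by simp)] at h2
    exact lt_of_lt_of_le (by exact_mod_cast Nat.lt_succ_self _) h2

/-- Iteration converging to the formal inverse of `X + N`. -/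
def inverseIter (N : σ → MvPowerSeries σ R) : ℕ → σ → MvPowerSeries σ R
  | 0 => 0
  | k + 1 => fun s => X s - subst (inverseIter N k) (N s)

variable {N : σ → MvPowerSeries σ R}

theorem constantCoeff_sub_subst (hN : ∀ s, 2 ≤ (N s).order) (hG : ∀ s, constantCoeff (G s) = 0)
    (s : σ) : constantCoeff (X s - subst G (N s)) = 0 := by
  rw [map_sub, constantCoeff_X, zero_sub, neg_eq_zero]
  exact constantCoeff_subst_eq_zero (hasSubst_of_constantCoeff_zero hG) hG
    (one_le_order_iff_constCoeff_eq_zero.1 (le_trans (by norm_num) (hN s)))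

theorem constantCoeff_inverseIter (hN : ∀ s, 2 ≤ (N s).order) (k : ℕ) (s : σ) :
    constantCoeff (inverseIter N k s) = 0 := by
  induction k generalizing s with
  | zero => simp [inverseIter]
  | succ k ih => exact constantCoeff_sub_subst hN ih s

theorem coeff_inverseIter_succ (hN : ∀ s, 2 ≤ (N s).order) (k : ℕ) :
    ∀ s e, e.degree < k + 1 →
      coeff e (inverseIter N (k + 1) s) = coeff e (inverseIter N k s) := by
  induction k with
  | zero =>
    intro s e he
    obtain rfl : e = 0 := (Finsupp.degree_eq_zero_iff e).1 (by omega)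
    rw [coeff_zero_eq_constantCoeff_apply, coeff_zero_eq_constantCoeff_apply,
      constantCoeff_inverseIter hN, constantCoeff_inverseIter hN]
  | succ k ih =>
    intro s e he
    change coeff e (X s - subst (inverseIter N (k + 1)) (N s))
      = coeff e (X s - subst (inverseIter N k) (N s))
    rw [map_sub, map_sub, coeff_subst_congr (constantCoeff_inverseIter hN _)
      (constantCoeff_inverseIter hN _) ih (k := 2) (hN s) (by omega)]

theorem coeff_inverseIter_of_le (hN : ∀ s, 2 ≤ (N s).order) (s : σ) (e : σ →₀ ℕ) {j : ℕ}
    (hj : e.degree ≤ j) : coeff e (inverseIter N j s) = coeff e (inverseIter N e.degree s) := by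
  induction j, hj using Nat.le_induction with
  | base => rfl
  | succ j hj ih => rw [coeff_inverseIter_succ hN j s e (by omega), ih]

/-- The fixed-point form G = X - N(G) with N = F - X is the basis of existence, uniqueness and the
norm bound alike. -/
theorem subst_eq_X_iff (F : σ → MvPowerSeries σ R) (hG : ∀ s, constantCoeff (G s) = 0) (s : σ) :
    subst G (F s) = X s ↔ G s = X s - subst G (F s - X s) := by
  have h := hasSubst_of_constantCoeff_zero hG
  rw [subst_sub h, subst_X h]
  constructor
  · intro e; rw [e]; ring
  · intro e; linear_combination e

theorem eq_of_fixed (hN : ∀ s, 2 ≤ (N s).order) (hG : ∀ s, constantCoeff (G s) = 0)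
    (hG' : ∀ s, constantCoeff (G' s) = 0) (h : ∀ s, G s = X s - subst G (N s))
    (h' : ∀ s, G' s = X s - subst G' (N s)) : G = G' := by
  have key : ∀ n : ℕ, ∀ s e, e.degree < n → coeff e (G s) = coeff e (G' s) := by
    intro n
    induction n with
    | zero => intro s e he; omega
    | succ n ih =>
      intro s e he
      rw [h s, h' s, map_sub, map_sub, coeff_subst_congr hG hG' ih (k := 2) (hN s) (by omega)]
  funext s
  ext e
  exact key (e.degree + 1) s e (by omega)

/-- Formal power series of the form `X + (order two)` have a unique compositional inverse. -/
theorem existsUnique_formal_inverse {F : σ → MvPowerSeries σ R}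
    (hF : ∀ s, 2 ≤ (F s - X s).order) : ∃! G : σ → MvPowerSeries σ R,
      (∀ s, constantCoeff (G s) = 0) ∧ ∀ s, subst G (F s) = X s := by
  let N := fun s => F s - X s
  have hN : ∀ s, 2 ≤ (N s).order := hF
  -- The coefficient of `e` is stationary from step `e.degree` of the iteration on, so the diagonal
  -- choice is the limit.
  let G : σ → MvPowerSeries σ R := fun s e => coeff e (inverseIter N e.degree s)
  have hc : ∀ s e j, e.degree ≤ j → coeff e (G s) = coeff e (inverseIter N j s) := fun s e j hj =>
    (coeff_inverseIter_of_le hN s e hj).symm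
  have hG : ∀ s, constantCoeff (G s) = 0 := by
    intro s
    rw [← coeff_zero_eq_constantCoeff_apply, hc s 0 0 (by simp)]
    simp [inverseIter]
  refine ⟨G, ⟨hG, fun s => (subst_eq_X_iff F hG s).2 ?_⟩, fun G' hG' => ?_⟩
  · ext e
    rw [hc s e (e.degree + 1) (by omega)]
    change coeff e (X s - subst (inverseIter N e.degree) (N s)) = _
    rw [map_sub, map_sub, coeff_subst_congr (n := e.degree + 1) (k := 2)
      (constantCoeff_inverseIter hN _) hG (fun s e' he' => (hc s e' _ (by omega)).symm) (hN s)
      (by omega)]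
  · refine eq_of_fixed hN hG'.1 hG (fun s => (subst_eq_X_iff F hG'.1 s).1 (hG'.2 s)) fun s => ?_
    ext e
    rw [hc s e (e.degree + 1) (by omega)]
    change coeff e (X s - subst (inverseIter N e.degree) (N s)) = _
    rw [map_sub, map_sub, coeff_subst_congr (n := e.degree + 1) (k := 2)
      (constantCoeff_inverseIter hN _) hG (fun s e' he' => (hc s e' _ (by omega)).symm) (hN s)
      (by omega)]

end FormalInverse

theorem insertBare_forall {p : Fin 5 → MvPowerSeries (Fin 5) ℝ → Prop}
    {H : Fin 3 → MvPowerSeries (Fin 5) ℝ} (h0 : p 0 (MvPowerSeries.X 0))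
    (h1 : p 1 (MvPowerSeries.X 1)) (h : ∀ a, p (irr a) (H a)) (s : Fin 5) :
    p s (insertBare H s) := by
  fin_cases s
  · exact h0
  · exact h1
  · exact h 0
  · exact h 1
  · exact h 2

theorem constantCoeff_insertBare {H : Fin 3 → MvPowerSeries (Fin 5) ℝ} (hH : ∀ a, MvPowerSeries.constantCoeff (H a) = 0)
    (s : Fin 5) : MvPowerSeries.constantCoeff (insertBare H s) = 0 :=
  insertBare_forall (p := fun _ f => MvPowerSeries.constantCoeff f = 0) (by simp) (by simp) hH s

/-- Adding the two relevant parameters as identity components makes the system square, so that the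
inversion theorem for five series in five variables applies. -/
theorem isInversion_iff {L : VertexFunctions} {ΛR : ℝ} {H : Fin 3 → MvPowerSeries (Fin 5) ℝ} :
    IsInversion L ΛR H ↔ (∀ s, MvPowerSeries.constantCoeff (insertBare H s) = 0) ∧
      ∀ s, MvPowerSeries.subst (insertBare H) (devFamily L ΛR s) = MvPowerSeries.X s := by
  constructor
  · intro h
    have hc := constantCoeff_insertBare h.constantCoeff
    have hs := MvPowerSeries.hasSubst_of_constantCoeff_zero hc
    exact ⟨hc, fun s => insertBare_forall (H := devSeries L ΛR)
      (p := fun s f => MvPowerSeries.subst (insertBare H) f = MvPowerSeries.X s)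
      (MvPowerSeries.subst_X hs 0) (MvPowerSeries.subst_X hs 1) h.inverts s⟩
  · rintro ⟨h1, h2⟩
    refine ⟨fun a => ?_, fun a => ?_⟩
    · rw [← insertBare_irr H a]; exact h1 _
    · rw [← insertBare_irr (devSeries L ΛR) a]; exact h2 _

/-- The relation between bare couplings and deviations has a unique formal inverse. -/
theorem existsUnique_isInversion {K : ℝ → ℝ} {A B ΛR Λ0 : ℝ} {L : VertexFunctions}
    (h : IsPerturbativeFlow K A B ΛR Λ0 L) (hle : ΛR ≤ Λ0) : ∃! H, IsInversion L ΛR H := by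
  obtain ⟨G, ⟨hG, hGX⟩, huniq⟩ := existsUnique_formal_inverse (devSeries_order h hle)
  have hs := MvPowerSeries.hasSubst_of_constantCoeff_zero hG
  have hG5 : insertBare (fun a => G (irr a)) = G := by
    funext s
    -- The first two components of the expansion are variables, so those of its inverse are forced
    -- to be the same variables.
    refine insertBare_forall (p := fun s f => f = G s) ?_ ?_ (fun a => rfl) s
    · exact (hGX 0).symm.trans (MvPowerSeries.subst_X hs 0)
    · exact (hGX 1).symm.trans (MvPowerSeries.subst_X hs 1)
  refine ⟨fun a => G (irr a), isInversion_iff.2 ?_, fun H hH => ?_⟩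
  · rw [hG5]
    exact ⟨hG, hGX⟩
  · have := huniq _ (isInversion_iff.1 hH)
    funext a
    rw [← this, insertBare_irr]

/-! ### Weighted norms of truncated power series -/

section WeightedNorm

open MvPowerSeries

variable {σ : Type} [Fintype σ]

/-- Monomials at the point `c`. -/
def monomialAt (c : σ → ℝ) (l : σ →₀ ℕ) : ℝ := ∏ i, c i ^ l i

theorem monomialAt_add (c : σ → ℝ) (l l' : σ →₀ ℕ) :
    monomialAt c (l + l') = monomialAt c l * monomialAt c l' := by
  simp only [monomialAt, Finsupp.add_apply, pow_add, Finset.prod_mul_distrib]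

theorem monomialAt_nonneg {c : σ → ℝ} (hc : ∀ i, 0 ≤ c i) (l : σ →₀ ℕ) : 0 ≤ monomialAt c l :=
  Finset.prod_nonneg fun i _ => pow_nonneg (hc i) _

theorem monomialAt_smul (c : σ → ℝ) (t : ℝ) (l : σ →₀ ℕ) :
    monomialAt (fun i => c i * t) l = monomialAt c l * t ^ l.degree := by
  simp only [monomialAt, mul_pow, Finset.prod_mul_distrib, Finset.prod_pow_eq_pow_sum,
    Finsupp.degree_eq_sum]

theorem monomialAt_single (c : σ → ℝ) (s : σ) : monomialAt c (Finsupp.single s 1) = c s := by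
  rw [monomialAt, Finset.prod_eq_single s] <;> simp +contextual [eq_comm]

theorem monomialAt_le {c c' : σ → ℝ} (hc : ∀ i, 0 ≤ c i) (h : ∀ i, c i ≤ c' i) (l : σ →₀ ℕ) :
    monomialAt c l ≤ monomialAt c' l :=
  Finset.prod_le_prod (fun i _ => pow_nonneg (hc i) _) fun i _ => pow_le_pow_left₀ (hc i) (h i) _

variable [DecidableEq σ]

/-- The monomials up to a total degree. -/
def monomialsUpTo (σ : Type) [Fintype σ] [DecidableEq σ] (n : ℕ) : Finset (σ →₀ ℕ) :=
  (Finset.range (n + 1)).biUnion fun d => Finset.finsuppAntidiag Finset.univ d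

theorem mem_monomialsUpTo {n : ℕ} {l : σ →₀ ℕ} : l ∈ monomialsUpTo σ n ↔ l.degree ≤ n := by
  simp [monomialsUpTo, Finset.mem_finsuppAntidiag, Finsupp.degree_eq_sum]

theorem monomialsUpTo_mono {n n' : ℕ} (h : n ≤ n') : monomialsUpTo σ n ⊆ monomialsUpTo σ n' :=
  fun _ hl => mem_monomialsUpTo.2 ((mem_monomialsUpTo.1 hl).trans h)

/-- The weighted `ℓ¹` norm of the coefficients up to a total degree. -/
def wnorm (c : σ → ℝ) (n : ℕ) (f : MvPowerSeries σ ℝ) : ℝ :=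
  ∑ l ∈ monomialsUpTo σ n, |coeff l f| * monomialAt c l

theorem wnorm_one_le (c : σ → ℝ) (n : ℕ) : wnorm c n 1 ≤ 1 := by
  have h : ∀ l, |coeff l (1 : MvPowerSeries σ ℝ)| * monomialAt c l = if l = 0 then 1 else 0 := by
    intro l
    rw [coeff_one]
    split_ifs with hl
    · simp [hl, monomialAt]
    · rw [abs_zero, zero_mul]
  rw [wnorm, Finset.sum_congr rfl fun l _ => h l, Finset.sum_ite_eq']
  split_ifs <;> norm_num

variable {c : σ → ℝ} (hc : ∀ i, 0 ≤ c i) {n : ℕ} {f g : MvPowerSeries σ ℝ}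

include hc

theorem wnorm_nonneg : 0 ≤ wnorm c n f :=
  Finset.sum_nonneg fun l _ => mul_nonneg (abs_nonneg _) (monomialAt_nonneg hc l)

theorem wnorm_mono {n' : ℕ} (h : n ≤ n') : wnorm c n f ≤ wnorm c n' f :=
  Finset.sum_le_sum_of_subset_of_nonneg (monomialsUpTo_mono h) fun l _ _ =>
    mul_nonneg (abs_nonneg _) (monomialAt_nonneg hc l)

theorem wnorm_le_of_coeff (h : ∀ l : σ →₀ ℕ, l.degree ≤ n → |coeff l f| ≤ |coeff l g|) :
    wnorm c n f ≤ wnorm c n g :=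
  Finset.sum_le_sum fun l hl => mul_le_mul_of_nonneg_right (h l (mem_monomialsUpTo.1 hl))
    (monomialAt_nonneg hc l)

theorem wnorm_sub_le : wnorm c n (f - g) ≤ wnorm c n f + wnorm c n g := by
  rw [wnorm, wnorm, wnorm, ← Finset.sum_add_distrib]
  refine Finset.sum_le_sum fun l _ => ?_
  rw [← add_mul, map_sub]
  exact mul_le_mul_of_nonneg_right (abs_sub _ _) (monomialAt_nonneg hc l)

theorem wnorm_X_le (s : σ) : wnorm c n (X s) ≤ c s := by
  have h : ∀ l, |coeff l (X s : MvPowerSeries σ ℝ)| * monomialAt c l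
      = if l = Finsupp.single s 1 then c s else 0 := by
    intro l
    rw [coeff_X]
    split_ifs with hl
    · rw [hl, monomialAt_single, abs_one, one_mul]
    · rw [abs_zero, zero_mul]
  rw [wnorm, Finset.sum_congr rfl fun l _ => h l, Finset.sum_ite_eq']
  split_ifs
  · exact le_rfl
  · exact hc s

/-- Weights are multiplicative, and two monomials whose product has degree at most n both have
degree at most n. Distinct products come from disjoint sets of pairs, so no pair is counted twice.
-/
theorem wnorm_mul_le : wnorm c n (f * g) ≤ wnorm c n f * wnorm c n g := by
  let φ : (σ →₀ ℕ) × (σ →₀ ℕ) → ℝ := fun p =>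
    (|coeff p.1 f| * monomialAt c p.1) * (|coeff p.2 g| * monomialAt c p.2)
  have hφ : ∀ p, 0 ≤ φ p := fun p => mul_nonneg
    (mul_nonneg (abs_nonneg _) (monomialAt_nonneg hc _))
    (mul_nonneg (abs_nonneg _) (monomialAt_nonneg hc _))
  calc wnorm c n (f * g)
      ≤ ∑ l ∈ monomialsUpTo σ n, ∑ p ∈ Finset.HasAntidiagonal.antidiagonal l, φ p := by
        refine Finset.sum_le_sum fun l _ => ?_
        rw [coeff_mul]
        refine (mul_le_mul_of_nonneg_right (Finset.abs_sum_le_sum_abs _ _)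
          (monomialAt_nonneg hc l)).trans (le_of_eq ?_)
        rw [Finset.sum_mul]
        refine Finset.sum_congr rfl fun p hp => ?_
        rw [← Finset.HasAntidiagonal.mem_antidiagonal.1 hp, monomialAt_add, abs_mul]
        simp only [φ]
        ring
    _ = ∑ p ∈ (monomialsUpTo σ n).biUnion Finset.HasAntidiagonal.antidiagonal, φ p := by
        rw [Finset.sum_biUnion]
        intro l _ l' _ hne
        rw [Function.onFun, Finset.disjoint_left]
        intro p hp hp'
        exact hne ((Finset.HasAntidiagonal.mem_antidiagonal.1 hp).symm.trans (Finset.HasAntidiagonal.mem_antidiagonal.1 hp'))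
    _ ≤ ∑ p ∈ monomialsUpTo σ n ×ˢ monomialsUpTo σ n, φ p := by
        refine Finset.sum_le_sum_of_subset_of_nonneg (fun p hp => ?_) fun p _ _ => hφ p
        obtain ⟨l, hl, hp⟩ := Finset.mem_biUnion.1 hp
        rw [← Finset.HasAntidiagonal.mem_antidiagonal.1 hp, mem_monomialsUpTo, map_add] at hl
        rw [Finset.mem_product, mem_monomialsUpTo, mem_monomialsUpTo]
        omega
    _ = _ := by rw [wnorm, wnorm, Finset.sum_mul_sum, Finset.sum_product]

theorem wnorm_pow_le (k : ℕ) : wnorm c n (f ^ k) ≤ wnorm c n f ^ k := by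
  induction k with
  | zero => rw [pow_zero, pow_zero]; exact wnorm_one_le c n
  | succ k ih =>
    rw [pow_succ, pow_succ]
    exact (wnorm_mul_le hc).trans (mul_le_mul_of_nonneg_right ih (wnorm_nonneg hc))

theorem wnorm_prod_pow_le (G : σ → MvPowerSeries σ ℝ) (m : σ →₀ ℕ) :
    wnorm c n (m.prod fun s k => G s ^ k) ≤ monomialAt (fun s => wnorm c n (G s)) m := by
  rw [Finsupp.prod_fintype _ _ fun s => pow_zero _, monomialAt]
  induction (Finset.univ : Finset σ) using Finset.induction_on with
  | empty => simpa using wnorm_one_le c n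
  | insert a s ha ih =>
    rw [Finset.prod_insert ha, Finset.prod_insert ha]
    exact (wnorm_mul_le hc).trans (mul_le_mul (wnorm_pow_le hc _) ih (wnorm_nonneg hc)
      (pow_nonneg (wnorm_nonneg hc) _))

/-- Without constant terms in `G`, a monomial of degree above n contributes only above degree n, so
finitely many terms remain. -/
theorem wnorm_subst_le {G : σ → MvPowerSeries σ ℝ} (hG : ∀ s, constantCoeff (G s) = 0) :
    wnorm c n (subst G f)
      ≤ ∑ m ∈ monomialsUpTo σ n, |coeff m f| * monomialAt (fun s => wnorm c n (G s)) m := by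
  have hcoeff : ∀ e ∈ monomialsUpTo σ n, coeff e (subst G f)
      = ∑ m ∈ monomialsUpTo σ n, coeff m f * coeff e (m.prod fun s k => G s ^ k) := by
    intro e he
    rw [coeff_subst (hasSubst_of_constantCoeff_zero hG)]
    refine finsum_eq_sum_of_support_subset _ fun m hm => ?_
    rw [Finset.mem_coe, mem_monomialsUpTo]
    by_contra! hlt
    refine hm ?_
    beta_reduce
    rw [coeff_of_lt_order (d := e), smul_zero]
    refine lt_of_lt_of_le ?_ (degree_le_order_prod hG m)
    exact_mod_cast (mem_monomialsUpTo.1 he).trans_lt hlt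
  calc wnorm c n (subst G f)
      ≤ ∑ e ∈ monomialsUpTo σ n, ∑ m ∈ monomialsUpTo σ n,
          |coeff m f| * (|coeff e (m.prod fun s k => G s ^ k)| * monomialAt c e) := by
        refine Finset.sum_le_sum fun e he => ?_
        rw [hcoeff e he]
        refine (mul_le_mul_of_nonneg_right (Finset.abs_sum_le_sum_abs _ _)
          (monomialAt_nonneg hc e)).trans (le_of_eq ?_)
        rw [Finset.sum_mul]
        refine Finset.sum_congr rfl fun m _ => ?_
        rw [abs_mul, mul_assoc]
    _ = ∑ m ∈ monomialsUpTo σ n, |coeff m f| * wnorm c n (m.prod fun s k => G s ^ k) := by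
        rw [Finset.sum_comm]
        simp only [← Finset.mul_sum, wnorm]
    _ ≤ _ := by
        refine Finset.sum_le_sum fun m _ => ?_
        exact mul_le_mul_of_nonneg_left (wnorm_prod_pow_le hc G m) (abs_nonneg _)

theorem wnorm_truncTotal_le {D N : ℕ} :
    wnorm c D (truncTotal (N + 1) f : MvPowerSeries σ ℝ) ≤ wnorm c N f := by
  have h : ∀ l ∈ monomialsUpTo σ D, |coeff l (truncTotal (N + 1) f : MvPowerSeries σ ℝ)|
      * monomialAt c l = if l ∈ monomialsUpTo σ N then |coeff l f| * monomialAt c l else 0 := by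
    intro l _
    rw [MvPolynomial.coeff_coe, coeff_truncTotal_eq_ite]
    simp only [mem_monomialsUpTo, Nat.lt_succ_iff]
    split_ifs <;> simp
  rw [wnorm, Finset.sum_congr rfl h, ← Finset.sum_filter]
  refine Finset.sum_le_sum_of_subset_of_nonneg (fun l hl => (Finset.mem_filter.1 hl).2)
    fun l _ _ => mul_nonneg (abs_nonneg _) (monomialAt_nonneg hc l)

theorem wnorm_scale_le {E : ℝ} (hE : 1 ≤ E) :
    wnorm (fun i => c i * E) n f ≤ E ^ n * wnorm c n f := by
  rw [wnorm, wnorm, Finset.mul_sum]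
  refine Finset.sum_le_sum fun l hl => ?_
  rw [monomialAt_smul]
  have h1 := pow_le_pow_right₀ hE (mem_monomialsUpTo.1 hl)
  have h2 := mul_nonneg (abs_nonneg (coeff l f)) (monomialAt_nonneg hc l)
  nlinarith

/-- Recursive bound on the norm of a formal inverse. -/
def inverseBound (b : ℝ) : ℕ → ℝ
  | 0 => 1
  | n + 1 => 1 + b * inverseBound b n ^ (n + 1)

omit hc in
theorem one_le_inverseBound {b : ℝ} (hb : 0 ≤ b) (n : ℕ) : 1 ≤ inverseBound b n := by
  induction n with
  | zero => exact le_rfl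
  | succ n ih =>
    rw [inverseBound]
    have := mul_nonneg hb (pow_nonneg (zero_le_one.trans ih) (n + 1))
    linarith

theorem sum_monomialAt_le {b : ℝ} (hb : 1 ≤ b) {v : σ → ℝ} (hv : ∀ s, 0 ≤ v s)
    (h : ∀ s, v s ≤ c s * b) :
    ∑ m ∈ monomialsUpTo σ n, |coeff m f| * monomialAt v m ≤ wnorm c n f * b ^ n := by
  rw [wnorm, Finset.sum_mul]
  refine Finset.sum_le_sum fun m hm => ?_
  rw [mul_assoc]
  refine mul_le_mul_of_nonneg_left ((monomialAt_le hv h m).trans ?_) (abs_nonneg _)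
  rw [monomialAt_smul]
  exact mul_le_mul_of_nonneg_left (pow_le_pow_right₀ hb (mem_monomialsUpTo.1 hm))
    (monomialAt_nonneg hc m)

/-- Norm bounds on a formal inverse. -/
theorem wnorm_inverse_le {F G : σ → MvPowerSeries σ ℝ} (hF : ∀ s, 2 ≤ (F s - X s).order)
    (hG : ∀ s, constantCoeff (G s) = 0) (hGF : ∀ s, subst G (F s) = X s) {N : ℕ} {b : ℝ}
    (hb : 0 ≤ b) (hN : ∀ s, wnorm c N (F s - X s) ≤ c s * b) :
    ∀ n ≤ N, ∀ s, wnorm c n (G s) ≤ c s * inverseBound b n := by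
  intro n
  induction n with
  | zero =>
    intro _ s
    have h0 : wnorm c 0 (G s) = 0 := by
      refine Finset.sum_eq_zero fun l hl => ?_
      obtain rfl : l = 0 := (Finsupp.degree_eq_zero_iff l).1 (by
        have := mem_monomialsUpTo.1 hl
        omega)
      rw [coeff_zero_eq_constantCoeff_apply, hG s, abs_zero, zero_mul]
    rw [h0, inverseBound, mul_one]
    exact hc s
  | succ n ih =>
    intro hn s
    -- Replacing `G` by its part of degree at most n does not change N(G) up to degree n + 1,
    -- because N has order at least two. The induction hypothesis then bounds everything that
    -- enters.
    let T : σ → MvPowerSeries σ ℝ := fun t => (truncTotal (n + 1) (G t) : MvPowerSeries σ ℝ)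
    have hT : ∀ t e, e.degree < n + 1 → coeff e (G t) = coeff e (T t) := by
      intro t e he
      simp only [T]
      rw [MvPolynomial.coeff_coe, coeff_truncTotal _ he]
    have hT0 : ∀ t, constantCoeff (T t) = 0 := by
      intro t
      rw [← coeff_zero_eq_constantCoeff_apply, ← hT t 0 (by simp),
        coeff_zero_eq_constantCoeff_apply, hG t]
    have h1 : wnorm c (n + 1) (G s) ≤ wnorm c (n + 1) (X s - subst T (F s - X s)) := by
      refine wnorm_le_of_coeff hc fun l hl => le_of_eq ?_
      conv_lhs => rw [(subst_eq_X_iff F hG s).1 (hGF s)]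
      rw [map_sub, map_sub, coeff_subst_congr hG hT0 hT (k := 2) (hF s) (by omega)]
    have hb1 := one_le_inverseBound hb n
    have h2 : wnorm c (n + 1) (subst T (F s - X s))
        ≤ wnorm c (n + 1) (F s - X s) * inverseBound b n ^ (n + 1) :=
      (wnorm_subst_le hc hT0).trans (sum_monomialAt_le hc hb1 (fun t => wnorm_nonneg hc)
        fun t => (wnorm_truncTotal_le hc).trans (ih (by omega) t))
    have h3 := (wnorm_mono hc hn).trans (hN s)
    have h4 : 0 ≤ inverseBound b n ^ (n + 1) := by positivity
    calc _ ≤ wnorm c (n + 1) (X s) + wnorm c (n + 1) (subst T (F s - X s)) :=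
          h1.trans (wnorm_sub_le hc)
      _ ≤ c s + (c s * b) * inverseBound b n ^ (n + 1) := by
          refine add_le_add (wnorm_X_le hc s) (h2.trans ?_)
          gcongr
      _ = _ := by rw [inverseBound]; ring

end WeightedNorm

/-! ### Composition of truncated series with truncated inverses -/

section Composition

open MvPowerSeries

variable {σ : Type} [Fintype σ] [DecidableEq σ] {c : σ → ℝ} (hc : ∀ i, 0 ≤ c i)

/-- Value of a power series cut off after a total order. -/
def truncEval (N : ℕ) (f : MvPowerSeries σ ℝ) (x : σ → ℝ) : ℝ :=
  MvPolynomial.eval x (truncTotal (N + 1) f)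

omit [DecidableEq σ] in
theorem truncEval_X {N : ℕ} (hN : N ≠ 0) (s : σ) (x : σ → ℝ) :
    truncEval N (X s : MvPowerSeries σ ℝ) x = x s := by
  have : truncTotal (N + 1) (X s : MvPowerSeries σ ℝ) = MvPolynomial.X s := by
    rw [← MvPolynomial.coe_X, truncTotal_coe_eq_self_iff _ (by omega), MvPolynomial.totalDegree_X]
    omega
  rw [truncEval, this, MvPolynomial.eval_X]

theorem truncEval_eq_sum (N : ℕ) (f : MvPowerSeries σ ℝ) (x : σ → ℝ) :
    truncEval N f x = ∑ l ∈ monomialsUpTo σ N, coeff l f * monomialAt x l := by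
  rw [truncEval, MvPolynomial.eval_eq']
  refine (Finset.sum_subset (s₂ := monomialsUpTo σ N) (fun l hl => ?_) fun l _ hl => ?_).trans
    (Finset.sum_congr rfl fun l hl => ?_)
  · rw [mem_monomialsUpTo]
    by_contra! h
    exact MvPolynomial.mem_support_iff.1 hl (coeff_truncTotal_eq_zero _ h)
  · rw [MvPolynomial.notMem_support_iff.1 hl, zero_mul]
  · rw [coeff_truncTotal _ (Nat.lt_succ_of_le (mem_monomialsUpTo.1 hl)), monomialAt]

omit [DecidableEq σ] in
theorem abs_monomialAt_le {x : σ → ℝ} {t : ℝ} (hx : ∀ i, |x i| ≤ c i * t) (l : σ →₀ ℕ) :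
    |monomialAt x l| ≤ monomialAt c l * t ^ l.degree := by
  rw [← monomialAt_smul, monomialAt, Finset.abs_prod]
  simp only [abs_pow]
  exact Finset.prod_le_prod (fun i _ => by positivity) fun i _ =>
    pow_le_pow_left₀ (abs_nonneg _) (hx i) _

include hc

theorem abs_truncEval_le {N : ℕ} {f : MvPowerSeries σ ℝ} {x : σ → ℝ} {E : ℝ} (hE : 1 ≤ E)
    (hx : ∀ i, |x i| ≤ c i * E) : |truncEval N f x| ≤ E ^ N * wnorm c N f := by
  rw [truncEval_eq_sum]
  refine (Finset.abs_sum_le_sum_abs _ _).trans (le_trans ?_ (wnorm_scale_le hc hE))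
  refine Finset.sum_le_sum fun l _ => ?_
  rw [abs_mul, monomialAt_smul]
  exact mul_le_mul_of_nonneg_left (abs_monomialAt_le hx l) (abs_nonneg _)

/-- A polynomial without terms of low order is small at small arguments. -/
theorem abs_eval_le_of_coeff_eq_zero {Z : MvPolynomial σ ℝ} {N : ℕ}
    (hZ : ∀ l : σ →₀ ℕ, l.degree ≤ N → Z.coeff l = 0) {x : σ → ℝ} {t E : ℝ} (ht : 0 ≤ t)
    (hE : 1 ≤ E) (htE : t ≤ E) (hx : ∀ i, |x i| ≤ c i * t) :
    |MvPolynomial.eval x Z| ≤ t ^ (N + 1) * wnorm (fun i => c i * E) Z.totalDegree Z := by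
  have hsub : Z.support ⊆ monomialsUpTo σ Z.totalDegree := fun l hl =>
    mem_monomialsUpTo.2 (MvPolynomial.le_totalDegree hl)
  have h1 : |MvPolynomial.eval x Z| ≤ ∑ l ∈ Z.support,
      t ^ (N + 1) * (|Z.coeff l| * monomialAt (fun i => c i * E) l) := by
    rw [MvPolynomial.eval_eq']
    refine (Finset.abs_sum_le_sum_abs _ _).trans (Finset.sum_le_sum fun l hl => ?_)
    have hdeg : N < l.degree := by
      by_contra! h
      exact MvPolynomial.mem_support_iff.1 hl (hZ l h)
    -- Exactly N + 1 powers of t are kept for the error estimate; the surplus ones are bounded by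
    -- powers of E.
    have h2 : t ^ l.degree ≤ t ^ (N + 1) * E ^ l.degree := by
      calc t ^ l.degree = t ^ (N + 1) * t ^ (l.degree - (N + 1)) := by
            rw [← pow_add]; congr 1; omega
        _ ≤ t ^ (N + 1) * E ^ (l.degree - (N + 1)) := by gcongr
        _ ≤ t ^ (N + 1) * E ^ l.degree := by gcongr; exact Nat.sub_le _ _
    have h3 := monomialAt_nonneg hc l
    rw [abs_mul, monomialAt_smul]
    calc |Z.coeff l| * |monomialAt x l|
        ≤ |Z.coeff l| * (monomialAt c l * (t ^ (N + 1) * E ^ l.degree)) := by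
          gcongr
          exact (abs_monomialAt_le hx l).trans (mul_le_mul_of_nonneg_left h2 h3)
      _ = _ := by ring
  refine h1.trans ?_
  rw [← Finset.mul_sum]
  refine mul_le_mul_of_nonneg_left ?_ (by positivity)
  refine (Finset.sum_le_sum_of_subset_of_nonneg hsub fun l _ _ => ?_).trans
    (le_of_eq (Finset.sum_congr rfl fun l _ => by rw [MvPolynomial.coeff_coe]))
  exact mul_nonneg (abs_nonneg _) (monomialAt_nonneg (fun i => mul_nonneg (hc i) (by linarith)) l)

/-- The composition of a truncated series with its truncated inverse is the identity up to terms
of higher order. -/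
theorem abs_truncEval_comp_sub_le {F G : σ → MvPowerSeries σ ℝ}
    (hG : ∀ s, constantCoeff (G s) = 0) (hGF : ∀ s, subst G (F s) = X s) {N : ℕ} {b : ℝ}
    (hb : 1 ≤ b) (hFb : ∀ s, wnorm c N (F s) ≤ c s * b) (hGb : ∀ s, wnorm c N (G s) ≤ c s * b)
    {x : σ → ℝ} {t E : ℝ} (ht : 0 ≤ t) (hE : 1 ≤ E) (htE : t ≤ E) (hx : ∀ i, |x i| ≤ c i * t)
    (s : σ) : |truncEval N (F s) (fun i => truncEval N (G i) x) - x s|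
      ≤ c s * (b * (E ^ N * b) ^ N + E) * t ^ (N + 1) := by
  let p : MvPolynomial σ ℝ := truncTotal (N + 1) (F s)
  let q : σ → MvPolynomial σ ℝ := fun i => truncTotal (N + 1) (G i)
  -- The error is an honest polynomial. Truncating before or after composing gives the same
  -- coefficients through degree N, so all of these cancel against `X s`.
  let Z : MvPolynomial σ ℝ := MvPolynomial.bind₁ q p - MvPolynomial.X s
  have hev : MvPolynomial.eval x Z
      = truncEval N (F s) (fun i => truncEval N (G i) x) - x s := by
    simp only [Z, map_sub, MvPolynomial.eval_X]
    congr 1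
    exact MvPolynomial.eval₂Hom_bind₁ (RingHom.id ℝ) x q p
  have hq0 : ∀ i, constantCoeff (q i : MvPowerSeries σ ℝ) = 0 := by
    intro i
    rw [← coeff_zero_eq_constantCoeff_apply, MvPolynomial.coeff_coe,
      coeff_truncTotal _ (by simp), coeff_zero_eq_constantCoeff_apply, hG i]
  have hcoe : (MvPolynomial.bind₁ q p : MvPowerSeries σ ℝ)
      = subst (fun i => (q i : MvPowerSeries σ ℝ)) (p : MvPowerSeries σ ℝ) := by
    rw [subst_coe]
    refine (MvPolynomial.map_aeval q (MvPolynomial.coeToMvPowerSeries.ringHom (σ := σ) (R := ℝ))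
      p).trans ?_
    rw [MvPolynomial.aeval_def, MvPolynomial.coe_eval₂Hom]
    congr 1
    ext r : 1
    exact MvPolynomial.coe_C r
  have hZc : (Z : MvPowerSeries σ ℝ)
      = subst (fun i => (q i : MvPowerSeries σ ℝ)) (p : MvPowerSeries σ ℝ) - X s := by
    rw [← hcoe]
    ext l
    rw [map_sub, MvPolynomial.coeff_coe, MvPolynomial.coeff_coe, MvPolynomial.coeff_sub,
      ← MvPolynomial.coeff_coe (MvPolynomial.X s), MvPolynomial.coe_X]
  have hZ : ∀ l : σ →₀ ℕ, l.degree ≤ N → Z.coeff l = 0 := by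
    intro l hl
    have h1 := congrArg (MvPolynomial.coeff l) (truncTotal_subst (f := F s) (k := N + 1) hG)
    rw [coeff_truncTotal _ (Nat.lt_succ_of_le hl), coeff_truncTotal _ (Nat.lt_succ_of_le hl),
      hGF s] at h1
    rw [← MvPolynomial.coeff_coe, hZc, map_sub, ← h1, sub_self]
  have hcE : ∀ i, 0 ≤ c i * E := fun i => mul_nonneg (hc i) (by linarith)
  have key := abs_eval_le_of_coeff_eq_zero hc hZ ht hE htE hx
  rw [hev] at key
  refine key.trans ?_
  rw [mul_comm]
  refine mul_le_mul_of_nonneg_right ?_ (by positivity)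
  have hEN : 1 ≤ E ^ N := one_le_pow₀ hE
  have hEb : 1 ≤ E ^ N * b := one_le_mul_of_one_le_of_one_le hEN hb
  -- The degree of the error polynomial is irrelevant: `p` and the `q i` stop at degree N, so their
  -- norms at any level are bounded by those at N.
  generalize Z.totalDegree = D
  have hqn : ∀ i, wnorm (fun i => c i * E) D (q i : MvPowerSeries σ ℝ) ≤ c i * (E ^ N * b) := by
    intro i
    calc _ ≤ wnorm (fun i => c i * E) N (G i) := wnorm_truncTotal_le hcE
      _ ≤ E ^ N * wnorm c N (G i) := wnorm_scale_le hc hE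
      _ ≤ E ^ N * (c i * b) := by gcongr; exact hGb i
      _ = _ := by ring
  have hpn : ∑ m ∈ monomialsUpTo σ D, |coeff m (p : MvPowerSeries σ ℝ)|
      * monomialAt (fun i => wnorm (fun i => c i * E) D (q i : MvPowerSeries σ ℝ)) m
      ≤ c s * b * (E ^ N * b) ^ N := by
    calc _ ≤ ∑ m ∈ monomialsUpTo σ D, |coeff m (p : MvPowerSeries σ ℝ)|
          * monomialAt c m * (E ^ N * b) ^ N := by
          refine Finset.sum_le_sum fun m _ => ?_
          rcases le_or_gt m.degree N with hm | hm
          · rw [mul_assoc]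
            refine mul_le_mul_of_nonneg_left ((monomialAt_le (fun i => wnorm_nonneg hcE) hqn
              m).trans ?_) (abs_nonneg _)
            rw [monomialAt_smul]
            exact mul_le_mul_of_nonneg_left (pow_le_pow_right₀ hEb hm) (monomialAt_nonneg hc m)
          · rw [MvPolynomial.coeff_coe, coeff_truncTotal_eq_zero _ hm, abs_zero, zero_mul,
              zero_mul, zero_mul]
      _ = wnorm c D (p : MvPowerSeries σ ℝ) * (E ^ N * b) ^ N := by
          rw [wnorm, Finset.sum_mul]
      _ ≤ _ := by
          gcongr
          exact (wnorm_truncTotal_le hc).trans (hFb s)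
  calc wnorm (fun i => c i * E) D Z
      ≤ c s * b * (E ^ N * b) ^ N + c s * E := by
        rw [hZc]
        exact (wnorm_sub_le hcE).trans (add_le_add ((wnorm_subst_le hcE hq0).trans hpn)
          (wnorm_X_le hcE s))
    _ = _ := by ring

end Composition

/-! ### Collecting logarithmic bounds into one polynomial -/

/-- Functions bounded by majorants. -/
def Moderate (h : ℝ → ℝ) : Prop := ∃ M : ℕ, ∀ x, 1 ≤ x → |h x| ≤ majorant M x

theorem moderate_majorant (M : ℕ) : Moderate (majorant M) :=
  ⟨M, fun _ hx => (abs_of_nonneg (majorant_nonneg M hx)).le⟩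

theorem moderate_const (C : ℝ) : Moderate fun _ => C := by
  obtain ⟨M, hM⟩ := exists_majorant |C| 0
  exact ⟨M, fun x hx => by simpa using hM x hx⟩

theorem Moderate.add {h k : ℝ → ℝ} (hh : Moderate h) (hk : Moderate k) :
    Moderate fun x => h x + k x := by
  obtain ⟨M, hM⟩ := hh
  obtain ⟨N, hN⟩ := hk
  exact ⟨M + N, fun x hx => (abs_add_le _ _).trans
    ((add_le_add (hM x hx) (hN x hx)).trans (add_majorant_le M N hx))⟩

theorem Moderate.mul {h k : ℝ → ℝ} (hh : Moderate h) (hk : Moderate k) :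
    Moderate fun x => h x * k x := by
  obtain ⟨M, hM⟩ := hh
  obtain ⟨N, hN⟩ := hk
  obtain ⟨M', hM'⟩ := exists_majorant (M * N) (M + N)
  refine ⟨M', fun x hx => le_trans ?_ (hM' x hx)⟩
  rw [abs_mul]
  refine (mul_le_mul (hM x hx) (hN x hx) (abs_nonneg _) (majorant_nonneg M hx)).trans
    (le_of_eq ?_)
  simp only [majorant, pow_add]
  ring

theorem Moderate.pow {h : ℝ → ℝ} (hh : Moderate h) (n : ℕ) : Moderate fun x => h x ^ n := by
  induction n with
  | zero => simpa using moderate_const 1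
  | succ n ih => simpa only [pow_succ] using ih.mul hh

theorem Moderate.inverseBound {b : ℝ → ℝ} (hb : Moderate b) (n : ℕ) :
    Moderate fun x => inverseBound (b x) n := by
  induction n with
  | zero => exact moderate_const 1
  | succ n ih => exact (moderate_const 1).add (hb.mul (ih.pow (n + 1)))

theorem Moderate.exists_polynomial {h : ℝ → ℝ} (hh : Moderate h) :
    ∃ T : Polynomial ℝ, NonnegCoeffs T ∧ ∀ x, 1 ≤ x → h (1 + Real.log x) ≤ pln T x := by
  obtain ⟨M, hM⟩ := hh
  -- A majorant in 1 + log x, expanded in log x, has nonnegative coefficients.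
  refine ⟨Polynomial.C (M : ℝ) * (1 + Polynomial.X) ^ M, fun i => ?_, fun x hx => ?_⟩
  · rw [Polynomial.coeff_C_mul, Polynomial.coeff_one_add_X_pow]
    positivity
  · refine (le_abs_self _).trans ((hM _ (by linarith [Real.log_nonneg hx])).trans (le_of_eq ?_))
    simp [pln, majorant]

/-! ### Natural sizes of the parameters and evaluation of truncated series -/

/-- The natural sizes of the expansion parameters. -/
def paramSize (ΛR Λ0 : ℝ) : Fin 5 → ℝ := ![ΛR, 1, Λ0⁻¹, Λ0⁻¹, Λ0⁻¹]

theorem paramSize_irr (ΛR Λ0 : ℝ) (a : Fin 3) : paramSize ΛR Λ0 (irr a) = Λ0⁻¹ := by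
  fin_cases a <;> rfl

theorem paramSize_nonneg {ΛR Λ0 : ℝ} (hR : 0 ≤ ΛR) (h0 : 0 ≤ Λ0) (i : Fin 5) :
    0 ≤ paramSize ΛR Λ0 i := by
  have : 0 ≤ Λ0⁻¹ := inv_nonneg.2 h0
  fin_cases i
  · exact hR
  · exact zero_le_one
  all_goals exact this

theorem monomialAt_paramSize (ΛR Λ0 : ℝ) (l : Order) :
    monomialAt (paramSize ΛR Λ0) l = ΛR ^ l 0 * Λ0⁻¹ ^ orderIrr l := by
  simp [monomialAt, Fin.prod_univ_five, paramSize, orderIrr, pow_add, mul_assoc]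

/-- Norm bound on the expansions of the deviations at the renormalization scale. -/
theorem exists_wnorm_devFamily_le {K : ℝ → ℝ} (hK : IsCutoff K)
    (P : Order → ℕ → ℕ → Polynomial ℝ) (N : ℕ) : ∃ M : ℕ,
      ∀ {A B ΛR Λ0 : ℝ} {L : VertexFunctions}, 0 < ΛR → ΛR ≤ Λ0 → |B| ≤ ΛR ^ 2 →
      IsPerturbativeFlow K A B ΛR Λ0 L → SmallBare P ΛR Λ0 L → ∀ s,
      wnorm (paramSize ΛR Λ0) N (devFamily L ΛR s)
        ≤ paramSize ΛR Λ0 s * (1 + majorant M (1 + Real.log (Λ0 / ΛR))) := by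
  choose M hM using exists_rhoIrr_bound hK P
  refine ⟨∑ l ∈ monomialsUpTo (Fin 5) N, M l, fun {A B ΛR Λ0 L} hR hle hB h hs s => ?_⟩
  have h0 : 0 < Λ0 := hR.trans_le hle
  have hℓ : 1 ≤ 1 + Real.log (Λ0 / ΛR) := by
    linarith [Real.log_nonneg ((one_le_div hR).2 hle)]
  generalize hℓ' : 1 + Real.log (Λ0 / ΛR) = ℓ at hℓ
  have hmaj := majorant_nonneg (∑ l ∈ monomialsUpTo (Fin 5) N, M l) hℓ
  have hc := paramSize_nonneg hR.le h0.le
  have hX : ∀ i, wnorm (paramSize ΛR Λ0) N (MvPowerSeries.X i)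
      ≤ paramSize ΛR Λ0 i * (1 + majorant (∑ l ∈ monomialsUpTo (Fin 5) N, M l) ℓ) := fun i =>
    (wnorm_X_le hc i).trans (le_mul_of_one_le_right (hc i) (by linarith))
  refine insertBare_forall (H := devSeries L ΛR) (p := fun s f => wnorm (paramSize ΛR Λ0) N f
    ≤ paramSize ΛR Λ0 s * (1 + majorant (∑ l ∈ monomialsUpTo (Fin 5) N, M l) ℓ)) (hX 0) (hX 1)
    (fun a => ?_) s
  calc wnorm (paramSize ΛR Λ0) N (devSeries L ΛR a)
      ≤ ∑ l ∈ monomialsUpTo (Fin 5) N, Λ0⁻¹ * majorant (M l) ℓ := by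
        refine Finset.sum_le_sum fun l _ => ?_
        have hm := majorant_nonneg (M l) hℓ
        rw [coeff_devSeries, monomialAt_paramSize]
        split_ifs with hl
        · rw [abs_zero, zero_mul]
          positivity
        · refine (mul_le_mul_of_nonneg_right (hM l hR hle hB hℓ'.le h hs a)
            (by positivity)).trans (le_of_eq ?_)
          obtain ⟨k, hk⟩ := Nat.exists_eq_succ_of_ne_zero hl
          rw [scaleWeight, irrGain, if_neg hl, hk, Nat.succ_sub_one, pow_one, inv_pow,
            Nat.succ_eq_add_one, pow_succ]
          field_simp
    _ ≤ Λ0⁻¹ * majorant (∑ l ∈ monomialsUpTo (Fin 5) N, M l) ℓ := by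
        rw [← Finset.mul_sum]
        have := sum_majorant_le (monomialsUpTo (Fin 5) N) M hℓ
        gcongr
    _ ≤ _ := by
        rw [paramSize_irr]
        gcongr
        linarith

theorem evalUpTo_eq_sum (N : ℕ) (f : MvPowerSeries (Fin 5) ℝ) (x : Fin 5 → ℝ) :
    evalUpTo N f x
      = ∑ l ∈ monomialsUpTo (Fin 5) N, MvPowerSeries.coeff l f * monomialAt x l := by
  rw [monomialsUpTo, Finset.sum_biUnion]
  · rfl
  · intro d _ d' _ hne
    rw [Function.onFun, Finset.disjoint_left]
    intro l hl hl'
    exact hne ((Finset.mem_finsuppAntidiag.1 hl).1.symm.trans (Finset.mem_finsuppAntidiag.1 hl').1)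

theorem evalUpTo_eq (N : ℕ) (f : MvPowerSeries (Fin 5) ℝ) (x : Fin 5 → ℝ) :
    evalUpTo N f x = truncEval N f x := by
  rw [evalUpTo_eq_sum, truncEval_eq_sum]

/-- Evaluation in dimensionless and in dimensionful parameters. -/
theorem evalUpTo_dimensionless {Λ : ℝ} (hΛ : Λ ≠ 0) (N : ℕ) (f : MvPowerSeries (Fin 5) ℝ)
    {x y : Fin 5 → ℝ} (h0 : y 0 = Λ * x 0) (h1 : y 1 = x 1) (h : ∀ a, y (irr a) = x (irr a) / Λ) :
    evalUpTo N (dimensionless Λ f) x = Λ * evalUpTo N f y := by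
  rw [evalUpTo_eq_sum, evalUpTo_eq_sum, Finset.mul_sum]
  refine Finset.sum_congr rfl fun l _ => ?_
  have h2 : y 2 = x 2 / Λ := h 0
  have h3 : y 3 = x 3 / Λ := h 1
  have h4 : y 4 = x 4 / Λ := h 2
  rw [coeff_dimensionless, zpow_sub₀ hΛ, zpow_add₀ hΛ, zpow_one, zpow_natCast, zpow_natCast]
  simp only [monomialAt, Fin.prod_univ_five, h0, h1, h2, h3, h4, mul_pow, div_pow, orderIrr,
    pow_add]
  field_simp

/-- A point with the irrelevant parameters removed. -/
def relevantPart (x : Fin 5 → ℝ) : Fin 5 → ℝ := ![x 0, x 1, 0, 0, 0]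

theorem monomialAt_relevantPart (x : Fin 5 → ℝ) (l : Order) :
    monomialAt (relevantPart x) l = if orderIrr l = 0 then monomialAt x l else 0 := by
  split_ifs with h
  · simp only [orderIrr] at h
    have h2 : l 2 = 0 := by omega
    have h3 : l 3 = 0 := by omega
    have h4 : l 4 = 0 := by omega
    simp [monomialAt, Fin.prod_univ_five, relevantPart, h2, h3, h4]
  · have : l 2 ≠ 0 ∨ l 3 ≠ 0 ∨ l 4 ≠ 0 := by
      simp only [orderIrr] at h
      omega
    rcases this with h | h | h <;> simp [monomialAt, Fin.prod_univ_five, relevantPart, h]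

theorem evalUpTo_rhoSeries (N : ℕ) (L : VertexFunctions) (Λ : ℝ) (a : Fin 3) (x : Fin 5 → ℝ) :
    evalUpTo N (rhoSeries L Λ a) x
      = evalUpTo N (devSeries L Λ a) x + evalUpTo N (rhoSeries L Λ a) (relevantPart x) := by
  simp only [evalUpTo_eq_sum]
  rw [← Finset.sum_add_distrib]
  refine Finset.sum_congr rfl fun l _ => ?_
  rw [coeff_devSeries, coeff_rhoSeries, monomialAt_relevantPart]
  split_ifs <;> ring

theorem abs_monomialAt_relevant_le {g4 g5 : ℝ} (h4 : |g4| ≤ 1) (h5 : |g5| ≤ 1) (l : Order) :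
    |monomialAt ![g4, g5, 0, 0, 0] l| ≤ if orderIrr l = 0 then 1 else 0 := by
  have := monomialAt_relevantPart ![g4, g5, 0, 0, 0] l
  rw [show relevantPart ![g4, g5, 0, 0, 0] = ![g4, g5, 0, 0, 0] from rfl] at this
  split_ifs with h
  · rw [monomialAt, Finset.abs_prod]
    refine Finset.prod_le_one (fun i _ => abs_nonneg _) fun i _ => ?_
    rw [abs_pow]
    refine pow_le_one₀ (abs_nonneg _) ?_
    fin_cases i
    · exact h4
    · exact h5
    all_goals simp
  · rw [this, if_neg h, abs_zero]

/-- Values of truncated series with nearby coefficients, at vanishing irrelevant parameters. -/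
theorem abs_evalUpTo_sub_le {N : ℕ} {f g : MvPowerSeries (Fin 5) ℝ} {g4 g5 : ℝ} (h4 : |g4| ≤ 1)
    (h5 : |g5| ≤ 1) {D : Order → ℝ} (h : ∀ l, orderIrr l = 0 →
      |MvPowerSeries.coeff l f - MvPowerSeries.coeff l g| ≤ D l) (hD : ∀ l, 0 ≤ D l) :
    |evalUpTo N f ![g4, g5, 0, 0, 0] - evalUpTo N g ![g4, g5, 0, 0, 0]|
      ≤ ∑ l ∈ monomialsUpTo (Fin 5) N, D l := by
  rw [evalUpTo_eq_sum, evalUpTo_eq_sum, ← Finset.sum_sub_distrib]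
  refine (Finset.abs_sum_le_sum_abs _ _).trans (Finset.sum_le_sum fun l _ => ?_)
  rw [← sub_mul, abs_mul]
  have hm := abs_monomialAt_relevant_le h4 h5 l
  split_ifs at hm with hl
  · calc _ ≤ D l * 1 := mul_le_mul (h l hl) hm (abs_nonneg _) (hD l)
      _ = D l := mul_one _
  · rw [le_antisymm hm (abs_nonneg _), mul_zero]
    exact hD l

/-- Since log y = log x + log (y/x), powers of the second logarithm are absorbed by the factor x/y.
With x = Λ₀/Λ_R and y = Λ_D/Λ_R this trades logarithms of Λ_D for logarithms of Λ₀. -/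
theorem exists_pln_le (S : Polynomial ℝ) : ∃ M : ℕ, ∀ x y, 1 ≤ x → x ≤ y →
    x / y * pln S y ≤ majorant M (1 + Real.log x) := by
  obtain ⟨M, hM⟩ := exists_majorant_polynomial S
  obtain ⟨M', hM'⟩ := exists_majorant (M * (M.factorial * Real.exp 1)) M
  refine ⟨M', fun x y hx hxy => le_trans ?_ (hM' _ (by linarith [Real.log_nonneg hx]))⟩
  have hx0 : 0 < x := by linarith
  have hy0 : 0 < y := by linarith
  have hlx := Real.log_nonneg hx
  have hu : 1 ≤ y / x := (one_le_div hx0).2 hxy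
  have hlu := Real.log_nonneg hu
  have hly : Real.log y = Real.log x + Real.log (y / x) := by
    rw [← Real.log_mul hx0.ne' (by positivity), mul_div_cancel₀ _ hx0.ne']
  have h1 : pln S y ≤ majorant M ((1 + Real.log x) * (1 + Real.log (y / x))) :=
    hM _ _ (Real.log_nonneg (hx.trans hxy)) (by
      rw [hly]
      nlinarith [mul_nonneg hlx hlu])
  calc x / y * pln S y
      ≤ x / y * majorant M ((1 + Real.log x) * (1 + Real.log (y / x))) := by gcongr
    _ = x / y * (M * (1 + Real.log x) ^ M) * (1 + Real.log (y / x)) ^ M := by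
        rw [majorant, mul_pow]; ring
    _ ≤ x / y * (M * (1 + Real.log x) ^ M) * (M.factorial * Real.exp 1 * (y / x)) := by
        gcongr
        exact one_add_log_pow_le M hu
    _ = _ := by field_simp

/-! ### Bounds on the coefficients of the inverse -/

/-- Part one of the inversion: the bare couplings are the deviations at the bare scale. -/
theorem coeffBound_lamBare {K : ℝ → ℝ} {A B ΛR Λ0 : ℝ} {L : VertexFunctions} (hR : 0 < ΛR)
    (hle : ΛR ≤ Λ0) (h : IsPerturbativeFlow K A B ΛR Λ0 L) {H : Fin 3 → MvPowerSeries (Fin 5) ℝ}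
    (hH : IsInversion L ΛR H) {Q : Fin 3 → Order → Polynomial ℝ}
    (hQ : CoeffBound Q ΛR Λ0 (lamDev L H)) : CoeffBound Q ΛR Λ0 (lamBare H) := by
  have h0 : 0 < Λ0 := hR.trans_le hle
  have hsub := MvPowerSeries.hasSubst_of_constantCoeff_zero
    (constantCoeff_insertBare hH.constantCoeff)
  -- At the bare scale the initial conditions say that the deviation is the bare coupling, so
  -- substituting the inverse returns the inverse itself.
  have hdev : ∀ a, devSeries L Λ0 a = MvPowerSeries.X (irr a) := by
    intro a
    ext r
    rw [coeff_devSeries, h.initial, MvPowerSeries.coeff_X]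
    split_ifs with h1 h2
    · rw [h2, orderIrr_single_irr] at h1
      exact absurd h1 one_ne_zero
    all_goals rfl
  have htop : ∀ a, lamDev L H Λ0 a = lamBare H Λ0 a := by
    intro a
    rw [lamDev, lamBare, hdev, MvPowerSeries.subst_X hsub, insertBare_irr]
  intro a l Λ hΛ
  have hΛ0 : 0 < Λ := hR.trans_le hΛ.1
  have key := hQ a l Λ0 (right_mem_Icc.2 hle)
  rw [htop, lamBare, coeff_dimensionless, div_self h0.ne', one_pow, mul_one, mul_one] at key
  have e : ∀ {x : ℝ}, x ≠ 0 → x ^ (1 + (l 0 : ℤ) - (orderIrr l : ℤ))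
      = x * x ^ l 0 / x ^ orderIrr l := fun hx => by
    rw [zpow_sub₀ hx, zpow_add₀ hx, zpow_one, zpow_natCast, zpow_natCast]
  rw [lamBare, coeff_dimensionless, e hΛ0.ne', abs_mul, abs_of_pos (by positivity)]
  rw [e h0.ne', abs_mul, abs_of_pos (by positivity)] at key
  calc Λ * Λ ^ l 0 / Λ ^ orderIrr l * |MvPowerSeries.coeff l (H a)|
      = (Λ / Λ0) * (Λ / Λ0) ^ l 0 * (Λ0 / Λ) ^ orderIrr l
        * (Λ0 * Λ0 ^ l 0 / Λ0 ^ orderIrr l * |MvPowerSeries.coeff l (H a)|) := by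
        simp only [div_pow]
        field_simp
    _ ≤ (Λ / Λ0) * (Λ / Λ0) ^ l 0 * (Λ0 / Λ) ^ orderIrr l
        * ((Λ0 / ΛR) ^ l 0 * pln (Q a l) (Λ0 / ΛR)) := by gcongr
    _ = _ := by
        simp only [div_pow]
        field_simp

/-! ### Bare couplings and improvement conditions for prescribed values -/

/-- The expansion parameters belonging to the deviations `δ` at the renormalization scale. -/
def devPoint (ΛR g4 g5 : ℝ) (δ : Fin 3 → ℝ) : Fin 5 → ℝ :=
  ![ΛR * g4, g5, δ 0 / ΛR, δ 1 / ΛR, δ 2 / ΛR]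

theorem devPoint_irr (ΛR g4 g5 : ℝ) (δ : Fin 3 → ℝ) (a : Fin 3) :
    devPoint ΛR g4 g5 δ (irr a) = δ a / ΛR := by
  fin_cases a <;> rfl

theorem bareValue_eq {ΛR Λ : ℝ} (hΛ : Λ ≠ 0) (N : ℕ) (H : Fin 3 → MvPowerSeries (Fin 5) ℝ)
    (g4 g5 : ℝ) (δ : Fin 3 → ℝ) (a : Fin 3) :
    bareValue N H ΛR g4 g5 δ Λ a = Λ * truncEval N (H a) (devPoint ΛR g4 g5 δ) := by
  rw [bareValue, lamBare, ← evalUpTo_eq]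
  refine evalUpTo_dimensionless hΛ N (H a) ?_ rfl fun b => ?_
  · change ΛR * g4 = Λ * (ΛR / Λ * g4)
    field_simp
  · rw [devPoint_irr]
    have : (![ΛR / Λ * g4, g5, Λ / ΛR * δ 0, Λ / ΛR * δ 1, Λ / ΛR * δ 2] : Fin 5 → ℝ) (irr b)
        = Λ / ΛR * δ b := by
      fin_cases b <;> rfl
    rw [this]
    field_simp

theorem truncEval_zero_congr (f : MvPowerSeries (Fin 5) ℝ) (x y : Fin 5 → ℝ) :
    truncEval 0 f x = truncEval 0 f y := by
  rw [truncEval_eq_sum, truncEval_eq_sum]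
  refine Finset.sum_congr rfl fun l hl => ?_
  obtain rfl : l = 0 := (Finsupp.degree_eq_zero_iff l).1 (Nat.le_zero.1 (mem_monomialsUpTo.1 hl))
  simp [monomialAt]

/-- The violation of the improvement conditions in terms of the composition of the expansion of
the deviations with its inverse. -/
theorem evalUpTo_lamSeries_sub {ΛR : ℝ} (hR : ΛR ≠ 0) (N : ℕ) (L : VertexFunctions)
    (H : Fin 3 → MvPowerSeries (Fin 5) ℝ) (g4 g5 : ℝ) (ν : Fin 3 → ℝ) (a : Fin 3) :
    evalUpTo N (lamSeries L ΛR a) ![g4, g5,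
        bareValue N H ΛR g4 g5 (prescribedDev N L ΛR g4 g5 ν) ΛR 0,
        bareValue N H ΛR g4 g5 (prescribedDev N L ΛR g4 g5 ν) ΛR 1,
        bareValue N H ΛR g4 g5 (prescribedDev N L ΛR g4 g5 ν) ΛR 2] - ν a
      = ΛR * (truncEval N (devFamily L ΛR (irr a))
          (fun i => truncEval N (insertBare H i)
            (devPoint ΛR g4 g5 (prescribedDev N L ΛR g4 g5 ν)))
        - devPoint ΛR g4 g5 (prescribedDev N L ΛR g4 g5 ν) (irr a)) := by
  have hδ : prescribedDev N L ΛR g4 g5 ν a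
      = ν a - evalUpTo N (lamSeries L ΛR a) ![g4, g5, 0, 0, 0] := rfl
  generalize prescribedDev N L ΛR g4 g5 ν = δ at *
  let x := devPoint ΛR g4 g5 δ
  let y : Fin 5 → ℝ := ![ΛR * g4, g5, truncEval N (H 0) x, truncEval N (H 1) x,
    truncEval N (H 2) x]
  have h1 : evalUpTo N (lamSeries L ΛR a) ![g4, g5, bareValue N H ΛR g4 g5 δ ΛR 0,
      bareValue N H ΛR g4 g5 δ ΛR 1, bareValue N H ΛR g4 g5 δ ΛR 2]
      = ΛR * evalUpTo N (rhoSeries L ΛR a) y := by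
    refine evalUpTo_dimensionless hR N _ rfl rfl fun b => ?_
    simp only [bareValue_eq hR]
    fin_cases b
    · exact (mul_div_cancel_left₀ _ hR).symm
    · exact (mul_div_cancel_left₀ _ hR).symm
    · exact (mul_div_cancel_left₀ _ hR).symm
  have h2 : evalUpTo N (lamSeries L ΛR a) ![g4, g5, 0, 0, 0]
      = ΛR * evalUpTo N (rhoSeries L ΛR a) (relevantPart y) := by
    refine evalUpTo_dimensionless hR N _ rfl rfl fun b => ?_
    fin_cases b <;> exact (zero_div _).symm
  have h3 : truncEval N (devFamily L ΛR (irr a)) (fun i => truncEval N (insertBare H i) x)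
      = evalUpTo N (devSeries L ΛR a) y := by
    rw [evalUpTo_eq, devFamily, insertBare_irr]
    -- For N = 0 truncation removes even the variables, so the points of evaluation differ; but a
    -- series truncated to its constant term does not depend on the point.
    rcases eq_or_ne N 0 with rfl | hN
    · exact truncEval_zero_congr _ _ _
    · congr 1
      funext i
      fin_cases i
      · exact truncEval_X hN 0 x
      · exact truncEval_X hN 1 x
      all_goals rfl
  rw [h1, evalUpTo_rhoSeries, h3, devPoint_irr, hδ, h2]
  field_simp
  ring

theorem abs_devPoint_le {ΛR Λ0 g4 g5 t : ℝ} {δ : Fin 3 → ℝ} (hR : 0 < ΛR) (h0 : 0 < Λ0)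
    (h4 : |g4| ≤ t) (h5 : |g5| ≤ t) (hδ : ∀ a, Λ0 / ΛR * |δ a| ≤ t) (i : Fin 5) :
    |devPoint ΛR g4 g5 δ i| ≤ paramSize ΛR Λ0 i * t := by
  have hirr : ∀ a, |δ a / ΛR| ≤ Λ0⁻¹ * t := by
    intro a
    rw [abs_div, abs_of_pos hR, inv_mul_eq_div, le_div_iff₀ h0]
    calc |δ a| / ΛR * Λ0 = Λ0 / ΛR * |δ a| := by ring
      _ ≤ t := hδ a
  fin_cases i
  · change |ΛR * g4| ≤ ΛR * t
    rw [abs_mul, abs_of_pos hR]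
    gcongr
  · change |g5| ≤ 1 * t
    rwa [one_mul]
  · exact hirr 0
  · exact hirr 1
  · exact hirr 2

/-- Smallness of the deviations belonging to prescribed values close to the continuum limit. -/
theorem scaled_prescribedDev_le {ΛR Λ0 ΛD g4 g5 X Y : ℝ} {N : ℕ} {L : VertexFunctions}
    {ν : Fin 3 → ℝ} {a : Fin 3} {c : MvPowerSeries (Fin 5) ℝ} (hR : 0 < ΛR) (h0 : 0 < Λ0)
    (hν : |ν a - evalUpTo N c ![g4, g5, 0, 0, 0]| ≤ X)
    (hc : |evalUpTo N (lamSeries L ΛR a) ![g4, g5, 0, 0, 0] - evalUpTo N c ![g4, g5, 0, 0, 0]|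
      ≤ ΛR / Λ0 * Y) (hX : Λ0 / ΛR * X ≤ ΛD) :
    Λ0 / ΛR * |prescribedDev N L ΛR g4 g5 ν a| ≤ ΛD + Y := by
  have h1 : |prescribedDev N L ΛR g4 g5 ν a| ≤ X + ΛR / Λ0 * Y := by
    rw [prescribedDev]
    rw [abs_sub_comm] at hc
    exact (abs_sub_le _ (evalUpTo N c ![g4, g5, 0, 0, 0]) _).trans (add_le_add hν hc)
  calc _ ≤ Λ0 / ΛR * (X + ΛR / Λ0 * Y) := by gcongr
    _ = Λ0 / ΛR * X + Y := by field_simp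
    _ ≤ _ := by linarith

/-- Bounds on the bare couplings and on the violation of the improvement conditions, given a bound
`E` on the scaled deviations. -/
theorem exists_trajectory_bound {K : ℝ → ℝ} (hK : IsCutoff K) (P : Order → ℕ → ℕ → Polynomial ℝ)
    (N : ℕ) {E : ℝ → ℝ} (hE : Moderate E) (hE1 : ∀ x, 1 ≤ x → 1 ≤ E x) :
    ∃ T : Polynomial ℝ, NonnegCoeffs T ∧
      ∀ {A B ΛR Λ0 g4 g5 : ℝ} {L : VertexFunctions} {H : Fin 3 → MvPowerSeries (Fin 5) ℝ}
        {ν : Fin 3 → ℝ}, 0 < ΛR → ΛR ≤ Λ0 → |B| ≤ ΛR ^ 2 →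
        IsPerturbativeFlow K A B ΛR Λ0 L → SmallBare P ΛR Λ0 L → IsInversion L ΛR H →
        |g4| ≤ 1 → |g5| ≤ 1 →
        (∀ a, Λ0 / ΛR * |prescribedDev N L ΛR g4 g5 ν a| ≤ E (1 + Real.log (Λ0 / ΛR))) →
        let δ := prescribedDev N L ΛR g4 g5 ν
        let lam0 := bareValue N H ΛR g4 g5 δ
        (∀ a, ∀ Λ ∈ Icc ΛR Λ0, |lam0 Λ a| ≤ Λ / Λ0 * pln T (Λ0 / ΛR)) ∧
        ∀ a, ∀ ε : ℝ, |g4| ≤ ε → |g5| ≤ ε → (∀ b, Λ0 / ΛR * |δ b| ≤ ε) →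
          |evalUpTo N (lamSeries L ΛR a) ![g4, g5, lam0 ΛR 0, lam0 ΛR 1, lam0 ΛR 2] - ν a|
            ≤ ΛR / Λ0 * pln T (Λ0 / ΛR) * ε ^ (N + 1) := by
  obtain ⟨M, hM⟩ := exists_wnorm_devFamily_le hK P N
  -- The first summand bounds the expansion of the deviations. The second bounds its inverse, where
  -- the additional 1 accounts for subtracting the identity part.
  let β : ℝ → ℝ := fun x => (1 + majorant M x) + inverseBound ((1 + majorant M x) + 1) N
  have hβm : Moderate β := ((moderate_const 1).add (moderate_majorant M)).add
    (Moderate.inverseBound (((moderate_const 1).add (moderate_majorant M)).add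
      (moderate_const 1)) N)
  obtain ⟨T, hT, hT'⟩ := (((hE.pow N).mul hβm).add
    ((hβm.mul (((hE.pow N).mul hβm).pow N)).add hE)).exists_polynomial
  refine ⟨T, hT, ?_⟩
  intro A B ΛR Λ0 g4 g5 L H ν hR hle hB h hs hH h4 h5 hδ δ lam0
  have h0 : 0 < Λ0 := hR.trans_le hle
  have hx : 1 ≤ Λ0 / ΛR := (one_le_div hR).2 hle
  have hTx := hT' _ hx
  have hℓ : 1 ≤ 1 + Real.log (Λ0 / ΛR) := by linarith [Real.log_nonneg hx]
  have hwn := hM hR hle hB h hs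
  generalize 1 + Real.log (Λ0 / ΛR) = ℓ at hδ hTx hℓ hwn
  have hEℓ := hE1 ℓ hℓ
  have hm := majorant_nonneg M hℓ
  have hib := one_le_inverseBound (b := (1 + majorant M ℓ) + 1) (by linarith) N
  have hβ : β ℓ = (1 + majorant M ℓ) + inverseBound ((1 + majorant M ℓ) + 1) N := rfl
  have hβ1 : 1 ≤ β ℓ := by linarith
  have hEβ : 0 ≤ E ℓ ^ N * β ℓ := by positivity
  have hEβ' : 0 ≤ β ℓ * (E ℓ ^ N * β ℓ) ^ N := by positivity
  have hc := paramSize_nonneg hR.le h0.le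
  obtain ⟨hG, hGX⟩ := isInversion_iff.1 hH
  have hFb : ∀ s, wnorm (paramSize ΛR Λ0) N (devFamily L ΛR s) ≤ paramSize ΛR Λ0 s * β ℓ :=
    fun s => (hwn s).trans (mul_le_mul_of_nonneg_left (by linarith) (hc s))
  have hGb : ∀ s, wnorm (paramSize ΛR Λ0) N (insertBare H s) ≤ paramSize ΛR Λ0 s * β ℓ := by
    intro s
    refine (wnorm_inverse_le hc (devSeries_order h hle) hG hGX (N := N)
      (b := (1 + majorant M ℓ) + 1) (by linarith) (fun s => ?_) N le_rfl s).trans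
      (mul_le_mul_of_nonneg_left (by linarith) (hc s))
    rw [mul_add, mul_one]
    exact (wnorm_sub_le hc).trans (add_le_add (hwn s) (wnorm_X_le hc s))
  refine ⟨fun a Λ hΛ => ?_, fun a ε hε4 hε5 hε => ?_⟩
  · have hΛ0 : 0 < Λ := hR.trans_le hΛ.1
    have hpt := abs_devPoint_le hR h0 (h4.trans hEℓ) (h5.trans hEℓ) hδ
    have key := abs_truncEval_le hc (N := N) (f := H a) hEℓ hpt
    have hHa := hGb (irr a)
    rw [insertBare_irr, paramSize_irr] at hHa
    simp only [lam0]
    rw [bareValue_eq hΛ0.ne', abs_mul, abs_of_pos hΛ0]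
    calc Λ * |truncEval N (H a) (devPoint ΛR g4 g5 δ)|
        ≤ Λ * (E ℓ ^ N * (Λ0⁻¹ * β ℓ)) := by
          gcongr
          exact key.trans (by gcongr)
      _ = Λ / Λ0 * (E ℓ ^ N * β ℓ) := by ring
      _ ≤ _ := by gcongr; linarith
  · have hε0 : 0 ≤ ε := (abs_nonneg _).trans hε4
    have ht0 : 0 ≤ min ε (E ℓ) := le_min hε0 (by linarith)
    -- The number ε is arbitrary, possibly larger than E. Its minimum with E keeps the higher powers
    -- under the uniform bound while still producing ε^(N+1).
    have hpt := abs_devPoint_le hR h0 (t := min ε (E ℓ)) (le_min hε4 (h4.trans hEℓ))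
      (le_min hε5 (h5.trans hEℓ)) fun b => le_min (hε b) (hδ b)
    have key := abs_truncEval_comp_sub_le hc hG hGX hβ1 hFb hGb ht0 hEℓ (min_le_right _ _) hpt
      (irr a)
    rw [paramSize_irr] at key
    simp only [lam0, δ]
    rw [evalUpTo_lamSeries_sub hR.ne', abs_mul, abs_of_pos hR]
    refine (mul_le_mul_of_nonneg_left key hR.le).trans ?_
    have hpow : min ε (E ℓ) ^ (N + 1) ≤ ε ^ (N + 1) :=
      pow_le_pow_left₀ ht0 (min_le_left _ _) _
    calc ΛR * (Λ0⁻¹ * (β ℓ * (E ℓ ^ N * β ℓ) ^ N + E ℓ) * min ε (E ℓ) ^ (N + 1))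
        ≤ ΛR * (Λ0⁻¹ * (β ℓ * (E ℓ ^ N * β ℓ) ^ N + E ℓ) * ε ^ (N + 1)) := by gcongr
      _ = ΛR / Λ0 * (β ℓ * (E ℓ ^ N * β ℓ) ^ N + E ℓ) * ε ^ (N + 1) := by ring
      _ ≤ _ := by gcongr; linarith

end RGFlow
end

/-! ### Assembly of the two parts -/

theorem mainTheorem3 (K : ℝ → ℝ) (hK : RGFlow.IsCutoff K)
    (P : RGFlow.Order → ℕ → ℕ → Polynomial ℝ) (hP : ∀ r m p, RGFlow.NonnegCoeffs (P r m p)) :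
    (∀ Q : Fin 3 → RGFlow.Order → Polynomial ℝ, (∀ a l, RGFlow.NonnegCoeffs (Q a l)) →
      ∃ R : Fin 3 → RGFlow.Order → Polynomial ℝ, (∀ a l, RGFlow.NonnegCoeffs (R a l)) ∧
        ∀ (ΛR Λ0 A B : ℝ) (L : RGFlow.VertexFunctions),
          0 < ΛR → ΛR ≤ Λ0 → |A| ≤ ΛR ^ 3 → |B| ≤ ΛR ^ 2 →
          RGFlow.IsPerturbativeFlow K A B ΛR Λ0 L → RGFlow.SmallBare P ΛR Λ0 L →
          (∃! H, RGFlow.IsInversion L ΛR H) ∧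
          ∀ H, RGFlow.IsInversion L ΛR H →
            RGFlow.CoeffBound Q ΛR Λ0 (RGFlow.lamDev L H) →
            RGFlow.CoeffBound R ΛR Λ0 (RGFlow.lamBare H)) ∧
    (∀ (N : ℕ) (S : Polynomial ℝ), RGFlow.NonnegCoeffs S →
      ∃ T : Polynomial ℝ, RGFlow.NonnegCoeffs T ∧
        ∀ (ΛR A B : ℝ) (L : ℝ → RGFlow.VertexFunctions),
          0 < ΛR → |A| ≤ ΛR ^ 3 → |B| ≤ ΛR ^ 2 →
          (∀ Λ0, ΛR ≤ Λ0 → RGFlow.IsPerturbativeFlow K A B ΛR Λ0 (L Λ0) ∧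
            RGFlow.SmallBare P ΛR Λ0 (L Λ0)) →
          ∃ lamCont : Fin 3 → MvPowerSeries (Fin 5) ℝ,
            (∀ a r, RGFlow.orderIrr r = 0 →
              Tendsto (fun Λ0 => MvPowerSeries.coeff r (RGFlow.lamSeries (L Λ0) ΛR a)) atTop
                (𝓝 (MvPowerSeries.coeff r (lamCont a)))) ∧
            ∀ (ΛD Λ0 g4 g5 : ℝ) (ν : Fin 3 → ℝ) (H : Fin 3 → MvPowerSeries (Fin 5) ℝ),
              ΛR < ΛD → ΛR ≤ Λ0 → Λ0 ≤ ΛD → |g4| ≤ 1 → |g5| ≤ 1 →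
              (∀ a, |ν a - RGFlow.evalUpTo N (lamCont a) ![g4, g5, 0, 0, 0]|
                ≤ ΛR / ΛD * RGFlow.pln S (ΛD / ΛR)) →
              RGFlow.IsInversion (L Λ0) ΛR H →
              let δ := RGFlow.prescribedDev N (L Λ0) ΛR g4 g5 ν
              let lam0 := RGFlow.bareValue N H ΛR g4 g5 δ
              (∀ a, ∀ Λ ∈ Set.Icc ΛR Λ0,
                |lam0 Λ a| ≤ Λ / Λ0 * RGFlow.pln T (Λ0 / ΛR)) ∧
              (∀ a, ∀ ε : ℝ, |g4| ≤ ε → |g5| ≤ ε → (∀ b, Λ0 / ΛR * |δ b| ≤ ε) →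
                |RGFlow.evalUpTo N (RGFlow.lamSeries (L Λ0) ΛR a)
                    ![g4, g5, lam0 ΛR 0, lam0 ΛR 1, lam0 ΛR 2] - ν a|
                  ≤ ΛR / Λ0 * RGFlow.pln T (Λ0 / ΛR) * ε ^ (N + 1))) := by
  -- The polynomials of the hypothesis serve unchanged in the conclusion of the first part.
  refine ⟨fun Q hQ => ⟨Q, hQ, fun ΛR Λ0 A B L hR hle _ _ h _ =>
    ⟨RGFlow.existsUnique_isInversion h hle, fun H hH hb =>
      RGFlow.coeffBound_lamBare hR hle h hH hb⟩⟩, fun N S _ => ?_⟩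
  choose Ml hMl using fun (r : RGFlow.Order) (hr : RGFlow.orderIrr r = 0) =>
    RGFlow.exists_lamSeries_limit hK P hr
  obtain ⟨Ms, hMs⟩ := RGFlow.exists_pln_le S
  -- Orders containing irrelevant couplings do not enter the continuum series; they receive the
  -- value zero.
  let M : RGFlow.Order → ℕ := fun r => if hr : RGFlow.orderIrr r = 0 then Ml r hr else 0
  let Mt : ℕ := ∑ l ∈ RGFlow.monomialsUpTo (Fin 5) N, M l
  obtain ⟨T, hT, hbound⟩ := RGFlow.exists_trajectory_bound hK P N
    -- The three terms keep E at least 1, bound the distance of the prescribed values from the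
    -- continuum limit, and bound the distance of the cutoff values from it.
    (E := fun x => 1 + (RGFlow.majorant Ms x + RGFlow.majorant Mt x))
    ((RGFlow.moderate_const 1).add ((RGFlow.moderate_majorant Ms).add
      (RGFlow.moderate_majorant Mt)))
    (fun x hx => by linarith [RGFlow.majorant_nonneg Ms hx, RGFlow.majorant_nonneg Mt hx])
  refine ⟨T, hT, fun ΛR A B L hR _ hB hL => ?_⟩
  choose lim hlim hrate using fun r hr => hMl r hr hR hB hL
  refine ⟨fun a r => if hr : RGFlow.orderIrr r = 0 then lim r hr a else 0, fun a r hr => ?_, ?_⟩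
  · have e : MvPowerSeries.coeff r (fun r => if hr : RGFlow.orderIrr r = 0 then lim r hr a else 0 :
        MvPowerSeries (Fin 5) ℝ) = lim r hr a := dif_pos hr
    rw [e]
    exact hlim r hr a
  · intro ΛD Λ0 g4 g5 ν H hD hle hleD h4 h5 hν hH
    have h0 : 0 < Λ0 := hR.trans_le hle
    have hx : 1 ≤ Λ0 / ΛR := (one_le_div hR).2 hle
    have hℓ : 1 ≤ 1 + Real.log (Λ0 / ΛR) := by linarith [Real.log_nonneg hx]
    refine hbound hR hle hB (hL Λ0 hle).1 (hL Λ0 hle).2 hH h4 h5 fun a => ?_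
    refine (RGFlow.scaled_prescribedDev_le (X := ΛR / ΛD * RGFlow.pln S (ΛD / ΛR))
      (Y := RGFlow.majorant Mt (1 + Real.log (Λ0 / ΛR)))
      (ΛD := RGFlow.majorant Ms (1 + Real.log (Λ0 / ΛR))) hR h0 (hν a) ?_ ?_).trans
      (by linarith)
    · refine (RGFlow.abs_evalUpTo_sub_le h4 h5
        (D := fun l => ΛR / Λ0 * RGFlow.majorant (M l) (1 + Real.log (Λ0 / ΛR)))
        (fun l hl => ?_) fun l => ?_).trans ?_
      · have e : MvPowerSeries.coeff l (fun r => if hr : RGFlow.orderIrr r = 0 then lim r hr a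
            else 0 : MvPowerSeries (Fin 5) ℝ) = lim l hl a := dif_pos hl
        have eM : M l = Ml l hl := dif_pos hl
        rw [e, eM]
        exact hrate l hl a Λ0 hle
      · have := RGFlow.majorant_nonneg (M l) hℓ
        positivity
      · rw [← Finset.mul_sum]
        exact mul_le_mul_of_nonneg_left (RGFlow.sum_majorant_le _ _ hℓ) (by positivity)
    · refine le_trans (le_of_eq ?_) (hMs (Λ0 / ΛR) (ΛD / ΛR) hx
        (div_le_div_of_nonneg_right hleD hR.le))
      have := hR.trans hD
      field_simp
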